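/- **Conventions.** A knot diagram $D$ is an oriented regular closed $C^1$ curve embedded in $\mathbb R^3=\mathbb R^2\times\mathbb R$ whose projection to $\mathbb R^2$ is an immersion with transverse double points only; heights give the crossing information. An over-underpass sequence of $D$ consists of points $s_1,f_1,\dots,s_k,f_k$ in cyclic order on $D$, none of them a crossing, such that each overpass $[s_i,f_i]$ contains at least one overcrossing and no undercrossing, and each underpass $[f_i,s_{i+1}]$ (with $s_{k+1}=s_1$) contains at least one undercrossing and no overcrossing. A component $L$ without self-crossings always crosses $D$ transversely and away from the crossings of $D$; $lk(D,L)$ is the sum of the signs of the crossings at which $D$ passes over $L$. An oriented two-component link $K\sqcup T$ in $S^3=\mathbb R^3\cup\{\infty\}$ is *braided* if it is isotopic to a closed braid together with its oriented axis, that is, to a link $K'\sqcup T'$ where $T'$ is the first coordinate axis with $\infty$, oriented from left to right, and $K'$ turns around $T'$ with everywhere positive angular velocity. **Minimal semi-threadings.** Let $D$ have at least one crossing. Choose an over-underpass sequence ($k\ge 1$) and a compactly supported $C^1$ isotopy of the plane after which the overpasses are vertical segments directed downward, ordered from left to right, each crossing the first coordinate axis, and after which $D$ meets this axis transversely and away from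 its crossings. Choose $a<b$ such that all overpasses lie strictly between the lines $x=a$ and $x=b$, and $\varepsilon>0$ such that all overpasses end below $y=-\varepsilon$. Consider the stadium-shaped simple closed curve consisting of the front arc $[a,b]\times\{0\}$, the back arc $[a,b]\times\{-\varepsilon\}$ and two semicircular ends; require that the region it bounds contains no crossing of $D$ and that $D$ does not meet the ends. Orient it from left to right on the front arc. Let the front arc pass below the overpasses and above the underpasses of $D$, and let the back arc pass above $D$ everywhere. The resulting closed curve (moved back by the plane isotopy) is called a *minimal semi-threading circle* $M_D$ of $D$, and $D\sqcup M_D$ a *minimal semi-threading*. The corresponding *extended semi-threading circle* $T_0$ is the whole first coordinate axis (moved back by the plane isotopy), closed up by $\infty$ and oriented from left to right, which passes below the overpasses and above the underpasses of $D$. If $D$ has no crossing, a minimal semi-threading circle is any simple closed curve $M_D$ in the plane, with crossing information, such that $D\sqcup M_D$ is a diagram of the positive Hopf link. **Lemma.** Let $D$ be a knot diagram and $D\sqcup M_D$ a minimal semi-threading of $D$ that is not braided. Then an extended semi-threading circle of $D$ belonging to $M_D$ exists, and for every such $T_0$ there is a circle $T$ obtained from $T_0$ by changing some of its crossings with $D$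 (so $T$ and $T_0$ have the same projection) such that $T$ is a threading circle of $D$, i.e. $D\sqcup T$ is a link diagram with $lk(D,T)>0$ and the link $D\sqcup T$ is braided, and $$lk(D,M_D)<lk(D,T).$$ -/

import Mathlib

open Set Function

noncomputable section

namespace SemiThreading

/-- The plane of projection. -/
abbrev Plane : Type := ℝ × ℝ

/-- Euclidean 3-space, a point being its projection to the plane together with its height. -/
abbrev Space : Type := Plane × ℝ

/-- Two parameters of a 1-periodic curve that denote the same point of the circle. -/
def SameParam (u v : ℝ) : Prop := ∃ n : ℤ, v = u + n

/-- The velocity of the planar projection of a curve. -/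
def planeVel (L : ℝ → Space) (u : ℝ) : Plane := deriv (fun v => (L v).1) u

def planeDet (p q : Plane) : ℝ := p.1 * q.2 - p.2 * q.1

/-! ### Knot diagrams -/

/-- An oriented knot diagram: a regular closed `C¹` curve embedded in space whose projection
is an immersion with transverse double points only. The heights at the two preimages of a
double point say which strand is the upper one. -/
structure IsKnotDiagram (D : ℝ → Space) : Prop where
  contDiff : ContDiff ℝ 1 D
  periodic : Periodic D 1
  simple : ∀ u v, D u = D v → SameParam u v
  immersed : ∀ u, planeVel D u ≠ 0
  transverse : ∀ u v, (D u).1 = (D v).1 → ¬ SameParam u v →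
    planeDet (planeVel D u) (planeVel D v) ≠ 0
  no_triple : ∀ u v w, (D u).1 = (D v).1 → (D v).1 = (D w).1 →
    SameParam u v ∨ SameParam v w ∨ SameParam u w

def IsOvercrossing (D : ℝ → Space) (u : ℝ) : Prop :=
  ∃ v, (D u).1 = (D v).1 ∧ (D v).2 < (D u).2

def IsUndercrossing (D : ℝ → Space) (u : ℝ) : Prop :=
  ∃ v, (D u).1 = (D v).1 ∧ (D u).2 < (D v).2

def IsCrossing (D : ℝ → Space) (u : ℝ) : Prop :=
  IsOvercrossing D u ∨ IsUndercrossing D u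

/-- `σ i` and `φ i` are the parameters of the points `s_i`, `f_i` of an over-underpass sequence
with `k` overpasses; the indices run through `ℤ` and are understood modulo `k`. The overpasses
are the arcs over `[σ i, φ i]`, the underpasses are the arcs over `[φ i, σ (i + 1)]`. -/
structure IsOverUnderSequence (D : ℝ → Space) (k : ℕ) (σ φ : ℤ → ℝ) : Prop where
  start_lt_finish : ∀ i, σ i < φ i
  finish_lt_start : ∀ i, φ i < σ (i + 1)
  start_period : ∀ i, σ (i + k) = σ i + 1
  finish_period : ∀ i, φ (i + k) = φ i + 1
  start_not_crossing : ∀ i, ¬ IsCrossing D (σ i)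
  finish_not_crossing : ∀ i, ¬ IsCrossing D (φ i)
  overpass : ∀ i, (∃ u ∈ Icc (σ i) (φ i), IsOvercrossing D u) ∧
    ∀ u ∈ Icc (σ i) (φ i), ¬ IsUndercrossing D u
  underpass : ∀ i, (∃ u ∈ Icc (φ i) (σ (i + 1)), IsUndercrossing D u) ∧
    ∀ u ∈ Icc (φ i) (σ (i + 1)), ¬ IsOvercrossing D u

/-! ### A second component without self-crossings -/

/-- A closed curve whose projection is an oriented simple closed `C¹` curve in the plane. -/
structure IsPlaneCircle (L : ℝ → Space) : Prop where
  contDiff : ContDiff ℝ 1 L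
  periodic : Periodic L 1
  simple : ∀ u v, (L u).1 = (L v).1 → SameParam u v
  immersed : ∀ u, planeVel L u ≠ 0

/-- A curve whose projection is a simple `C¹` curve and which is the first coordinate axis
(run through from left to right) outside a compact set. Together with the point at infinity it
is a simple closed curve in the 3-sphere. -/
structure IsLineThroughInfinity (L : ℝ → Space) : Prop where
  contDiff : ContDiff ℝ 1 L
  simple : ∀ u v, (L u).1 = (L v).1 → u = v
  immersed : ∀ u, planeVel L u ≠ 0
  straight : ∃ R : ℝ, ∀ s, R ≤ |s| → L s = ((s, 0), 0)

/-- `D ⊔ L` is a link diagram: `D` and `L` cross transversely, away from the crossings of `D`,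
and one of them is the upper strand. -/
def CrossRegularly (D L : ℝ → Space) : Prop :=
  ∀ u v, (D u).1 = (L v).1 →
    (D u).2 ≠ (L v).2 ∧ planeDet (planeVel D u) (planeVel L v) ≠ 0 ∧ ¬ IsCrossing D u

/-- The linking number of `D` and `L`: the sum of the signs of the crossings at which `D` passes
over `L`. A crossing is positive if the upper velocity followed by the lower velocity is a
positively oriented basis of the plane. The set `I` contains one parameter for each point
of `L`. -/
def linkingNumberOn (I : Set ℝ) (D L : ℝ → Space) : ℤ :=
  ∑ᶠ p ∈ {p : ℝ × ℝ | p.1 ∈ Ico (0 : ℝ) 1 ∧ p.2 ∈ I ∧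
      (D p.1).1 = (L p.2).1 ∧ (L p.2).2 < (D p.1).2},
    ((SignType.sign (planeDet (planeVel D p.1) (planeVel L p.2)) : SignType) : ℤ)

/-- `lk(D, L)` for a closed curve `L`. -/
def lkCircle (D L : ℝ → Space) : ℤ := linkingNumberOn (Ico 0 1) D L

/-- `lk(D, L)` for a line `L` through infinity. -/
def lkLine (D L : ℝ → Space) : ℤ := linkingNumberOn univ D L

/-! ### Links in the 3-sphere, isotopy, closed braids -/

/-- The ambient space of the 3-sphere `{(z, w) : |z|² + |w|² = 1}`. -/
abbrev C2 : Type := ℂ × ℂ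

/-- Inverse stereographic projection from space to the 3-sphere. The point at infinity is
`(I, 0)`; the first coordinate axis together with infinity is the circle `w = 0`. -/
def toSphere (p : Space) : C2 :=
  let x := p.1.1
  let y := p.1.2
  let z := p.2
  let r := x ^ 2 + y ^ 2 + z ^ 2
  (⟨2 * x / (r + 1), (r - 1) / (r + 1)⟩, ⟨2 * y / (r + 1), 2 * z / (r + 1)⟩)

/-- A closed curve in space, seen in the 3-sphere. -/
def sphereCurve (L : ℝ → Space) : ℝ → C2 := fun u => toSphere (L u)

/-- A line through infinity, seen as a closed curve in the 3-sphere. It is parametrized by the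
circle: the parameter `u` in `(0, 1)` is sent to the point of the line at
`s = - cot (π u)`, and `u = 0` is sent to infinity. -/
def sphereLine (L : ℝ → Space) : ℝ → C2 := fun u =>
  if Real.sin (Real.pi * u) = 0 then (Complex.I, 0)
  else toSphere (L (-(Real.cos (Real.pi * u) / Real.sin (Real.pi * u))))

/-- A `C¹` knot in the 3-sphere. -/
structure IsSphereKnot (K : ℝ → C2) : Prop where
  contDiff : ContDiff ℝ 1 K
  periodic : Periodic K 1
  mem_sphere : ∀ u, ‖(K u).1‖ ^ 2 + ‖(K u).2‖ ^ 2 = 1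
  simple : ∀ u v, K u = K v → SameParam u v
  immersed : ∀ u, deriv K u ≠ 0

/-- An ordered oriented 2-component link in the 3-sphere. -/
structure IsSphereLink (K T : ℝ → C2) : Prop where
  left : IsSphereKnot K
  right : IsSphereKnot T
  disjoint : ∀ u v, K u ≠ T v

/-- Isotopy of 2-component links in the 3-sphere: a path of `C¹` embeddings, continuous together
with the velocities. -/
def IsIsotopic (K T K' T' : ℝ → C2) : Prop :=
  ∃ F G : ℝ → ℝ → C2,
    (∀ t ∈ Icc (0 : ℝ) 1, IsSphereLink (F t) (G t)) ∧
    ContinuousOn (fun p : ℝ × ℝ => F p.1 p.2) (Icc 0 1 ×ˢ univ) ∧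
    ContinuousOn (fun p : ℝ × ℝ => deriv (F p.1) p.2) (Icc 0 1 ×ˢ univ) ∧
    ContinuousOn (fun p : ℝ × ℝ => G p.1 p.2) (Icc 0 1 ×ˢ univ) ∧
    ContinuousOn (fun p : ℝ × ℝ => deriv (G p.1) p.2) (Icc 0 1 ×ˢ univ) ∧
    F 0 = K ∧ G 0 = T ∧ F 1 = K' ∧ G 1 = T'

/-- `z` never vanishes and turns around the origin with positive angular velocity. -/
def TurnsPositively (z : ℝ → ℂ) : Prop :=
  ∀ u, 0 < ((starRingEnd ℂ) (z u) * deriv z u).im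

/-- `K` is a closed braid with axis `T`: the axis is the positively oriented unknotted circle
`w = 0`, and `K` runs around it so that the angle `arg w` (the page of the open book of
half-planes bounded by the axis) increases with positive velocity. -/
structure IsClosedBraidWithAxis (K T : ℝ → C2) : Prop where
  link : IsSphereLink K T
  axis : ∀ u, (T u).2 = 0
  axis_oriented : TurnsPositively fun u => (T u).1
  braid : TurnsPositively fun u => (K u).2

/-- The link `K ⊔ T` is braided: it is isotopic to a closed braid together with its axis.
(It follows that `T` is trivial and that the linking number is positive.) -/
def IsBraided (K T : ℝ → C2) : Prop :=
  ∃ K' T', IsIsotopic K T K' T' ∧ IsClosedBraidWithAxis K' T'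

/-- The positive Hopf link. -/
def hopfKnot (u : ℝ) : C2 := (0, Complex.exp (2 * Real.pi * u * Complex.I))

def hopfAxis (u : ℝ) : C2 := (Complex.exp (2 * Real.pi * u * Complex.I), 0)

/-- `T` (a simple curve in the plane through infinity, with crossing information) is a threading
circle of the diagram `D`. -/
structure IsThreadingCircle (D T : ℝ → Space) : Prop where
  line : IsLineThroughInfinity T
  regular : CrossRegularly D T
  lk_pos : 0 < lkLine D T
  braided : IsBraided (sphereCurve D) (sphereLine T)

/-! ### Minimal semi-threadings -/

/-- A (compactly supported) ambient `C¹` isotopy of the plane. -/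
structure IsPlaneIsotopy (h : ℝ → Plane → Plane) : Prop where
  zero : ∀ p, h 0 p = p
  bijective : ∀ t ∈ Icc (0 : ℝ) 1, Bijective (h t)
  differentiable : ∀ t ∈ Icc (0 : ℝ) 1, Differentiable ℝ (h t)
  fderiv_bijective : ∀ t ∈ Icc (0 : ℝ) 1, ∀ p, Bijective (fderiv ℝ (h t) p)
  continuousOn : ContinuousOn (fun q : ℝ × Plane => h q.1 q.2) (Icc 0 1 ×ˢ univ)
  continuousOn_fderiv :
    ContinuousOn (fun q : ℝ × Plane => fderiv ℝ (h q.1) q.2) (Icc 0 1 ×ˢ univ)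
  compact_support : ∃ R : ℝ, ∀ t ∈ Icc (0 : ℝ) 1, ∀ p, R ≤ ‖p‖ → h t p = p

/-- The filled stadium between the segment `[a, b] × {0}` and its translate
`[a, b] × {-ε}`, closed up by half-discs of diameter `ε` at both ends. -/
def filledStadium (a b ε : ℝ) : Set Plane :=
  {p | (p.1 - max a (min b p.1)) ^ 2 + (p.2 + ε / 2) ^ 2 ≤ (ε / 2) ^ 2}

/-- The boundary of the filled stadium. -/
def stadium (a b ε : ℝ) : Set Plane :=
  {p | (p.1 - max a (min b p.1)) ^ 2 + (p.2 + ε / 2) ^ 2 = (ε / 2) ^ 2}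

/-- The choices made in the construction of a minimal semi-threading circle of a diagram `D` with
at least one crossing: an over-underpass sequence, and a plane isotopy after which the overpasses
are vertical segments, directed downward, ordered from left to right, that cross the
first coordinate axis. The piece `[a, b] × {0}` of the axis is the front arc of the circle and
`[a, b] × {-ε}` is the back arc. -/
structure Arrangement (D : ℝ → Space) where
  k : ℕ
  σ : ℤ → ℝ
  φ : ℤ → ℝ
  h : ℝ → Plane → Plane
  x : ℤ → ℝ
  a : ℝ
  b : ℝ
  ε : ℝ
  k_pos : 1 ≤ k
  ε_pos : 0 < ε
  sequence : IsOverUnderSequence D k σ φ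
  isotopy : IsPlaneIsotopy h
  left_to_right : ∀ i j : ℤ, 0 ≤ i → i < j → j < k → x i < x j
  between : ∀ i : ℤ, 0 ≤ i → i < k → a < x i ∧ x i < b
  vertical : ∀ i : ℤ, 0 ≤ i → i < k → ∀ u ∈ Icc (σ i) (φ i), (h 1 (D u).1).1 = x i
  downward : ∀ i : ℤ, 0 ≤ i → i < k →
    StrictAntiOn (fun u => (h 1 (D u).1).2) (Icc (σ i) (φ i))
  start_above : ∀ i : ℤ, 0 ≤ i → i < k → 0 < (h 1 (D (σ i)).1).2
  finish_below : ∀ i : ℤ, 0 ≤ i → i < k → (h 1 (D (φ i)).1).2 < -ε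
  /-- The diagram meets the first coordinate axis transversely and away from its crossings. -/
  axis_regular : ∀ u, (h 1 (D u).1).2 = 0 →
    deriv (fun v => (h 1 (D v).1).2) u ≠ 0 ∧ ¬ IsCrossing D u
  /-- There is no crossing of the diagram between the two arcs. -/
  no_crossing_between : ∀ u, IsCrossing D u → h 1 (D u).1 ∉ filledStadium a b ε
  /-- The two ends of the stadium do not meet the diagram. -/
  ends_free : ∀ u, h 1 (D u).1 ∈ stadium a b ε → a < (h 1 (D u).1).1 ∧ (h 1 (D u).1).1 < b

/-- The parameter `u` belongs to an overpass. -/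
def Arrangement.OnOverpass {D : ℝ → Space} (A : Arrangement D) (u : ℝ) : Prop :=
  ∃ i : ℤ, u ∈ Icc (A.σ i) (A.φ i)

/-- `M` is the minimal semi-threading circle constructed from the arrangement `A`. After
the plane isotopy it runs once around the stadium, from left to right on the front arc. The front
arc passes below the overpasses and above the underpasses; the back arc passes above
everything. -/
structure Arrangement.IsCircle {D : ℝ → Space} (A : Arrangement D) (M : ℝ → Space) : Prop where
  circle : IsPlaneCircle M
  regular : CrossRegularly D M
  range_eq : range (fun v => A.h 1 (M v).1) = stadium A.a A.b A.ε
  oriented : ∀ v, (A.h 1 (M v).1).2 = 0 → 0 < deriv (fun w => (A.h 1 (M w).1).1) v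
  front_under : ∀ u v, (D u).1 = (M v).1 → (A.h 1 (M v).1).2 = 0 → A.OnOverpass u →
    (M v).2 < (D u).2
  front_over : ∀ u v, (D u).1 = (M v).1 → (A.h 1 (M v).1).2 = 0 → ¬ A.OnOverpass u →
    (D u).2 < (M v).2
  back_over : ∀ u v, (D u).1 = (M v).1 → (A.h 1 (M v).1).2 = -A.ε → (D u).2 < (M v).2

/-- `T₀` is the extended circle: the front arc is extended by the two horizontal rays,
which pass above the underpasses they meet. -/
structure Arrangement.IsExtendedCircle {D : ℝ → Space} (A : Arrangement D) (T₀ : ℝ → Space) :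
    Prop where
  line : IsLineThroughInfinity T₀
  regular : CrossRegularly D T₀
  proj_eq : ∀ s, A.h 1 (T₀ s).1 = (s, 0)
  below_overpasses : ∀ u s, (D u).1 = (T₀ s).1 → A.OnOverpass u → (T₀ s).2 < (D u).2
  above_underpasses : ∀ u s, (D u).1 = (T₀ s).1 → ¬ A.OnOverpass u → (D u).2 < (T₀ s).2

/-- `M` is a minimal semi-threading circle of `D`, so that `D ⊔ M` is a minimal semi-threading.
For a diagram without crossings this means that `D ⊔ M` is a diagram of the positive
Hopf link. -/
def IsMinimalSemiThreadingCircle (D M : ℝ → Space) : Prop :=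
  ((∀ u, ¬ IsCrossing D u) ∧ IsPlaneCircle M ∧ CrossRegularly D M ∧
    IsIsotopic (sphereCurve D) (sphereCurve M) hopfKnot hopfAxis) ∨
  ∃ A : Arrangement D, A.IsCircle M

/-- `T₀` is an extended minimal semi-threading circle belonging to `M`. -/
def IsExtendedCircleOf (D M T₀ : ℝ → Space) : Prop :=
  ∃ A : Arrangement D, A.IsCircle M ∧ A.IsExtendedCircle T₀

/-- `T` arises from `T₀` by changing crossings with the diagram: it has the same projection,
so that only the heights at the crossings can differ. -/
def ObtainedByCrossingChanges (T₀ T : ℝ → Space) : Prop :=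
  ∀ s, (T s).1 = (T₀ s).1

end SemiThreading

end

/-!
# Threading circles from minimal semi-threadings

The extended circle `T₀` is the first coordinate axis, and the diagram crosses it downward on every
overpass. Change the crossings such that `D` passes over the axis where it crosses it downward and
under the axis where it crosses it upward. The claim is that the axis `T` with these crossings is a
threading circle, and that it beats `M` unless `M` is itself braided.

**`D ⊔ T` is braided** (`Arrangement.isBraided_line`). Let `y` be the second coordinate of `D`
after the plane isotopy. It suffices to find heights `g` which keep all crossings of `D` and
satisfy `y * g' - g * y' > 0`, so that `D` turns around the axis with positive velocity; at the
zeros of `y` such a `g` automatically has the signs prescribed by the crossings with `T`. Each arc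
of `D` above the axis ends, and each arc below the axis begins, with at most one piece of an
overpass; the rest of the arc belongs to an underpass. With a pivot `c` at the change,
`g u = y u * (u - c)` has the right sign at all crossings, and `g / y` grows with velocity `1`. Near
the zeros of `y`, where there are no crossings, this is modified so that `g` becomes `C¹`:
`exists_turning_height` and `Arrangement.exists_braiding_height`.

**Linking numbers.** All crossings where `D` passes over `T` are positive, so `lk(D, T)` is the
number of downward crossings of `D` with the axis (`Arrangement.lkLine_eq_ncard`). Over `M` the
diagram passes on the overpasses only, so `lk(D, M)` is at most the number of crossings of the
overpasses with the axis, all of which are downward (`Arrangement.IsCircle.lkCircle_le`). Hence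
`lk(D, M) < lk(D, T)` and `0 < lk(D, T)` if some underpass crosses the axis downward.

**Otherwise `M` is braided** (`Arrangement.IsCircle.isBraided`), which is excluded. With the
heights `g`, the points of `D` that have `y < 0` and `g > 0` belong to overpasses, because `g / y`
is increasing on each arc and vanishes at the end of the overpass
(`Arrangement.onOverpass_of_height_pos`). So their abscissas are between `a` and `b`. Change the
heights of `M` such that `M` lies in a half-plane that is bounded by the axis and contained in the
quadrant `y ≤ 0`, `z ≥ 0`. The half-planes bounded by the axis are the pages of an open book. In
the 3-sphere in `ℂ²`, with coordinates `(z, w)`, the axis is the circle `w = 0`, and each page is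
an open hemisphere bounded by it. After a normalization, the back arc has distance `2` from the
axis, the centre of the hemisphere is the point at distance `1` in the middle, and `M` turns around
this centre with positive velocity. Hence `M` can be pushed within its page, along the great
circles through the centre, to the axis. The heights of `D` are scaled such that `D` meets the page
only at points between the centre and the front arc, which is part of the axis and does not move;
so `D` is not met on the way (`IsNormalizedStadium.isBraided`, `isBraided_of_pushed`).
-/

noncomputable section

namespace SemiThreading

/-! ### Families of `C¹` curves -/

/-- A family `F t`, `t ∈ [0, 1]`, of curves which on `s` are differentiable and, together with their
velocities, jointly continuous in the time and the parameter. -/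
structure C1FamilyOn {E : Type*} [NormedAddCommGroup E] [NormedSpace ℝ E] (F : ℝ → ℝ → E)
    (s : Set ℝ) : Prop where
  diff : ∀ t ∈ Icc (0 : ℝ) 1, ∀ u ∈ s, DifferentiableAt ℝ (F t) u
  cont : ContinuousOn (fun p : ℝ × ℝ => F p.1 p.2) (Icc 0 1 ×ˢ s)
  cont_deriv : ContinuousOn (fun p : ℝ × ℝ => deriv (F p.1) p.2) (Icc 0 1 ×ˢ s)

namespace C1FamilyOn

variable {E E' : Type*} [NormedAddCommGroup E] [NormedSpace ℝ E] [NormedAddCommGroup E']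
  [NormedSpace ℝ E'] {F : ℝ → ℝ → E} {G : ℝ → ℝ → E'} {s : Set ℝ}

theorem of_hasDerivAt {F' : ℝ → ℝ → E}
    (h : ∀ t ∈ Icc (0 : ℝ) 1, ∀ u ∈ s, HasDerivAt (F t) (F' t u) u)
    (hc : ContinuousOn (fun p : ℝ × ℝ => F p.1 p.2) (Icc 0 1 ×ˢ s))
    (hc' : ContinuousOn (fun p : ℝ × ℝ => F' p.1 p.2) (Icc 0 1 ×ˢ s)) : C1FamilyOn F s :=
  ⟨fun t ht u hu => (h t ht u hu).differentiableAt, hc,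
    hc'.congr fun p hp => (h p.1 hp.1 p.2 hp.2).deriv⟩

theorem const {f : ℝ → E} (hf : ContDiff ℝ 1 f) (s : Set ℝ) : C1FamilyOn (fun _ => f) s :=
  ⟨fun _ _ u _ => hf.differentiable one_ne_zero u,
    (hf.continuous.comp continuous_snd).continuousOn,
    ((hf.continuous_deriv le_rfl).comp continuous_snd).continuousOn⟩

theorem prodMk (hF : C1FamilyOn F s) (hG : C1FamilyOn G s) :
    C1FamilyOn (fun t u => (F t u, G t u)) s :=
  of_hasDerivAt (F' := fun t u => (deriv (F t) u, deriv (G t) u))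
    (fun t ht u hu => (hF.diff t ht u hu).hasDerivAt.prodMk (hG.diff t ht u hu).hasDerivAt)
    (hF.cont.prodMk hG.cont) (hF.cont_deriv.prodMk hG.cont_deriv)

theorem add {G : ℝ → ℝ → E} (hF : C1FamilyOn F s) (hG : C1FamilyOn G s) :
    C1FamilyOn (fun t u => F t u + G t u) s :=
  of_hasDerivAt (F' := fun t u => deriv (F t) u + deriv (G t) u)
    (fun t ht u hu => (hF.diff t ht u hu).hasDerivAt.add (hG.diff t ht u hu).hasDerivAt)
    (hF.cont.add hG.cont) (hF.cont_deriv.add hG.cont_deriv)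

theorem time_smul {c : ℝ → ℝ} (hc : Continuous c) (hF : C1FamilyOn F s) :
    C1FamilyOn (fun t u => c t • F t u) s :=
  of_hasDerivAt (F' := fun t u => c t • deriv (F t) u)
    (fun t ht u hu => (hF.diff t ht u hu).hasDerivAt.const_smul (c t))
    ((hc.comp continuous_fst).continuousOn.smul hF.cont)
    ((hc.comp continuous_fst).continuousOn.smul hF.cont_deriv)

theorem interpolate {f g : ℝ → ℝ} (hf : ContDiff ℝ 1 f) (hg : ContDiff ℝ 1 g) (s : Set ℝ) :
    C1FamilyOn (fun t u => (1 - t) * f u + t * g u) s :=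
  ((const hf s).time_smul (c := fun t => 1 - t) (by fun_prop)).add
    ((const hg s).time_smul (c := fun t => t) (by fun_prop))

/-- Composition with a map that is `C¹` near the values of the family. -/
theorem comp (hF : C1FamilyOn F s) {Φ : E → E'} {U : Set E} (hU : IsOpen U)
    (hΦ : ContDiffOn ℝ 1 Φ U) (hmem : ∀ t ∈ Icc (0 : ℝ) 1, ∀ u ∈ s, F t u ∈ U) :
    C1FamilyOn (fun t u => Φ (F t u)) s := by
  have hm : MapsTo (fun p : ℝ × ℝ => F p.1 p.2) (Icc 0 1 ×ˢ s) U :=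
    fun p hp => hmem p.1 hp.1 p.2 hp.2
  refine of_hasDerivAt (F' := fun t u => fderiv ℝ Φ (F t u) (deriv (F t) u)) ?_ ?_ ?_
  · intro t ht u hu
    have h1 : DifferentiableAt ℝ Φ (F t u) :=
      (hΦ.differentiableOn one_ne_zero).differentiableAt (hU.mem_nhds (hmem t ht u hu))
    exact h1.hasFDerivAt.comp_hasDerivAt u (hF.diff t ht u hu).hasDerivAt
  · exact hΦ.continuousOn.comp hF.cont hm
  · exact ((hΦ.continuousOn_fderiv_of_isOpen hU le_rfl).comp hF.cont hm).clm_apply hF.cont_deriv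

theorem comp_contDiff (hF : C1FamilyOn F s) {Φ : E → E'} (hΦ : ContDiff ℝ 1 Φ) :
    C1FamilyOn (fun t u => Φ (F t u)) s :=
  hF.comp isOpen_univ hΦ.contDiffOn fun _ _ _ _ => mem_univ _

theorem reparam (hF : C1FamilyOn F univ) {c : ℝ → ℝ} (hs : IsOpen s) (hc : ContDiffOn ℝ 1 c s) :
    C1FamilyOn (fun t u => F t (c u)) s := by
  have hm : ContinuousOn (fun p : ℝ × ℝ => (p.1, c p.2)) (Icc 0 1 ×ˢ s) :=
    continuousOn_fst.prodMk (hc.continuousOn.comp continuousOn_snd fun p hp => hp.2)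
  have hm' : MapsTo (fun p : ℝ × ℝ => (p.1, c p.2)) (Icc 0 1 ×ˢ s) (Icc 0 1 ×ˢ univ) :=
    fun p hp => ⟨hp.1, mem_univ _⟩
  refine of_hasDerivAt (F' := fun t u => deriv c u • deriv (F t) (c u)) ?_ ?_ ?_
  · intro t ht u hu
    have h1 : DifferentiableAt ℝ c u :=
      (hc.differentiableOn one_ne_zero).differentiableAt (hs.mem_nhds hu)
    exact (hF.diff t ht (c u) (mem_univ _)).hasDerivAt.scomp u h1.hasDerivAt
  · exact hF.cont.comp hm hm'
  · exact ((hc.continuousOn_deriv_of_isOpen hs le_rfl).comp continuousOn_snd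
      fun p hp => hp.2).smul (hF.cont_deriv.comp hm hm')

theorem congr {F₂ : ℝ → ℝ → E} (hF : C1FamilyOn F s) (hs : IsOpen s)
    (h : ∀ t ∈ Icc (0 : ℝ) 1, ∀ u ∈ s, F₂ t u = F t u) : C1FamilyOn F₂ s := by
  have he : ∀ t ∈ Icc (0 : ℝ) 1, ∀ u ∈ s, F₂ t =ᶠ[nhds u] F t := fun t ht u hu =>
    Filter.eventually_of_mem (hs.mem_nhds hu) (h t ht)
  refine of_hasDerivAt (F' := fun t u => deriv (F t) u) ?_ ?_ hF.cont_deriv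
  · intro t ht u hu
    exact (hF.diff t ht u hu).hasDerivAt.congr_of_eventuallyEq (he t ht u hu)
  · exact hF.cont.congr fun p hp => h p.1 hp.1 p.2 hp.2

theorem of_local (h : ∀ u, ∃ s, IsOpen s ∧ u ∈ s ∧ C1FamilyOn F s) : C1FamilyOn F univ := by
  have key : ∀ f : ℝ × ℝ → E, (∀ u, ∃ s, IsOpen s ∧ u ∈ s ∧ ContinuousOn f (Icc 0 1 ×ˢ s)) →
      ContinuousOn f (Icc 0 1 ×ˢ univ) := by
    rintro f hf ⟨t, u⟩ ⟨ht, -⟩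
    obtain ⟨s, hs, hu, hc⟩ := hf u
    refine (hc (t, u) ⟨ht, hu⟩).mono_of_mem_nhdsWithin ?_
    have h1 : (univ : Set ℝ) ×ˢ s ∈ nhds (t, u) :=
      (isOpen_univ.prod hs).mem_nhds ⟨mem_univ _, hu⟩
    refine Filter.mem_of_superset
      (Filter.inter_mem self_mem_nhdsWithin (mem_nhdsWithin_of_mem_nhds h1)) ?_
    rintro ⟨a, b⟩ ⟨⟨ha, -⟩, -, hb⟩
    exact ⟨ha, hb⟩
  refine ⟨fun t ht u _ => ?_, key _ fun u => ?_, key _ fun u => ?_⟩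
  · obtain ⟨s, -, hu, hc⟩ := h u
    exact hc.diff t ht u hu
  · obtain ⟨s, hs, hu, hc⟩ := h u
    exact ⟨s, hs, hu, hc.cont⟩
  · obtain ⟨s, hs, hu, hc⟩ := h u
    exact ⟨s, hs, hu, hc.cont_deriv⟩

theorem contDiff (hF : C1FamilyOn F univ) {t : ℝ} (ht : t ∈ Icc (0 : ℝ) 1) :
    ContDiff ℝ 1 (F t) := by
  refine contDiff_one_iff_deriv.2 ⟨fun u => hF.diff t ht u (mem_univ _), ?_⟩
  have h : Continuous fun u : ℝ => ((t, u) : ℝ × ℝ) := by fun_prop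
  exact hF.cont_deriv.comp_continuous h fun u => ⟨ht, mem_univ _⟩

end C1FamilyOn

/-- Two families of curves that form a link at each time are an isotopy. -/
theorem IsIsotopic.of_families {K T K' T' : ℝ → C2} {F G : ℝ → ℝ → C2}
    (hF : C1FamilyOn F univ) (hG : C1FamilyOn G univ)
    (hlink : ∀ t ∈ Icc (0 : ℝ) 1, IsSphereLink (F t) (G t))
    (hF0 : F 0 = K) (hG0 : G 0 = T) (hF1 : F 1 = K') (hG1 : G 1 = T') : IsIsotopic K T K' T' :=
  ⟨F, G, hlink, hF.cont, hF.cont_deriv, hG.cont, hG.cont_deriv, hF0, hG0, hF1, hG1⟩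

theorem continuousOn_concat {f g : ℝ → ℝ → C2}
    (hf : ContinuousOn (fun p : ℝ × ℝ => f p.1 p.2) (Icc 0 1 ×ˢ univ))
    (hg : ContinuousOn (fun p : ℝ × ℝ => g p.1 p.2) (Icc 0 1 ×ˢ univ)) (h : f 1 = g 0) :
    ContinuousOn (fun p : ℝ × ℝ => if p.1 ≤ 1 / 2 then f (2 * p.1) p.2 else g (2 * p.1 - 1) p.2)
      (Icc 0 1 ×ˢ univ) := by
  have hU : (Icc 0 1 ×ˢ univ : Set (ℝ × ℝ)) =
      (Icc 0 (1 / 2) ×ˢ univ) ∪ (Icc (1 / 2) 1 ×ˢ univ) := by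
    rw [← union_prod, Icc_union_Icc_eq_Icc] <;> norm_num
  rw [hU]
  refine ContinuousOn.union_of_isClosed ?_ ?_ (isClosed_Icc.prod isClosed_univ)
    (isClosed_Icc.prod isClosed_univ)
  · have h1 : ContinuousOn (fun p : ℝ × ℝ => ((2 * p.1, p.2) : ℝ × ℝ)) (Icc 0 (1 / 2) ×ˢ univ) := by
      fun_prop
    refine (hf.comp h1 ?_).congr ?_
    · rintro ⟨t, u⟩ ⟨⟨h0, h2⟩, -⟩
      refine ⟨⟨?_, ?_⟩, mem_univ _⟩ <;> simp only at * <;> linarith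
    · rintro ⟨t, u⟩ ⟨⟨h0, h2⟩, -⟩
      exact if_pos h2
  · have h1 : ContinuousOn (fun p : ℝ × ℝ => ((2 * p.1 - 1, p.2) : ℝ × ℝ))
        (Icc (1 / 2) 1 ×ˢ univ) := by
      fun_prop
    refine (hg.comp h1 ?_).congr ?_
    · rintro ⟨t, u⟩ ⟨⟨h0, h2⟩, -⟩
      refine ⟨⟨?_, ?_⟩, mem_univ _⟩ <;> simp only at * <;> linarith
    · rintro ⟨t, u⟩ ⟨⟨h0, h2⟩, -⟩
      simp only at h0
      rcases h0.eq_or_lt with rfl | h0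
      · simp [h]
      · exact if_neg (not_le.2 h0)

theorem IsIsotopic.trans {K T K' T' K'' T'' : ℝ → C2} (h₁ : IsIsotopic K T K' T')
    (h₂ : IsIsotopic K' T' K'' T'') : IsIsotopic K T K'' T'' := by
  obtain ⟨F, G, hl, hF, hF', hG, hG', hF0, hG0, hF1, hG1⟩ := h₁
  obtain ⟨P, Q, kl, hP, hP', hQ, hQ', hP0, hQ0, hP1, hQ1⟩ := h₂
  have hite : ∀ (A B : ℝ → ℝ → C2) (p : ℝ × ℝ),
      deriv ((fun t u => if t ≤ 1 / 2 then A (2 * t) u else B (2 * t - 1) u) p.1) p.2 =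
      if p.1 ≤ 1 / 2 then deriv (A (2 * p.1)) p.2 else deriv (B (2 * p.1 - 1)) p.2 := by
    intro A B p
    by_cases hp : p.1 ≤ 1 / 2
    · simp only [hp, if_true]
    · simp only [hp, if_false]
  refine ⟨fun t u => if t ≤ 1 / 2 then F (2 * t) u else P (2 * t - 1) u,
    fun t u => if t ≤ 1 / 2 then G (2 * t) u else Q (2 * t - 1) u, ?_,
    continuousOn_concat hF hP (hF1.trans hP0.symm), ?_,
    continuousOn_concat hG hQ (hG1.trans hQ0.symm), ?_, ?_, ?_, ?_, ?_⟩
  · rintro t ⟨h0, h1⟩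
    by_cases ht : t ≤ 1 / 2
    · simp only [ht, if_true]
      exact hl _ ⟨by linarith, by linarith⟩
    · simp only [ht, if_false]
      exact kl _ ⟨by linarith, by linarith⟩
  · refine (continuousOn_concat (f := fun t => deriv (F t)) (g := fun t => deriv (P t)) hF' hP'
      (funext fun u => by rw [hF1, hP0])).congr fun p _ => ?_
    exact hite F P p
  · refine (continuousOn_concat (f := fun t => deriv (G t)) (g := fun t => deriv (Q t)) hG' hQ'
      (funext fun u => by rw [hG1, hQ0])).congr fun p _ => ?_
    exact hite G Q p
  · funext u; simp [hF0]
  · funext u; simp [hG0]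
  · funext u; norm_num [hP1]
  · funext u; norm_num [hQ1]

/-! ### Stereographic projection -/

theorem complex_mk_contDiff {E : Type*} [NormedAddCommGroup E] [NormedSpace ℝ E] {f g : E → ℝ}
    {n : WithTop ℕ∞} (hf : ContDiff ℝ n f) (hg : ContDiff ℝ n g) :
    ContDiff ℝ n fun x => (⟨f x, g x⟩ : ℂ) :=
  Complex.equivRealProdCLM.symm.contDiff.comp (hf.prodMk hg)

theorem norm_sq_add_one_pos (p : Space) : 0 < p.1.1 ^ 2 + p.1.2 ^ 2 + p.2 ^ 2 + 1 := by positivity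

theorem toSphere_contDiff {n : WithTop ℕ∞} : ContDiff ℝ n toSphere := by
  have h : ∀ p : Space, p.1.1 ^ 2 + p.1.2 ^ 2 + p.2 ^ 2 + 1 ≠ 0 :=
    fun p => (norm_sq_add_one_pos p).ne'
  refine ContDiff.prodMk (complex_mk_contDiff ?_ ?_) (complex_mk_contDiff ?_ ?_) <;>
    exact ContDiff.div (by fun_prop) (by fun_prop) h

/-- Stereographic projection from `(I, 0)`, the inverse of `toSphere`. -/
def stereo (q : C2) : Space :=
  ((q.1.re / (1 - q.1.im), q.2.re / (1 - q.1.im)), q.2.im / (1 - q.1.im))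

theorem toSphere_fst_im (p : Space) :
    1 - (toSphere p).1.im = 2 / (p.1.1 ^ 2 + p.1.2 ^ 2 + p.2 ^ 2 + 1) := by
  have h := (norm_sq_add_one_pos p).ne'
  simp only [toSphere]
  field_simp
  ring

theorem toSphere_fst_im_lt (p : Space) : (toSphere p).1.im < 1 := by
  have h : 0 < 1 - (toSphere p).1.im := by
    rw [toSphere_fst_im]
    have := norm_sq_add_one_pos p
    positivity
  linarith

theorem stereo_toSphere (p : Space) : stereo (toSphere p) = p := by
  have h := (norm_sq_add_one_pos p).ne'
  obtain ⟨⟨x, y⟩, z⟩ := p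
  simp only [stereo, toSphere_fst_im]
  simp only [toSphere] at h ⊢
  refine Prod.ext (Prod.ext ?_ ?_) ?_ <;> simp only <;> field_simp

theorem toSphere_injective : Injective toSphere := LeftInverse.injective stereo_toSphere

theorem toSphere_ne_infinity (p : Space) : toSphere p ≠ (Complex.I, 0) := by
  intro h
  have h1 := toSphere_fst_im_lt p
  rw [h] at h1
  simp at h1

theorem toSphere_mem_sphere (p : Space) :
    ‖(toSphere p).1‖ ^ 2 + ‖(toSphere p).2‖ ^ 2 = 1 := by
  have h := (norm_sq_add_one_pos p).ne'
  rw [Complex.sq_norm, Complex.sq_norm, Complex.normSq_apply, Complex.normSq_apply]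
  simp only [toSphere]
  field_simp
  ring

theorem stereo_differentiableAt {q : C2} (hq : q.1.im ≠ 1) : DifferentiableAt ℝ stereo q := by
  have h : 1 - q.1.im ≠ 0 := sub_ne_zero.2 hq.symm
  have hre : Differentiable ℝ Complex.re := Complex.reCLM.differentiable
  have him : Differentiable ℝ Complex.im := Complex.imCLM.differentiable
  have h1 : DifferentiableAt ℝ (fun q : C2 => q.1.re) q := by fun_prop
  have h2 : DifferentiableAt ℝ (fun q : C2 => q.1.im) q := by fun_prop
  have h3 : DifferentiableAt ℝ (fun q : C2 => q.2.re) q := by fun_prop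
  have h4 : DifferentiableAt ℝ (fun q : C2 => q.2.im) q := by fun_prop
  have h5 : DifferentiableAt ℝ (fun q : C2 => 1 - q.1.im) q := h2.const_sub 1
  have h6 : DifferentiableAt ℝ (fun q : C2 => (1 - q.1.im)⁻¹) q := h5.fun_inv h
  exact ((h1.fun_mul h6).prodMk (h3.fun_mul h6)).prodMk (h4.fun_mul h6)

theorem deriv_toSphere_comp_ne_zero {γ : ℝ → Space} {u : ℝ} (hγ : DifferentiableAt ℝ γ u)
    (h : deriv γ u ≠ 0) : deriv (fun v => toSphere (γ v)) u ≠ 0 := by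
  intro h0
  have h1 : DifferentiableAt ℝ (fun v => toSphere (γ v)) u :=
    ((toSphere_contDiff (n := 1)).differentiable one_ne_zero (γ u)).comp u hγ
  have h2 := (stereo_differentiableAt (toSphere_fst_im_lt (γ u)).ne).hasFDerivAt.comp_hasDerivAt u
    h1.hasDerivAt
  have h3 : stereo ∘ (fun v => toSphere (γ v)) = γ := funext fun v => stereo_toSphere _
  rw [h3, h0, map_zero] at h2
  exact h h2.deriv

theorem isSphereKnot_sphereCurve {γ : ℝ → Space} (hγ : ContDiff ℝ 1 γ) (hp : Periodic γ 1)
    (hs : ∀ u v, γ u = γ v → SameParam u v) (hi : ∀ u, deriv γ u ≠ 0) :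
    IsSphereKnot (sphereCurve γ) where
  contDiff := toSphere_contDiff.comp hγ
  periodic u := by simp only [sphereCurve, hp u]
  mem_sphere u := toSphere_mem_sphere _
  simple u v h := hs u v (toSphere_injective h)
  immersed u := deriv_toSphere_comp_ne_zero (hγ.differentiable one_ne_zero u) (hi u)

/-! ### Lines through infinity in the 3-sphere -/

theorem hasDerivAt_complex_mk {f g : ℝ → ℝ} {f' g' u : ℝ} (hf : HasDerivAt f f' u)
    (hg : HasDerivAt g g' u) : HasDerivAt (fun v => (⟨f v, g v⟩ : ℂ)) ⟨f', g'⟩ u :=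
  Complex.equivRealProdCLM.symm.hasFDerivAt.comp_hasDerivAt u (hf.prodMk hg)

/-- The first coordinate axis together with infinity, in the parametrization of `sphereLine`. -/
def axisCurve (u : ℝ) : C2 := (⟨-Real.sin (2 * Real.pi * u), Real.cos (2 * Real.pi * u)⟩, 0)

theorem axisCurve_fst_hasDerivAt (u : ℝ) : HasDerivAt (fun v => (axisCurve v).1)
    ⟨-(Real.cos (2 * Real.pi * u) * (2 * Real.pi)),
      -(Real.sin (2 * Real.pi * u) * (2 * Real.pi))⟩ u := by
  have h : HasDerivAt (fun v => 2 * Real.pi * v) (2 * Real.pi) u := by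
    simpa using (hasDerivAt_id u).const_mul (2 * Real.pi)
  have h2 := hasDerivAt_complex_mk h.sin.neg h.cos
  rwa [neg_mul] at h2

theorem axisCurve_contDiff : ContDiff ℝ 1 axisCurve := by
  refine ContDiff.prodMk (complex_mk_contDiff ?_ ?_) contDiff_const
  · exact (Real.contDiff_sin.comp (contDiff_const.mul contDiff_id)).neg
  · exact Real.contDiff_cos.comp (contDiff_const.mul contDiff_id)

theorem axisCurve_turnsPositively : TurnsPositively fun u => (axisCurve u).1 := by
  intro u
  rw [(axisCurve_fst_hasDerivAt u).deriv]
  simp only [axisCurve, Complex.mul_im, Complex.conj_re, Complex.conj_im]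
  have h := Real.sin_sq_add_cos_sq (2 * Real.pi * u)
  nlinarith [Real.pi_pos]

theorem TurnsPositively.deriv_ne_zero {z : ℝ → ℂ} (hz : TurnsPositively z) (u : ℝ) :
    deriv z u ≠ 0 := by
  intro h
  have := hz u
  simp [h] at this

theorem deriv_ne_zero_of_fst {E E' : Type*} [NormedAddCommGroup E] [NormedSpace ℝ E]
    [NormedAddCommGroup E'] [NormedSpace ℝ E'] {K : ℝ → E × E'} {u : ℝ}
    (hK : DifferentiableAt ℝ K u) (h : deriv (fun v => (K v).1) u ≠ 0) : deriv K u ≠ 0 := by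
  intro h0
  have h1 := (hasFDerivAt_fst (𝕜 := ℝ) (p := K u)).comp_hasDerivAt u hK.hasDerivAt
  rw [h0, map_zero] at h1
  exact h h1.deriv

/-- The point of the line that corresponds to the parameter `u` of the circle. -/
def lineParam (u : ℝ) : ℝ := -(Real.cos (Real.pi * u) / Real.sin (Real.pi * u))

theorem isOpen_sin_ne_zero : IsOpen {u : ℝ | Real.sin (Real.pi * u) ≠ 0} :=
  isOpen_ne_fun (by fun_prop) continuous_const

theorem lineParam_hasDerivAt {u : ℝ} (hu : Real.sin (Real.pi * u) ≠ 0) :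
    HasDerivAt lineParam (Real.pi / Real.sin (Real.pi * u) ^ 2) u := by
  have h : HasDerivAt (fun v => Real.pi * v) Real.pi u := by
    simpa using (hasDerivAt_id u).const_mul Real.pi
  refine HasDerivAt.congr_deriv (f' := -((-Real.sin (Real.pi * u) * Real.pi *
    Real.sin (Real.pi * u) - Real.cos (Real.pi * u) * (Real.cos (Real.pi * u) * Real.pi)) /
    Real.sin (Real.pi * u) ^ 2)) (h.cos.fun_div h.sin hu).fun_neg ?_
  have := Real.sin_sq_add_cos_sq (Real.pi * u)
  field_simp
  linarith

theorem lineParam_contDiffOn : ContDiffOn ℝ 1 lineParam {u : ℝ | Real.sin (Real.pi * u) ≠ 0} := by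
  refine ContDiffOn.neg (ContDiffOn.div ?_ ?_ fun u hu => hu)
  · exact (Real.contDiff_cos.comp (contDiff_const.mul contDiff_id)).contDiffOn
  · exact (Real.contDiff_sin.comp (contDiff_const.mul contDiff_id)).contDiffOn

theorem sphereLine_of_sin_ne_zero (L : ℝ → Space) {u : ℝ} (hu : Real.sin (Real.pi * u) ≠ 0) :
    sphereLine L u = toSphere (L (lineParam u)) := if_neg hu

theorem axisCurve_eq {u : ℝ} : axisCurve u =
    (⟨-(2 * Real.sin (Real.pi * u) * Real.cos (Real.pi * u)),
      Real.cos (Real.pi * u) ^ 2 - Real.sin (Real.pi * u) ^ 2⟩, 0) := by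
  have h : 2 * Real.pi * u = 2 * (Real.pi * u) := by ring
  rw [axisCurve, h, Real.sin_two_mul, Real.cos_two_mul']

/-- Where the line coincides with the first coordinate axis, its image in the sphere is the
circle `w = 0`. -/
theorem sphereLine_eq_axisCurve {L : ℝ → Space} {u : ℝ}
    (h : Real.sin (Real.pi * u) ≠ 0 → L (lineParam u) = ((lineParam u, 0), 0)) :
    sphereLine L u = axisCurve u := by
  have h1 := Real.sin_sq_add_cos_sq (Real.pi * u)
  rw [axisCurve_eq]
  by_cases hu : Real.sin (Real.pi * u) = 0
  · rw [hu] at h1 ⊢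
    have h2 : Real.cos (Real.pi * u) ^ 2 = 1 := by linarith
    rw [sphereLine, if_pos hu, h2]
    refine Prod.ext (Complex.ext ?_ ?_) rfl <;> simp
  · rw [sphereLine_of_sin_ne_zero L hu, h hu]
    have h3 : lineParam u ^ 2 + 1 = 1 / Real.sin (Real.pi * u) ^ 2 := by
      rw [lineParam]
      field_simp
      linarith
    simp only [toSphere]
    refine Prod.ext (Complex.ext ?_ ?_) (Complex.ext ?_ ?_)
    · simp only [ne_eq, OfNat.ofNat_ne_zero, not_false_eq_true, zero_pow, add_zero, h3]
      rw [lineParam]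
      field_simp
    · simp only [ne_eq, OfNat.ofNat_ne_zero, not_false_eq_true, zero_pow, add_zero, h3]
      rw [lineParam]
      field_simp
    · simp
    · simp

/-- Near a parameter of infinity, lines that are the first coordinate axis outside `[-R, R]` are
the first coordinate axis. -/
theorem sphereLine_near_infinity (R : ℝ) {u : ℝ} (hu : Real.sin (Real.pi * u) = 0) :
    ∃ s, IsOpen s ∧ u ∈ s ∧ ∀ L : ℝ → Space, (∀ x, R ≤ |x| → L x = ((x, 0), 0)) →
      ∀ v ∈ s, sphereLine L v = axisCurve v := by
  refine ⟨{v | R * |Real.sin (Real.pi * v)| < |Real.cos (Real.pi * v)|},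
    isOpen_lt (by fun_prop) (by fun_prop), ?_, ?_⟩
  · have h1 := Real.sin_sq_add_cos_sq (Real.pi * u)
    rw [hu] at h1
    have h2 : Real.cos (Real.pi * u) ≠ 0 := by
      intro h
      rw [h] at h1
      norm_num at h1
    simpa [hu] using h2
  · intro L hL v hv
    refine sphereLine_eq_axisCurve fun hs => hL _ ?_
    rw [lineParam, abs_neg, abs_div, le_div_iff₀ (abs_pos.2 hs)]
    exact le_of_lt hv

theorem C1FamilyOn.sphereLine {L : ℝ → ℝ → Space} (hL : C1FamilyOn L univ) {R : ℝ}
    (hR : ∀ t ∈ Icc (0 : ℝ) 1, ∀ s, R ≤ |s| → L t s = ((s, 0), 0)) :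
    C1FamilyOn (fun t => SemiThreading.sphereLine (L t)) univ := by
  refine C1FamilyOn.of_local fun u => ?_
  by_cases hu : Real.sin (Real.pi * u) = 0
  · obtain ⟨s, hs, hus, h⟩ := sphereLine_near_infinity R hu
    exact ⟨s, hs, hus, (C1FamilyOn.const axisCurve_contDiff s).congr hs
      fun t ht v hv => h (L t) (hR t ht) v hv⟩
  · refine ⟨_, isOpen_sin_ne_zero, hu, ?_⟩
    refine ((hL.reparam isOpen_sin_ne_zero lineParam_contDiffOn).comp_contDiff
      toSphere_contDiff).congr isOpen_sin_ne_zero fun t _ v hv => ?_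
    exact sphereLine_of_sin_ne_zero (L t) hv

theorem sameParam_of_sin_eq_zero {u v : ℝ} (h : Real.sin (Real.pi * (v - u)) = 0) :
    SameParam u v := by
  obtain ⟨n, hn⟩ := Real.sin_eq_zero_iff.1 h
  have h1 : Real.pi * (v - u - n) = 0 := by linarith
  have h2 := (mul_eq_zero.1 h1).resolve_left Real.pi_ne_zero
  exact ⟨n, by linarith⟩

theorem sphereLine_sameParam {L : ℝ → Space} (hL : Injective L) {u v : ℝ}
    (h : sphereLine L u = sphereLine L v) : SameParam u v := by
  apply sameParam_of_sin_eq_zero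
  rw [mul_sub, Real.sin_sub]
  by_cases hu : Real.sin (Real.pi * u) = 0 <;> by_cases hv : Real.sin (Real.pi * v) = 0
  · simp [hu, hv]
  · rw [sphereLine, sphereLine, if_pos hu, if_neg hv] at h
    exact absurd h.symm (toSphere_ne_infinity _)
  · rw [sphereLine, sphereLine, if_neg hu, if_pos hv] at h
    exact absurd h (toSphere_ne_infinity _)
  · rw [sphereLine_of_sin_ne_zero L hu, sphereLine_of_sin_ne_zero L hv] at h
    have h1 := hL (toSphere_injective h)
    rw [lineParam, lineParam, neg_inj, div_eq_div_iff hu hv] at h1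
    linarith

theorem sphereLine_periodic (L : ℝ → Space) : Periodic (sphereLine L) 1 := by
  intro u
  have h : Real.pi * (u + 1) = Real.pi * u + Real.pi := by ring
  simp only [sphereLine, h, Real.sin_add_pi, Real.cos_add_pi, neg_eq_zero, neg_div_neg_eq]

theorem sphereLine_mem_sphere (L : ℝ → Space) (u : ℝ) :
    ‖(sphereLine L u).1‖ ^ 2 + ‖(sphereLine L u).2‖ ^ 2 = 1 := by
  by_cases hu : Real.sin (Real.pi * u) = 0
  · simp [sphereLine, if_pos hu]
  · rw [sphereLine_of_sin_ne_zero L hu]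
    exact toSphere_mem_sphere _

theorem isSphereKnot_sphereLine {L : ℝ → Space} (hL : ContDiff ℝ 1 L) (hinj : Injective L)
    (himm : ∀ s, deriv L s ≠ 0) {R : ℝ} (hR : ∀ s, R ≤ |s| → L s = ((s, 0), 0)) :
    IsSphereKnot (sphereLine L) where
  contDiff := ((C1FamilyOn.const hL univ).sphereLine fun _ _ => hR).contDiff (t := 0) (by simp)
  periodic := sphereLine_periodic L
  mem_sphere := sphereLine_mem_sphere L
  simple _ _ h := sphereLine_sameParam hinj h
  immersed u := by
    by_cases hu : Real.sin (Real.pi * u) = 0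
    · obtain ⟨s, hs, hus, h⟩ := sphereLine_near_infinity R hu
      have h1 : sphereLine L =ᶠ[nhds u] axisCurve :=
        Filter.eventually_of_mem (hs.mem_nhds hus) (h L hR)
      rw [h1.deriv_eq]
      exact deriv_ne_zero_of_fst (axisCurve_contDiff.differentiable one_ne_zero u)
        (axisCurve_turnsPositively.deriv_ne_zero u)
    · have h1 : sphereLine L =ᶠ[nhds u] fun v => toSphere (L (lineParam v)) :=
        Filter.eventually_of_mem (isOpen_sin_ne_zero.mem_nhds hu)
          fun v hv => sphereLine_of_sin_ne_zero L hv
      rw [h1.deriv_eq]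
      have h2 : HasDerivAt (fun v => L (lineParam v)) _ u :=
        (hL.differentiable one_ne_zero (lineParam u)).hasDerivAt.scomp u (lineParam_hasDerivAt hu)
      refine deriv_toSphere_comp_ne_zero h2.differentiableAt ?_
      rw [h2.deriv]
      exact smul_ne_zero (div_ne_zero Real.pi_ne_zero (pow_ne_zero 2 hu)) (himm _)

/-! ### Families of plane diffeomorphisms, and changes of heights -/

/-- A family `h t`, `t ∈ [0, 1]`, of injective `C¹` immersions of the plane that starts with the
identity. In contrast to `IsPlaneIsotopy`, the support need not be compact. -/
structure IsPlaneFamily (h : ℝ → Plane → Plane) : Prop where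
  zero : ∀ p, h 0 p = p
  injective : ∀ t ∈ Icc (0 : ℝ) 1, Injective (h t)
  differentiable : ∀ t ∈ Icc (0 : ℝ) 1, Differentiable ℝ (h t)
  fderiv_injective : ∀ t ∈ Icc (0 : ℝ) 1, ∀ p, Injective (fderiv ℝ (h t) p)
  continuousOn : ContinuousOn (fun q : ℝ × Plane => h q.1 q.2) (Icc 0 1 ×ˢ univ)
  continuousOn_fderiv :
    ContinuousOn (fun q : ℝ × Plane => fderiv ℝ (h q.1) q.2) (Icc 0 1 ×ˢ univ)

theorem IsPlaneIsotopy.isPlaneFamily {h : ℝ → Plane → Plane} (H : IsPlaneIsotopy h) :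
    IsPlaneFamily h :=
  ⟨H.zero, fun t ht => (H.bijective t ht).1, H.differentiable,
    fun t ht p => (H.fderiv_bijective t ht p).1, H.continuousOn, H.continuousOn_fderiv⟩

/-- A plane family combined with the straight line path from the identity to the similarity
`p ↦ α p - c`. -/
theorem IsPlaneFamily.similarity {h : ℝ → Plane → Plane} (H : IsPlaneFamily h) {α : ℝ}
    (hα : 0 < α) (c : Plane) :
    IsPlaneFamily fun t p => (1 - t + t * α) • h t p - t • c := by
  have hpos : ∀ t ∈ Icc (0 : ℝ) 1, 1 - t + t * α ≠ 0 := by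
    rintro t ⟨h0, h1⟩
    rcases h1.eq_or_lt with rfl | h1
    · simpa using hα.ne'
    · have := mul_nonneg h0 hα.le
      exact (by linarith : 0 < 1 - t + t * α).ne'
  have hd : ∀ t ∈ Icc (0 : ℝ) 1, ∀ p, HasFDerivAt (fun p => (1 - t + t * α) • h t p - t • c)
      ((1 - t + t * α) • fderiv ℝ (h t) p) p := fun t ht p =>
    ((H.differentiable t ht p).hasFDerivAt.fun_const_smul _).sub_const _
  refine ⟨fun p => by simp [H.zero], fun t ht p q hpq => ?_,
    fun t ht p => (hd t ht p).differentiableAt, fun t ht p => ?_, ?_, ?_⟩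
  · exact H.injective t ht (smul_right_injective _ (hpos t ht) (sub_left_injective hpq))
  · rw [(hd t ht p).fderiv]
    intro v w hvw
    exact H.fderiv_injective t ht p (smul_right_injective _ (hpos t ht) hvw)
  · have := H.continuousOn
    fun_prop
  · have h1 := H.continuousOn_fderiv
    have h2 : ContinuousOn (fun q : ℝ × Plane => (1 - q.1 + q.1 * α) • fderiv ℝ (h q.1) q.2)
      (Icc 0 1 ×ˢ univ) := by fun_prop
    exact h2.congr fun q hq => (hd q.1 hq.1 q.2).fderiv

theorem IsPlaneFamily.hasDerivAt_comp {h : ℝ → Plane → Plane} (H : IsPlaneFamily h) {t : ℝ}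
    (ht : t ∈ Icc (0 : ℝ) 1) {f : ℝ → Plane} {u : ℝ} (hf : DifferentiableAt ℝ f u) :
    HasDerivAt (fun v => h t (f v)) (fderiv ℝ (h t) (f u) (deriv f u)) u :=
  (H.differentiable t ht _).hasFDerivAt.comp_hasDerivAt u hf.hasDerivAt

theorem IsPlaneFamily.c1FamilyOn {h : ℝ → Plane → Plane} (H : IsPlaneFamily h) {f : ℝ → Plane}
    (hf : ContDiff ℝ 1 f) : C1FamilyOn (fun t u => h t (f u)) univ := by
  have hc : ContinuousOn (fun p : ℝ × ℝ => ((p.1, f p.2) : ℝ × Plane)) (Icc 0 1 ×ˢ univ) :=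
    continuousOn_fst.prodMk (hf.continuous.comp continuous_snd).continuousOn
  have hm : MapsTo (fun p : ℝ × ℝ => ((p.1, f p.2) : ℝ × Plane)) (Icc 0 1 ×ˢ univ)
    (Icc 0 1 ×ˢ univ) := fun p hp => ⟨hp.1, mem_univ _⟩
  refine C1FamilyOn.of_hasDerivAt
    (fun t ht u _ => H.hasDerivAt_comp ht (hf.differentiable one_ne_zero u))
    (H.continuousOn.comp hc hm) ((H.continuousOn_fderiv.comp hc hm).clm_apply ?_)
  exact ((hf.continuous_deriv le_rfl).comp continuous_snd).continuousOn

/-- The curve `L` after the plane motion `h t`, its heights being moved towards `g` along straight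
lines. -/
def movedCurve (h : ℝ → Plane → Plane) (L : ℝ → Space) (g : ℝ → ℝ) (t u : ℝ) : Space :=
  (h t (L u).1, (1 - t) * (L u).2 + t * g u)

section moved

variable {h : ℝ → Plane → Plane} (H : IsPlaneFamily h) {L : ℝ → Space} {g : ℝ → ℝ}

theorem movedCurve_zero (hz : ∀ p, h 0 p = p) : movedCurve h L g 0 = L := by
  funext u
  simp [movedCurve, hz]

theorem movedCurve_one : movedCurve h L g 1 = fun u => (h 1 (L u).1, g u) := by
  funext u
  simp [movedCurve]

include H in
theorem movedCurve_family (hL : ContDiff ℝ 1 L) (hg : ContDiff ℝ 1 g) :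
    C1FamilyOn (movedCurve h L g) univ :=
  (H.c1FamilyOn hL.fst).prodMk (C1FamilyOn.interpolate hL.snd hg univ)

include H in
theorem movedCurve_deriv_ne_zero (hL : ContDiff ℝ 1 L) (hg : ContDiff ℝ 1 g)
    (hi : ∀ u, planeVel L u ≠ 0) {t : ℝ} (ht : t ∈ Icc (0 : ℝ) 1) (u : ℝ) :
    deriv (movedCurve h L g t) u ≠ 0 := by
  refine deriv_ne_zero_of_fst ((movedCurve_family H hL hg).diff t ht u (mem_univ _)) ?_
  have h1 := H.hasDerivAt_comp ht (hL.fst.differentiable one_ne_zero u)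
  simp only [movedCurve]
  rw [h1.deriv]
  intro h2
  exact hi u (H.fderiv_injective t ht _ (h2.trans (map_zero _).symm))

theorem interpolate_lt {a b a' b' t : ℝ} (ht : t ∈ Icc (0 : ℝ) 1) (h : a < b) (h' : a' < b') :
    (1 - t) * a + t * a' < (1 - t) * b + t * b' := by
  obtain ⟨h0, h1⟩ := ht
  rcases h0.eq_or_lt with rfl | h0
  · simpa using h
  · have := mul_lt_mul_of_pos_left h' h0
    have := mul_le_mul_of_nonneg_left h.le (sub_nonneg.2 h1)
    linarith

include H in
theorem movedCurve_ne {M : ℝ → Space} {μ : ℝ → ℝ} {t u v : ℝ} (ht : t ∈ Icc (0 : ℝ) 1)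
    (hc : (L u).1 = (M v).1 → (L u).2 < (M v).2 ∧ g u < μ v ∨ (M v).2 < (L u).2 ∧ μ v < g u) :
    movedCurve h L g t u ≠ movedCurve h M μ t v := by
  intro he
  have h1 := H.injective t ht (congrArg Prod.fst he)
  have h2 : (1 - t) * (L u).2 + t * g u = (1 - t) * (M v).2 + t * μ v := congrArg Prod.snd he
  rcases hc h1 with h3 | h3
  · exact (interpolate_lt ht h3.1 h3.2).ne h2
  · exact (interpolate_lt ht h3.1 h3.2).ne' h2

include H in
theorem movedCurve_isSphereKnot (hL : ContDiff ℝ 1 L) (hg : ContDiff ℝ 1 g)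
    (hp : Periodic L 1) (hgp : Periodic g 1) (hi : ∀ u, planeVel L u ≠ 0)
    (hs : ∀ u v, (L u).1 = (L v).1 → ¬ SameParam u v →
      (L u).2 < (L v).2 ∧ g u < g v ∨ (L v).2 < (L u).2 ∧ g v < g u) {t : ℝ}
    (ht : t ∈ Icc (0 : ℝ) 1) : IsSphereKnot (sphereCurve (movedCurve h L g t)) := by
  refine isSphereKnot_sphereCurve ((movedCurve_family H hL hg).contDiff ht)
    (fun u => by simp only [movedCurve, hp u, hgp u]) (fun u v he => ?_)
    (movedCurve_deriv_ne_zero H hL hg hi ht)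
  by_contra hn
  exact movedCurve_ne H ht (fun h1 => hs u v h1 hn) he

end moved

/-- The diagram `D` with new heights, the order of the strands at the crossings being kept. -/
structure IsHeightChange (D : ℝ → Space) (g : ℝ → ℝ) : Prop where
  contDiff : ContDiff ℝ 1 g
  periodic : Periodic g 1
  pos_of_over : ∀ u, IsOvercrossing D u → 0 < g u
  neg_of_under : ∀ u, IsUndercrossing D u → g u < 0

theorem SameParam.eq_of_periodic {E : Type*} {f : ℝ → E} (hf : Periodic f 1) {u v : ℝ}
    (h : SameParam u v) : f u = f v := by
  obtain ⟨n, rfl⟩ := h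
  have := hf.int_mul n u
  rw [mul_one] at this
  exact this.symm

theorem IsHeightChange.isSphereKnot {D : ℝ → Space} {g : ℝ → ℝ} (hg : IsHeightChange D g)
    (hD : IsKnotDiagram D) {h : ℝ → Plane → Plane} (H : IsPlaneFamily h) {t : ℝ}
    (ht : t ∈ Icc (0 : ℝ) 1) : IsSphereKnot (sphereCurve (movedCurve h D g t)) := by
  refine movedCurve_isSphereKnot H hD.contDiff hg.contDiff hD.periodic hg.periodic hD.immersed
    (fun u v h1 hn => ?_) ht
  rcases lt_trichotomy (D u).2 (D v).2 with h2 | h2 | h2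
  · exact Or.inl ⟨h2, (hg.neg_of_under u ⟨v, h1, h2⟩).trans (hg.pos_of_over v ⟨u, h1.symm, h2⟩)⟩
  · exact absurd (hD.simple u v (Prod.ext h1 h2)) hn
  · exact Or.inr ⟨h2, (hg.neg_of_under v ⟨u, h1.symm, h2⟩).trans (hg.pos_of_over u ⟨v, h1, h2⟩)⟩

/-- A plane motion and a change of heights that keeps the order of the strands at the crossings
is an isotopy of links with two closed components. -/
theorem isIsotopic_of_heightChange {D M : ℝ → Space} {g μ : ℝ → ℝ} {h : ℝ → Plane → Plane}
    (H : IsPlaneFamily h) (hD : IsKnotDiagram D) (hg : IsHeightChange D g) (hM : IsPlaneCircle M)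
    (hμ : ContDiff ℝ 1 μ) (hμp : Periodic μ 1)
    (hc : ∀ u v, (D u).1 = (M v).1 →
      (D u).2 < (M v).2 ∧ g u < μ v ∨ (M v).2 < (D u).2 ∧ μ v < g u) :
    IsIsotopic (sphereCurve D) (sphereCurve M) (sphereCurve fun u => (h 1 (D u).1, g u))
      (sphereCurve fun v => (h 1 (M v).1, μ v)) := by
  refine IsIsotopic.of_families (F := fun t => sphereCurve (movedCurve h D g t))
    (G := fun t => sphereCurve (movedCurve h M μ t))
    ((movedCurve_family H hD.contDiff hg.contDiff).comp_contDiff toSphere_contDiff)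
    ((movedCurve_family H hM.contDiff hμ).comp_contDiff toSphere_contDiff)
    (fun t ht => ⟨hg.isSphereKnot hD H ht, ?_, fun u v he => ?_⟩) ?_ ?_ ?_ ?_
  · exact movedCurve_isSphereKnot H hM.contDiff hμ hM.periodic hμp hM.immersed
      (fun u v h1 hn => absurd (hM.simple u v h1) hn) ht
  · exact movedCurve_ne H ht (hc u v) (toSphere_injective he)
  all_goals simp only [movedCurve_zero H.zero, movedCurve_one]

/-- A compactly supported plane isotopy and a change of heights that keeps the order of the
strands at the crossings is an isotopy of a knot together with a line through infinity; the
heights of the line are moved to zero. -/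
theorem isIsotopic_line_of_heightChange {D T : ℝ → Space} {g : ℝ → ℝ} {h : ℝ → Plane → Plane}
    (H : IsPlaneIsotopy h) (hD : IsKnotDiagram D) (hg : IsHeightChange D g)
    (hT : IsLineThroughInfinity T)
    (hc : ∀ u s, (D u).1 = (T s).1 →
      (D u).2 < (T s).2 ∧ g u < 0 ∨ (T s).2 < (D u).2 ∧ 0 < g u) :
    IsIsotopic (sphereCurve D) (sphereLine T) (sphereCurve fun u => (h 1 (D u).1, g u))
      (sphereLine fun s => (h 1 (T s).1, 0)) := by
  have H' := H.isPlaneFamily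
  have hT0 : ContDiff ℝ 1 fun _ : ℝ => (0 : ℝ) := contDiff_const
  obtain ⟨R₁, hR₁⟩ := H.compact_support
  obtain ⟨R₂, hR₂⟩ := hT.straight
  have hst : ∀ t ∈ Icc (0 : ℝ) 1, ∀ s, max R₁ R₂ ≤ |s| →
      movedCurve h T (fun _ => 0) t s = ((s, 0), 0) := by
    intro t ht s hs
    have h1 := hR₂ s ((le_max_right _ _).trans hs)
    have h2 : h t (s, 0) = (s, 0) := by
      refine hR₁ t ht (s, 0) ?_
      rw [Prod.norm_def]
      simpa using (le_max_left _ _).trans hs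
    simp [movedCurve, h1, h2]
  have hf := movedCurve_family H' hT.contDiff hT0
  refine IsIsotopic.of_families (F := fun t => sphereCurve (movedCurve h D g t))
    (G := fun t => sphereLine (movedCurve h T (fun _ => 0) t))
    ((movedCurve_family H' hD.contDiff hg.contDiff).comp_contDiff toSphere_contDiff)
    (hf.sphereLine hst) (fun t ht => ⟨hg.isSphereKnot hD H' ht, ?_, fun u v he => ?_⟩) ?_ ?_ ?_ ?_
  · refine isSphereKnot_sphereLine (hf.contDiff ht) (fun u v he => ?_)
      (movedCurve_deriv_ne_zero H' hT.contDiff hT0 hT.immersed ht) (hst t ht)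
    exact hT.simple u v (H'.injective t ht (congrArg Prod.fst he))
  · by_cases hv : Real.sin (Real.pi * v) = 0
    · rw [sphereLine, if_pos hv] at he
      exact toSphere_ne_infinity _ he
    · rw [sphereLine_of_sin_ne_zero _ hv] at he
      exact movedCurve_ne H' ht (hc u _) (toSphere_injective he)
  all_goals simp only [movedCurve_zero H'.zero, movedCurve_one]

/-! ### The diagram in the plane of an arrangement -/

namespace Arrangement

variable {D : ℝ → Space} (A : Arrangement D)

/-- The first coordinate of the diagram after the plane isotopy. -/
def abscissa (u : ℝ) : ℝ := (A.h 1 (D u).1).1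

/-- The second coordinate of the diagram after the plane isotopy. -/
def ordinate (u : ℝ) : ℝ := (A.h 1 (D u).1).2

theorem one_mem : (1 : ℝ) ∈ Icc (0 : ℝ) 1 := by simp

theorem planar_contDiff {L : ℝ → Space} (hL : ContDiff ℝ 1 L) :
    ContDiff ℝ 1 fun u => A.h 1 (L u).1 :=
  (A.isotopy.isPlaneFamily.c1FamilyOn hL.fst).contDiff one_mem

theorem ordinate_contDiff (hD : ContDiff ℝ 1 D) : ContDiff ℝ 1 A.ordinate :=
  (A.planar_contDiff hD).snd

theorem ordinate_periodic (hD : Periodic D 1) : Periodic A.ordinate 1 :=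
  fun u => by simp only [ordinate, hD u]

theorem abscissa_periodic (hD : Periodic D 1) : Periodic A.abscissa 1 :=
  fun u => by simp only [abscissa, hD u]

theorem deriv_ordinate_ne_zero {u : ℝ} (h : A.ordinate u = 0) : deriv A.ordinate u ≠ 0 :=
  (A.axis_regular u h).1

theorem start_add_mul (i n : ℤ) : A.σ (i + n * A.k) = A.σ i + n := by
  induction n using Int.induction_on with
  | zero => simp
  | succ m ih =>
    have := A.sequence.start_period (i + m * A.k)
    rw [ih] at this
    push_cast at this ⊢
    rw [← add_assoc, ← this]
    ring_nf
  | pred m ih =>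
    have := A.sequence.start_period (i + (-m - 1) * A.k)
    rw [show i + (-(m : ℤ) - 1) * A.k + A.k = i + (-m) * A.k by ring, ih] at this
    push_cast at this ⊢
    linarith

theorem finish_add_mul (i n : ℤ) : A.φ (i + n * A.k) = A.φ i + n := by
  induction n using Int.induction_on with
  | zero => simp
  | succ m ih =>
    have := A.sequence.finish_period (i + m * A.k)
    rw [ih] at this
    push_cast at this ⊢
    rw [← add_assoc, ← this]
    ring_nf
  | pred m ih =>
    have := A.sequence.finish_period (i + (-m - 1) * A.k)
    rw [show i + (-(m : ℤ) - 1) * A.k + A.k = i + (-m) * A.k by ring, ih] at this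
    push_cast at this ⊢
    linarith

/-- Every overpass is a translate of one of the overpasses with indices `0, …, k - 1`. -/
theorem exists_index (i : ℤ) : ∃ (j : ℤ) (n : ℤ), 0 ≤ j ∧ j < A.k ∧ A.σ i = A.σ j + n ∧
    A.φ i = A.φ j + n := by
  have hk : (0 : ℤ) < A.k := by exact_mod_cast A.k_pos
  refine ⟨i % A.k, i / A.k, Int.emod_nonneg _ hk.ne', Int.emod_lt_of_pos _ hk, ?_, ?_⟩
  · rw [← A.start_add_mul, Int.emod_add_ediv_mul]
  · rw [← A.finish_add_mul, Int.emod_add_ediv_mul]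

theorem start_lt_finish (i : ℤ) : A.σ i < A.φ i := A.sequence.start_lt_finish i

theorem start_strictMono : StrictMono A.σ := strictMono_int_of_lt_succ fun i =>
  (A.sequence.start_lt_finish i).trans (A.sequence.finish_lt_start i)

theorem finish_lt_start_of_lt {i j : ℤ} (h : i < j) : A.φ i < A.σ j :=
  (A.sequence.finish_lt_start i).trans_le (A.start_strictMono.monotone (Int.add_one_le_iff.2 h))

theorem index_unique {i j : ℤ} {u : ℝ} (hi : u ∈ Icc (A.σ i) (A.φ i))
    (hj : u ∈ Icc (A.σ j) (A.φ j)) : i = j := by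
  rcases lt_trichotomy i j with h | h | h
  · have := A.finish_lt_start_of_lt h
    linarith [hi.2, hj.1]
  · exact h
  · have := A.finish_lt_start_of_lt h
    linarith [hj.2, hi.1]

theorem finish_le_start_add_one (i : ℤ) : A.φ i ≤ A.σ i + 1 := by
  have hk : (1 : ℤ) ≤ A.k := by exact_mod_cast A.k_pos
  rw [← A.sequence.start_period]
  exact (A.finish_lt_start_of_lt (by linarith)).le

theorem onOverpass_add_one {u : ℝ} (h : A.OnOverpass u) : A.OnOverpass (u + 1) := by
  obtain ⟨i, h1, h2⟩ := h
  refine ⟨i + A.k, ?_, ?_⟩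
  · rw [A.sequence.start_period]; linarith
  · rw [A.sequence.finish_period]; linarith

theorem onOverpass_sub_one {u : ℝ} (h : A.OnOverpass u) : A.OnOverpass (u - 1) := by
  obtain ⟨i, h1, h2⟩ := h
  have h3 := A.sequence.start_period (i - A.k)
  have h4 := A.sequence.finish_period (i - A.k)
  rw [sub_add_cancel] at h3 h4
  exact ⟨i - A.k, by linarith, by linarith⟩

theorem onOverpass_periodic : Periodic A.OnOverpass 1 := fun u => propext
  ⟨fun h => by simpa using A.onOverpass_sub_one h, A.onOverpass_add_one⟩

theorem onOverpass_congr {u v : ℝ} (h : SameParam u v) : A.OnOverpass u ↔ A.OnOverpass v :=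
  (h.eq_of_periodic A.onOverpass_periodic).to_iff

theorem exists_mem_Ico (u : ℝ) : ∃ i, u ∈ Ico (A.σ i) (A.σ (i + 1)) := by
  have hb : ∃ b : ℤ, ∀ z : ℤ, A.σ z ≤ u → z ≤ b := by
    refine ⟨(⌊u - A.σ 0⌋ + 1) * A.k, fun z hz => ?_⟩
    by_contra hn
    push Not at hn
    have h1 := A.start_strictMono hn
    have h2 := A.start_add_mul 0 (⌊u - A.σ 0⌋ + 1)
    rw [zero_add] at h2
    rw [h2] at h1
    have := Int.lt_floor_add_one (u - A.σ 0)
    push_cast at h1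
    linarith
  have he : ∃ z : ℤ, A.σ z ≤ u := by
    refine ⟨⌊u - A.σ 0⌋ * A.k, ?_⟩
    have h2 := A.start_add_mul 0 ⌊u - A.σ 0⌋
    rw [zero_add] at h2
    rw [h2]
    have := Int.floor_le (u - A.σ 0)
    linarith
  obtain ⟨i, hi, hmax⟩ := Int.exists_greatest_of_bdd hb he
  refine ⟨i, hi, ?_⟩
  by_contra hn
  push Not at hn
  have := hmax _ hn
  linarith

theorem onOverpass_of_isOvercrossing {u : ℝ} (h : IsOvercrossing D u) : A.OnOverpass u := by
  obtain ⟨i, h1, h2⟩ := A.exists_mem_Ico u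
  rcases le_total u (A.φ i) with h3 | h3
  · exact ⟨i, h1, h3⟩
  · exact absurd h ((A.sequence.underpass i).2 u ⟨h3, h2.le⟩)

theorem not_onOverpass_of_isUndercrossing {u : ℝ} (h : IsUndercrossing D u) :
    ¬ A.OnOverpass u := by
  rintro ⟨i, hi⟩
  exact (A.sequence.overpass i).2 u hi h

variable {A}

theorem start_pos (hD : Periodic D 1) (i : ℤ) : 0 < A.ordinate (A.σ i) := by
  obtain ⟨j, n, h0, hk, h1, -⟩ := A.exists_index i
  rw [h1, ← SameParam.eq_of_periodic (A.ordinate_periodic hD) ⟨n, rfl⟩]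
  exact A.start_above j h0 hk

theorem finish_lt (hD : Periodic D 1) (i : ℤ) : A.ordinate (A.φ i) < -A.ε := by
  obtain ⟨j, n, h0, hk, -, h1⟩ := A.exists_index i
  rw [h1, ← SameParam.eq_of_periodic (A.ordinate_periodic hD) ⟨n, rfl⟩]
  exact A.finish_below j h0 hk

theorem finish_neg (hD : Periodic D 1) (i : ℤ) : A.ordinate (A.φ i) < 0 := by
  linarith [A.finish_lt hD i, A.ε_pos]

theorem ordinate_strictAntiOn (hD : Periodic D 1) (i : ℤ) :
    StrictAntiOn A.ordinate (Icc (A.σ i) (A.φ i)) := by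
  obtain ⟨j, n, h0, hk, h1, h2⟩ := A.exists_index i
  rw [h1, h2]
  rintro u ⟨hu1, hu2⟩ v ⟨hv1, hv2⟩ huv
  have hs : ∀ w, A.ordinate (w - n) = A.ordinate w := fun w =>
    SameParam.eq_of_periodic (A.ordinate_periodic hD) ⟨n, by ring⟩
  rw [← hs u, ← hs v]
  exact A.downward j h0 hk ⟨by linarith, by linarith⟩ ⟨by linarith, by linarith⟩ (by linarith)

theorem abscissa_mem_Ioo (hD : Periodic D 1) {u : ℝ} (h : A.OnOverpass u) :
    A.abscissa u ∈ Ioo A.a A.b := by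
  obtain ⟨i, hi1, hi2⟩ := h
  obtain ⟨j, n, h0, hk, h1, h2⟩ := A.exists_index i
  have hs : A.abscissa (u - n) = A.abscissa u :=
    SameParam.eq_of_periodic (A.abscissa_periodic hD) ⟨n, by ring⟩
  have h3 : A.abscissa (u - n) = A.x j :=
    A.vertical j h0 hk (u - n) ⟨by linarith, by linarith⟩
  rw [← hs, h3]
  exact A.between j h0 hk

theorem a_lt_b : A.a < A.b := by
  have h := A.between 0 le_rfl (by exact_mod_cast A.k_pos)
  exact h.1.trans h.2

/-- On an overpass the diagram crosses the axis downward. -/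
theorem deriv_ordinate_neg (hD : IsKnotDiagram D) {u : ℝ} (hu : A.OnOverpass u)
    (h0 : A.ordinate u = 0) : deriv A.ordinate u < 0 := by
  obtain ⟨i, hi⟩ := hu
  have h1 : A.σ i < u := hi.1.lt_of_ne fun h => by
    have := A.start_pos hD.periodic i
    rw [h, h0] at this
    exact this.false
  have h2 : u < A.φ i := hi.2.lt_of_ne fun h => by
    have := A.finish_neg hD.periodic i
    rw [← h, h0] at this
    exact this.false
  refine lt_of_le_of_ne ?_ (A.deriv_ordinate_ne_zero h0)
  have h3 : derivWithin A.ordinate (Icc (A.σ i) (A.φ i)) u = deriv A.ordinate u :=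
    derivWithin_of_mem_nhds (Icc_mem_nhds h1 h2)
  rw [← h3]
  exact (A.ordinate_strictAntiOn hD.periodic i).antitoneOn.derivWithin_nonpos

theorem exists_zero_mem_overpass (hD : IsKnotDiagram D) (i : ℤ) :
    ∃ u ∈ Icc (A.σ i) (A.φ i), A.ordinate u = 0 := by
  have h := intermediate_value_Icc' (A.start_lt_finish i).le
    (A.ordinate_contDiff hD.contDiff).continuous.continuousOn
  exact h ⟨(A.finish_neg hD.periodic i).le, (A.start_pos hD.periodic i).le⟩

end Arrangement

/-! ### Neighbouring zeros of a periodic function -/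

/-- The first zero of `y` after `u`. -/
def nextZero (y : ℝ → ℝ) (u : ℝ) : ℝ := sInf {c | u < c ∧ y c = 0}

/-- The last zero of `y` before `u`. -/
def prevZero (y : ℝ → ℝ) (u : ℝ) : ℝ := sSup {c | c < u ∧ y c = 0}

section zeros

variable {y : ℝ → ℝ} (hy : Continuous y) (hp : Periodic y 1) (hz : ∃ c, y c = 0)

include hp hz in
theorem exists_zero_Ioc (u : ℝ) : ∃ c, u < c ∧ c ≤ u + 1 ∧ y c = 0 := by
  obtain ⟨c, hc⟩ := hz
  refine ⟨c + (⌊u - c⌋ + 1 : ℤ), ?_, ?_, ?_⟩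
  · push_cast; linarith [Int.lt_floor_add_one (u - c)]
  · push_cast; linarith [Int.floor_le (u - c)]
  · rw [← SameParam.eq_of_periodic hp ⟨_, rfl⟩, hc]

include hp hz in
theorem exists_zero_Ico (u : ℝ) : ∃ c, c < u ∧ u - 1 ≤ c ∧ y c = 0 := by
  obtain ⟨c, hc⟩ := hz
  refine ⟨c + (⌈u - c⌉ - 1 : ℤ), ?_, ?_, ?_⟩
  · push_cast; linarith [Int.ceil_lt_add_one (u - c)]
  · push_cast; linarith [Int.le_ceil (u - c)]
  · rw [← SameParam.eq_of_periodic hp ⟨_, rfl⟩, hc]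

theorem bddBelow_zeros (u : ℝ) : BddBelow {c | u < c ∧ y c = 0} := ⟨u, fun _ hc => hc.1.le⟩

theorem bddAbove_zeros (u : ℝ) : BddAbove {c | c < u ∧ y c = 0} := ⟨u, fun _ hc => hc.1.le⟩

theorem nextZero_le {u c : ℝ} (h : u < c) (hc : y c = 0) : nextZero y u ≤ c :=
  csInf_le (bddBelow_zeros u) ⟨h, hc⟩

theorem le_prevZero {u c : ℝ} (h : c < u) (hc : y c = 0) : c ≤ prevZero y u :=
  le_csSup (bddAbove_zeros u) ⟨h, hc⟩

include hp hz in
theorem nextZero_le_add_one (u : ℝ) : nextZero y u ≤ u + 1 := by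
  obtain ⟨c, h1, h2, h3⟩ := exists_zero_Ioc hp hz u
  exact (nextZero_le h1 h3).trans h2

include hp hz in
theorem sub_one_le_prevZero (u : ℝ) : u - 1 ≤ prevZero y u := by
  obtain ⟨c, h1, h2, h3⟩ := exists_zero_Ico hp hz u
  exact h2.trans (le_prevZero h1 h3)

theorem ne_zero_of_prevZero_lt {u c : ℝ} (h : c < u) (hc : prevZero y u < c) : y c ≠ 0 :=
  fun h0 => (le_prevZero h h0).not_gt hc

include hy hp hz in
theorem nextZero_mem {u : ℝ} (hu : y u ≠ 0) : u < nextZero y u ∧ y (nextZero y u) = 0 := by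
  have hne : {c | u < c ∧ y c = 0}.Nonempty := by
    obtain ⟨c, h1, -, h3⟩ := exists_zero_Ioc hp hz u
    exact ⟨c, h1, h3⟩
  have hcl : IsClosed {c | u < c ∧ y c = 0} := by
    have : {c | u < c ∧ y c = 0} = {c | u ≤ c ∧ y c = 0} := by
      ext c
      refine ⟨fun h => ⟨h.1.le, h.2⟩, fun h => ⟨h.1.lt_of_ne ?_, h.2⟩⟩
      rintro rfl
      exact hu h.2
    rw [this]
    exact (isClosed_le continuous_const continuous_id).inter (isClosed_eq hy continuous_const)
  exact hcl.csInf_mem hne (bddBelow_zeros u)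

include hy hp hz in
theorem prevZero_mem {u : ℝ} (hu : y u ≠ 0) : prevZero y u < u ∧ y (prevZero y u) = 0 := by
  have hne : {c | c < u ∧ y c = 0}.Nonempty := by
    obtain ⟨c, h1, -, h3⟩ := exists_zero_Ico hp hz u
    exact ⟨c, h1, h3⟩
  have hcl : IsClosed {c | c < u ∧ y c = 0} := by
    have : {c | c < u ∧ y c = 0} = {c | c ≤ u ∧ y c = 0} := by
      ext c
      refine ⟨fun h => ⟨h.1.le, h.2⟩, fun h => ⟨h.1.lt_of_ne ?_, h.2⟩⟩
      rintro rfl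
      exact hu h.2
    rw [this]
    exact (isClosed_le continuous_id continuous_const).inter (isClosed_eq hy continuous_const)
  exact hcl.csSup_mem hne (bddAbove_zeros u)

include hy in
/-- Between parameters that no zero separates, the sign does not change. -/
theorem mul_pos_of_Icc_ne_zero {u v : ℝ} (h : ∀ c ∈ uIcc u v, y c ≠ 0) : 0 < y u * y v := by
  by_contra hn
  push Not at hn
  have h0 : (0 : ℝ) ∈ uIcc (y u) (y v) := by
    rcases le_total (y u) 0 with h1 | h1
    · rcases le_total 0 (y v) with h2 | h2
      · exact mem_uIcc.2 (Or.inl ⟨h1, h2⟩)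
      · have h3 : y u * y v = 0 := le_antisymm hn (mul_nonneg_of_nonpos_of_nonpos h1 h2)
        rcases mul_eq_zero.1 h3 with h4 | h4
        · exact absurd h4 (h u left_mem_uIcc)
        · exact absurd h4 (h v right_mem_uIcc)
    · rcases le_total (y v) 0 with h2 | h2
      · exact mem_uIcc.2 (Or.inr ⟨h2, h1⟩)
      · have h3 : y u * y v = 0 := le_antisymm hn (mul_nonneg h1 h2)
        rcases mul_eq_zero.1 h3 with h4 | h4
        · exact absurd h4 (h u left_mem_uIcc)
        · exact absurd h4 (h v right_mem_uIcc)
  obtain ⟨c, hc, hc0⟩ := intermediate_value_uIcc hy.continuousOn h0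
  exact h c hc hc0

theorem nextZero_eq_of_uIcc {u v : ℝ} (h : ∀ c ∈ uIcc u v, y c ≠ 0) :
    nextZero y u = nextZero y v := by
  unfold nextZero
  congr 1
  ext c
  refine and_congr_left fun hc => ⟨fun h1 => ?_, fun h1 => ?_⟩ <;> by_contra h2 <;>
    push Not at h2
  · exact h c (mem_uIcc.2 (Or.inl ⟨h1.le, h2⟩)) hc
  · exact h c (mem_uIcc.2 (Or.inr ⟨h1.le, h2⟩)) hc

theorem prevZero_eq_of_uIcc {u v : ℝ} (h : ∀ c ∈ uIcc u v, y c ≠ 0) :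
    prevZero y u = prevZero y v := by
  unfold prevZero
  congr 1
  ext c
  refine and_congr_left fun hc => ⟨fun h1 => ?_, fun h1 => ?_⟩ <;> by_contra h2 <;>
    push Not at h2
  · exact h c (mem_uIcc.2 (Or.inr ⟨h2, h1.le⟩)) hc
  · exact h c (mem_uIcc.2 (Or.inl ⟨h2, h1.le⟩)) hc

include hp hz in
theorem nextZero_add_one (u : ℝ) : nextZero y (u + 1) = nextZero y u + 1 := by
  have : {c | u + 1 < c ∧ y c = 0} = (OrderIso.addRight (1 : ℝ)) '' {c | u < c ∧ y c = 0} := by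
    ext c
    constructor
    · rintro ⟨h1, h2⟩
      exact ⟨c - 1, ⟨by linarith, by rw [hp.sub_eq, h2]⟩, by simp⟩
    · rintro ⟨d, ⟨h1, h2⟩, rfl⟩
      exact ⟨by simpa using h1, by rw [OrderIso.addRight_apply, hp d, h2]⟩
  obtain ⟨c, h1, -, h3⟩ := exists_zero_Ioc hp hz u
  rw [nextZero, this]
  have hne : {c | u < c ∧ y c = 0}.Nonempty := ⟨c, h1, h3⟩
  exact ((OrderIso.addRight (1 : ℝ)).map_csInf' hne (bddBelow_zeros u)).symm

include hp hz in
theorem prevZero_add_one (u : ℝ) : prevZero y (u + 1) = prevZero y u + 1 := by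
  have : {c | c < u + 1 ∧ y c = 0} = (OrderIso.addRight (1 : ℝ)) '' {c | c < u ∧ y c = 0} := by
    ext c
    constructor
    · rintro ⟨h1, h2⟩
      exact ⟨c - 1, ⟨by linarith, by rw [hp.sub_eq, h2]⟩, by simp⟩
    · rintro ⟨d, ⟨h1, h2⟩, rfl⟩
      exact ⟨by simpa using h1, by rw [OrderIso.addRight_apply, hp d, h2]⟩
  obtain ⟨c, h1, -, h3⟩ := exists_zero_Ico hp hz u
  rw [prevZero, this]
  have hne : {c | c < u ∧ y c = 0}.Nonempty := ⟨c, h1, h3⟩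
  exact ((OrderIso.addRight (1 : ℝ)).map_csSup' hne (bddAbove_zeros u)).symm

end zeros

/-! ### Pivots -/

namespace Arrangement

variable {D : ℝ → Space} {A : Arrangement D}

open Classical in
/-- The value `τ i` (an end of the overpass number `i`) if `c` lies on that overpass,
and `c` itself if `c` lies on no overpass. -/
def overpassEnd (A : Arrangement D) (τ : ℤ → ℝ) (c : ℝ) : ℝ :=
  if h : A.OnOverpass c then τ h.choose else c

theorem overpassEnd_of_mem {τ : ℤ → ℝ} {c : ℝ} {i : ℤ} (h : c ∈ Icc (A.σ i) (A.φ i)) :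
    A.overpassEnd τ c = τ i := by
  have h' : A.OnOverpass c := ⟨i, h⟩
  rw [overpassEnd, dif_pos h', A.index_unique h'.choose_spec h]

theorem overpassEnd_of_not {τ : ℤ → ℝ} {c : ℝ} (h : ¬ A.OnOverpass c) :
    A.overpassEnd τ c = c := dif_neg h

theorem overpassEnd_add_one {τ : ℤ → ℝ} (hτ : ∀ i, τ (i + A.k) = τ i + 1) (c : ℝ) :
    A.overpassEnd τ (c + 1) = A.overpassEnd τ c + 1 := by
  by_cases h : A.OnOverpass c
  · obtain ⟨i, hi⟩ := h
    have h1 : c + 1 ∈ Icc (A.σ (i + A.k)) (A.φ (i + A.k)) := by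
      rw [A.sequence.start_period, A.sequence.finish_period]
      exact ⟨by linarith [hi.1], by linarith [hi.2]⟩
    rw [overpassEnd_of_mem hi, overpassEnd_of_mem h1, hτ]
  · have h1 : ¬ A.OnOverpass (c + 1) := fun h2 => h (by simpa using A.onOverpass_sub_one h2)
    rw [overpassEnd_of_not h, overpassEnd_of_not h1]

theorem overpassEnd_mem {τ : ℤ → ℝ} (hτ : ∀ i, τ i ∈ Icc (A.σ i) (A.φ i)) (c : ℝ) :
    |A.overpassEnd τ c - c| ≤ 1 := by
  by_cases h : A.OnOverpass c
  · obtain ⟨i, hi⟩ := h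
    have h1 := A.finish_le_start_add_one i
    rw [overpassEnd_of_mem hi, abs_le]
    exact ⟨by linarith [hi.2, (hτ i).1], by linarith [hi.1, (hτ i).2]⟩
  · simp [overpassEnd_of_not h]

/-- The pivot of an arc of the diagram on one side of the axis: its overcrossings and
its undercrossings are on different sides of the pivot. Above the axis the overcrossings come
after the pivot, below the axis they come before it. -/
def pivot (A : Arrangement D) (u : ℝ) : ℝ :=
  if 0 < A.ordinate u then A.overpassEnd A.σ (nextZero A.ordinate u)
  else A.overpassEnd A.φ (prevZero A.ordinate u)

section

variable (hD : IsKnotDiagram D)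
include hD

theorem exists_ordinate_eq_zero : ∃ u, A.ordinate u = 0 := by
  obtain ⟨u, -, hu⟩ := A.exists_zero_mem_overpass hD 0
  exact ⟨u, hu⟩

theorem pivot_add_one (u : ℝ) : A.pivot (u + 1) = A.pivot u + 1 := by
  have hp := A.ordinate_periodic hD.periodic
  simp only [pivot, hp u, nextZero_add_one hp (exists_ordinate_eq_zero hD), prevZero_add_one hp
    (exists_ordinate_eq_zero hD), overpassEnd_add_one A.sequence.start_period,
    overpassEnd_add_one A.sequence.finish_period]
  split_ifs <;> rfl

theorem pivot_eventually_eq {u : ℝ} (hu : A.ordinate u ≠ 0) : ∀ᶠ v in nhds u,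
    A.pivot v = A.pivot u := by
  have hc := (A.ordinate_contDiff hD.contDiff).continuous
  have h1 : ∀ᶠ v in nhds u, A.ordinate v ≠ 0 := hc.continuousAt.eventually_ne hu
  obtain ⟨r, hr, hball⟩ := Metric.eventually_nhds_iff_ball.1 h1
  filter_upwards [Metric.ball_mem_nhds u hr] with v hv
  have h2 : ∀ c ∈ uIcc v u, A.ordinate c ≠ 0 := fun c hc =>
    hball c ((convex_ball u r).ordConnected.uIcc_subset hv (Metric.mem_ball_self hr) hc)
  have h3 := mul_pos_of_Icc_ne_zero hc h2
  have h4 : 0 < A.ordinate v ↔ 0 < A.ordinate u :=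
    ⟨fun h => (mul_pos_iff_of_pos_left h).1 h3, fun h => (mul_pos_iff_of_pos_right h).1 h3⟩
  simp only [pivot, h4, nextZero_eq_of_uIcc h2, prevZero_eq_of_uIcc h2]

theorem abs_sub_pivot_le {u : ℝ} (hu : A.ordinate u ≠ 0) : |u - A.pivot u| ≤ 2 := by
  have hc := (A.ordinate_contDiff hD.contDiff).continuous
  have hp := A.ordinate_periodic hD.periodic
  have hz := exists_ordinate_eq_zero (A := A) hD
  rw [pivot]
  split_ifs
  · have h1 := overpassEnd_mem (A := A) (τ := A.σ)
      (fun i => ⟨le_rfl, (A.start_lt_finish i).le⟩) (nextZero A.ordinate u)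
    have h2 := (nextZero_mem hc hp hz hu).1
    have h3 := nextZero_le_add_one hp hz u
    rw [abs_le] at h1 ⊢
    exact ⟨by linarith, by linarith⟩
  · have h1 := overpassEnd_mem (A := A) (τ := A.φ)
      (fun i => ⟨(A.start_lt_finish i).le, le_rfl⟩) (prevZero A.ordinate u)
    have h2 := (prevZero_mem hc hp hz hu).1
    have h3 := sub_one_le_prevZero hp hz u
    rw [abs_le] at h1 ⊢
    exact ⟨by linarith, by linarith⟩

theorem nextZero_mem_overpass {u : ℝ} {i : ℤ} (hu : 0 < A.ordinate u)
    (hi : u ∈ Icc (A.σ i) (A.φ i)) : nextZero A.ordinate u ∈ Icc (A.σ i) (A.φ i) := by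
  have hc := (A.ordinate_contDiff hD.contDiff).continuous
  have hp := A.ordinate_periodic hD.periodic
  obtain ⟨c, hc1, hc2⟩ := intermediate_value_Icc' hi.2 hc.continuousOn
    ⟨(A.finish_neg hD.periodic i).le, hu.le⟩
  have h1 : u < c := hc1.1.lt_of_ne fun h => by rw [h, hc2] at hu; exact hu.false
  exact ⟨hi.1.trans (nextZero_mem hc hp (exists_ordinate_eq_zero hD) hu.ne').1.le,
    (nextZero_le h1 hc2).trans hc1.2⟩

theorem prevZero_mem_overpass {u : ℝ} {i : ℤ} (hu : A.ordinate u < 0)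
    (hi : u ∈ Icc (A.σ i) (A.φ i)) : prevZero A.ordinate u ∈ Icc (A.σ i) (A.φ i) := by
  have hc := (A.ordinate_contDiff hD.contDiff).continuous
  have hp := A.ordinate_periodic hD.periodic
  obtain ⟨c, hc1, hc2⟩ := intermediate_value_Icc' hi.1 hc.continuousOn
    ⟨hu.le, (A.start_pos hD.periodic i).le⟩
  have h1 : c < u := hc1.2.lt_of_ne fun h => by rw [← h, hc2] at hu; exact hu.false
  exact ⟨hc1.1.trans (le_prevZero h1 hc2),
    (prevZero_mem hc hp (exists_ordinate_eq_zero hD) hu.ne).1.le.trans hi.2⟩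

/-- The product of the ordinate and the position relative to the pivot is a height with the right
sign at the overcrossings. -/
theorem mul_sub_pivot_pos {u : ℝ} (h : IsOvercrossing D u) :
    0 < A.ordinate u * (u - A.pivot u) := by
  have h0 : A.ordinate u ≠ 0 := fun h0 => (A.axis_regular u h0).2 (Or.inl h)
  obtain ⟨i, hi⟩ := A.onOverpass_of_isOvercrossing h
  rcases lt_or_gt_of_ne h0 with h1 | h1
  · have h2 : u ≠ A.φ i := fun h3 => A.sequence.finish_not_crossing i (h3 ▸ Or.inl h)
    rw [pivot, if_neg h1.not_gt, overpassEnd_of_mem (prevZero_mem_overpass hD h1 hi)]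
    exact mul_pos_of_neg_of_neg h1 (sub_neg.2 (hi.2.lt_of_ne h2))
  · have h2 : A.σ i ≠ u := fun h3 => A.sequence.start_not_crossing i (h3 ▸ Or.inl h)
    rw [pivot, if_pos h1, overpassEnd_of_mem (nextZero_mem_overpass hD h1 hi)]
    exact mul_pos h1 (sub_pos.2 (hi.1.lt_of_ne h2))

/-- The product of the ordinate and the position relative to the pivot is a height with the right
sign at the undercrossings. -/
theorem mul_sub_pivot_neg {u : ℝ} (h : IsUndercrossing D u) :
    A.ordinate u * (u - A.pivot u) < 0 := by
  have hc := (A.ordinate_contDiff hD.contDiff).continuous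
  have hp := A.ordinate_periodic hD.periodic
  have h0 : A.ordinate u ≠ 0 := fun h0 => (A.axis_regular u h0).2 (Or.inr h)
  have hu := A.not_onOverpass_of_isUndercrossing h
  rcases lt_or_gt_of_ne h0 with h1 | h1
  · rw [pivot, if_neg h1.not_gt]
    refine mul_neg_of_neg_of_pos h1 (sub_pos.2 ?_)
    have h2 := (prevZero_mem hc hp (exists_ordinate_eq_zero hD) h0).1
    by_cases h3 : A.OnOverpass (prevZero A.ordinate u)
    · obtain ⟨i, hi⟩ := h3
      rw [overpassEnd_of_mem hi]
      by_contra hn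
      exact hu ⟨i, hi.1.trans h2.le, not_lt.1 hn⟩
    · rwa [overpassEnd_of_not h3]
  · rw [pivot, if_pos h1]
    refine mul_neg_of_pos_of_neg h1 (sub_neg.2 ?_)
    have h2 := (nextZero_mem hc hp (exists_ordinate_eq_zero hD) h0).1
    by_cases h3 : A.OnOverpass (nextZero A.ordinate u)
    · obtain ⟨i, hi⟩ := h3
      rw [overpassEnd_of_mem hi]
      by_contra hn
      exact hu ⟨i, not_lt.1 hn, h2.le.trans hi.2⟩
    · rwa [overpassEnd_of_not h3]

theorem pivot_finish (i : ℤ) : A.pivot (A.φ i) = A.φ i := by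
  have h1 := A.finish_neg hD.periodic i
  rw [pivot, if_neg h1.not_gt, overpassEnd_of_mem
    (prevZero_mem_overpass hD h1 ⟨(A.start_lt_finish i).le, le_rfl⟩)]

end

end Arrangement

/-! ### Heights that turn around the axis -/

/-- A smooth cut-off function: it is `1` for `x ^ 2 ≤ η` and `0` for `2 * η ≤ x ^ 2`. -/
def cutoff (η x : ℝ) : ℝ := Real.smoothTransition (2 - x ^ 2 / η)

section cutoff

variable {η : ℝ} (hη : 0 < η)

theorem cutoff_contDiff (η : ℝ) {n : ℕ∞} : ContDiff ℝ n (cutoff η) :=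
  Real.smoothTransition.contDiff.comp (by fun_prop)

include hη in
theorem cutoff_one {x : ℝ} (hx : x ^ 2 ≤ η) : cutoff η x = 1 := by
  refine Real.smoothTransition.one_of_one_le ?_
  have := (div_le_one hη).2 hx
  linarith

include hη in
theorem cutoff_zero {x : ℝ} (hx : 2 * η ≤ x ^ 2) : cutoff η x = 0 := by
  refine Real.smoothTransition.zero_of_nonpos ?_
  have := (le_div_iff₀ hη).2 hx
  linarith

theorem cutoff_nonneg (η x : ℝ) : 0 ≤ cutoff η x := Real.smoothTransition.nonneg _

theorem cutoff_le_one (η x : ℝ) : cutoff η x ≤ 1 := Real.smoothTransition.le_one _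

include hη in
theorem mul_deriv_cutoff_nonpos (x : ℝ) : x * deriv (cutoff η) x ≤ 0 := by
  have hS : Differentiable ℝ Real.smoothTransition :=
    (Real.smoothTransition.contDiff (n := 1)).differentiable one_ne_zero
  have h1 : HasDerivAt (fun x : ℝ => 2 - x ^ 2 / η) (-(2 * x / η)) x := by
    simpa using ((hasDerivAt_pow 2 x).div_const η).const_sub 2
  have h2 : HasDerivAt (cutoff η) _ x := (hS _).hasDerivAt.comp x h1
  rw [h2.deriv]
  have h3 : 0 ≤ deriv Real.smoothTransition (2 - x ^ 2 / η) :=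
    Real.smoothTransition.monotone.deriv_nonneg
  have h4 : 0 ≤ x * x / η := div_nonneg (mul_self_nonneg x) hη.le
  have h5 : x * (deriv Real.smoothTransition (2 - x ^ 2 / η) * -(2 * x / η)) =
      -(2 * (deriv Real.smoothTransition (2 - x ^ 2 / η) * (x * x / η))) := by ring
  rw [h5]
  have := mul_nonneg h3 h4
  linarith

include hη in
theorem deriv_cutoff_eq_zero {x : ℝ} (hx : 2 * η < x ^ 2) : deriv (cutoff η) x = 0 := by
  have h : cutoff η =ᶠ[nhds x] fun _ => 0 := by
    have h1 : ∀ᶠ v in nhds x, 2 * η < v ^ 2 :=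
      (continuous_pow 2).continuousAt.eventually_const_lt hx
    filter_upwards [h1] with v hv using cutoff_zero hη hv.le
  rw [h.deriv_eq, deriv_const]

end cutoff

/-- Given a periodic function `y` with simple zeros and a function `r` that grows with velocity `1`
away from the zeros, there is a function `g` such that the curve `(y, g)` turns around the origin
with positive velocity and such that `g = y * r` outside a neighbourhood of the zeros. Near a zero
of `y`, the summand `-c * cutoff (y) * sign (y')` dominates. -/
theorem exists_turning_height {y r : ℝ → ℝ} (hy : ContDiff ℝ 1 y) (hp : Periodic y 1)
    (hr : ∀ u, y u ≠ 0 → ∀ᶠ v in nhds u, r v = r u + (v - u)) (hrp : Periodic r 1)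
    (hrb : ∀ u, y u ≠ 0 → |r u| ≤ 2) {δ : ℝ} (hδ : 0 < δ)
    (hδ' : ∀ u, |y u| < δ → deriv y u ≠ 0) :
    ∃ g : ℝ → ℝ, ContDiff ℝ 1 g ∧ Periodic g 1 ∧
      (∀ u, 0 < y u * deriv g u - g u * deriv y u) ∧ ∀ u, δ ≤ |y u| → g u = y u * r u := by
  obtain ⟨η, hη, hηδ⟩ : ∃ η : ℝ, 0 < η ∧ 2 * η < δ ^ 2 := ⟨δ ^ 2 / 4, by positivity, by nlinarith⟩
  have hη2 : 0 < η / 2 := by positivity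
  have hdy := hy.differentiable one_ne_zero
  have hlt : ∀ u, y u ^ 2 ≤ 2 * η → |y u| < δ := fun u hu =>
    lt_of_pow_lt_pow_left₀ 2 hδ.le (by rw [sq_abs]; linarith)
  obtain ⟨C, hC⟩ : ∃ C : ℝ, ∀ x ∈ Icc (-δ) δ, ‖x ^ 2 * deriv (cutoff (η / 2)) x‖ ≤ C :=
    isCompact_Icc.exists_bound_of_continuousOn ((continuous_pow 2).mul
      ((cutoff_contDiff (η / 2) (n := 1)).continuous_deriv le_rfl)).continuousOn
  have hC0 : 0 ≤ C := (norm_nonneg _).trans (hC 0 ⟨by linarith, hδ.le⟩)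
  set s : ℝ → ℝ := fun u => Real.sign (deriv y u) with hs
  set p : ℝ → ℝ := fun u => cutoff η (y u) * s u with hpdef
  set q : ℝ → ℝ := fun u => y u * (1 - cutoff (η / 2) (y u)) * r u with hqdef
  have hs_loc : ∀ u, deriv y u ≠ 0 → ∀ᶠ v in nhds u, s v = s u := by
    intro u hu
    have hc : ContinuousAt (deriv y) u := (hy.continuous_deriv le_rfl).continuousAt
    rcases lt_or_gt_of_ne hu with h | h
    · filter_upwards [hc.eventually_lt_const h] with v hv
      rw [hs]
      simp only [Real.sign_of_neg h, Real.sign_of_neg hv]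
    · filter_upwards [hc.eventually_const_lt h] with v hv
      rw [hs]
      simp only [Real.sign_of_pos h, Real.sign_of_pos hv]
  have hcy : ∀ η' : ℝ, ContDiff ℝ 1 fun u => cutoff η' (y u) :=
    fun η' => (cutoff_contDiff η' (n := 1)).comp hy
  have hcd : ∀ (η' : ℝ) u, HasDerivAt (fun v => cutoff η' (y v))
      (deriv (cutoff η') (y u) * deriv y u) u := fun η' u =>
    ((cutoff_contDiff η' (n := 1)).differentiable one_ne_zero _).hasDerivAt.comp u
      (hdy u).hasDerivAt
  -- The two summands are locally products of `C¹` functions.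
  have hp_loc : ∀ u, p =ᶠ[nhds u] fun v => cutoff η (y v) * s u := by
    intro u
    by_cases hu : y u ^ 2 ≤ 2 * η
    · filter_upwards [hs_loc u (hδ' u (hlt u hu))] with v hv
      rw [hpdef]
      simp only [hv]
    · have h1 : ∀ᶠ v in nhds u, 2 * η < y v ^ 2 :=
        (hy.continuous.pow 2).continuousAt.eventually_const_lt (not_le.1 hu)
      filter_upwards [h1] with v hv
      rw [hpdef]
      simp only [cutoff_zero hη hv.le, zero_mul]
  have hq_loc : ∀ u, q =ᶠ[nhds u] fun v => y v * (1 - cutoff (η / 2) (y v)) * (r u + (v - u)) := by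
    intro u
    by_cases hu : y u = 0
    · have h1 : ∀ᶠ v in nhds u, y v ^ 2 < η / 2 :=
        (hy.continuous.pow 2).continuousAt.eventually_lt_const (by simpa [hu] using hη)
      filter_upwards [h1] with v hv
      rw [hqdef]
      simp only [cutoff_one hη2 hv.le, sub_self, mul_zero, zero_mul]
    · filter_upwards [hr u hu] with v hv
      rw [hqdef]
      simp only [hv]
  have hpC : ContDiff ℝ 1 p := contDiff_iff_contDiffAt.2 fun u =>
    ((hcy η).mul contDiff_const).contDiffAt.congr_of_eventuallyEq (hp_loc u)
  have hqC : ContDiff ℝ 1 q := contDiff_iff_contDiffAt.2 fun u =>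
    ((hy.mul (contDiff_const.sub (hcy (η / 2)))).mul
      (contDiff_const.add (contDiff_id.sub contDiff_const))).contDiffAt.congr_of_eventuallyEq
        (hq_loc u)
  have hpd : ∀ u, deriv p u = deriv (cutoff η) (y u) * deriv y u * s u := fun u => by
    rw [(hp_loc u).deriv_eq]
    exact ((hcd η u).mul_const (s u)).deriv
  have hqd : ∀ u, deriv q u = (deriv y u * (1 - cutoff (η / 2) (y u)) +
      y u * -(deriv (cutoff (η / 2)) (y u) * deriv y u)) * r u +
      y u * (1 - cutoff (η / 2) (y u)) := fun u => by
    rw [(hq_loc u).deriv_eq]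
    have h := ((hdy u).hasDerivAt.fun_mul ((hcd (η / 2) u).const_sub 1)).fun_mul
      (((hasDerivAt_id u).sub_const u).const_add (r u))
    simpa using h.deriv
  have hdp : Periodic (deriv y) 1 := fun u => by
    rw [← deriv_comp_add_const]
    congr 1
    exact funext hp
  have hss : ∀ u, s u * deriv y u = |deriv y u| := fun u => by
    rw [hs]
    rcases lt_trichotomy (deriv y u) 0 with h | h | h
    · simp only [Real.sign_of_neg h, abs_of_neg h, neg_one_mul]
    · simp [h]
    · simp only [Real.sign_of_pos h, abs_of_pos h, one_mul]
  refine ⟨fun u => -((2 * C + 1) * p u) + q u, (contDiff_const.mul hpC).neg.add hqC, fun u => ?_,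
    fun u => ?_, fun u hu => ?_⟩
  · simp only [hpdef, hqdef, hs, hp u, hrp u, hdp u]
  · have hgd : deriv (fun u => -((2 * C + 1) * p u) + q u) u =
        -((2 * C + 1) * deriv p u) + deriv q u :=
      ((((hpC.differentiable one_ne_zero u).hasDerivAt.const_mul (2 * C + 1)).fun_neg).add
        (hqC.differentiable one_ne_zero u).hasDerivAt).deriv
    rw [hgd, hpd, hqd]
    have hkey : y u * (-((2 * C + 1) * (deriv (cutoff η) (y u) * deriv y u * s u)) +
        ((deriv y u * (1 - cutoff (η / 2) (y u)) +
        y u * -(deriv (cutoff (η / 2)) (y u) * deriv y u)) * r u +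
        y u * (1 - cutoff (η / 2) (y u)))) - (-((2 * C + 1) * p u) + q u) * deriv y u =
        (2 * C + 1) * (s u * deriv y u) * (cutoff η (y u) - y u * deriv (cutoff η) (y u)) +
        y u ^ 2 * (1 - cutoff (η / 2) (y u)) -
        r u * deriv y u * (y u ^ 2 * deriv (cutoff (η / 2)) (y u)) := by
      simp only [hpdef, hqdef]
      ring
    rw [hkey, hss]
    have h1 := mul_deriv_cutoff_nonpos hη (y u)
    have h2 := cutoff_nonneg η (y u)
    have h3 := cutoff_le_one (η / 2) (y u)
    by_cases hu : y u ^ 2 ≤ η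
    · have hu' := hlt u (by linarith)
      have h4 : 0 < |deriv y u| := abs_pos.2 (hδ' u hu')
      have h5 := hC (y u) (abs_le.1 hu'.le)
      rw [cutoff_one hη hu]
      have h6 : r u * deriv y u * (y u ^ 2 * deriv (cutoff (η / 2)) (y u)) ≤
          2 * |deriv y u| * C := by
        by_cases h0 : y u = 0
        · simp only [h0, ne_eq, OfNat.ofNat_ne_zero, not_false_eq_true, zero_pow, zero_mul,
            mul_zero]
          positivity
        · refine (le_abs_self _).trans ?_
          rw [abs_mul, abs_mul]
          exact mul_le_mul (mul_le_mul_of_nonneg_right (hrb u h0) h4.le) h5 (abs_nonneg _)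
            (by positivity)
      have h7 : (2 * C + 1) * |deriv y u| * 1 ≤
          (2 * C + 1) * |deriv y u| * (1 - y u * deriv (cutoff η) (y u)) :=
        mul_le_mul_of_nonneg_left (by linarith) (by positivity)
      have h8 : 0 ≤ y u ^ 2 * (1 - cutoff (η / 2) (y u)) :=
        mul_nonneg (sq_nonneg _) (by linarith)
      linarith
    · push Not at hu
      rw [deriv_cutoff_eq_zero hη2 (by linarith), cutoff_zero hη2 (by linarith)]
      have h7 : 0 ≤ (2 * C + 1) * |deriv y u| * (cutoff η (y u) - y u * deriv (cutoff η) (y u)) :=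
        mul_nonneg (by positivity) (by linarith)
      have h8 : 0 < y u ^ 2 := hη.trans hu
      linarith
  · have h1 : δ ^ 2 ≤ y u ^ 2 := by
      rw [← sq_abs (y u)]
      exact pow_le_pow_left₀ hδ.le hu 2
    simp only [hpdef, hqdef, cutoff_zero hη (by linarith : 2 * η ≤ y u ^ 2),
      cutoff_zero hη2 (by linarith : 2 * (η / 2) ≤ y u ^ 2)]
    ring

/-! ### Heights that keep the crossings of the diagram -/

theorem exists_sameParam_mem_Ico (u : ℝ) : ∃ v ∈ Ico (0 : ℝ) 1, SameParam u v :=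
  ⟨Int.fract u, ⟨Int.fract_nonneg u, Int.fract_lt_one u⟩, -⌊u⌋, by
    rw [← Int.self_sub_floor]; push_cast; ring⟩

theorem SameParam.eq_of_mem_Ico {u v : ℝ} (h : SameParam u v) (hu : u ∈ Ico (0 : ℝ) 1)
    (hv : v ∈ Ico (0 : ℝ) 1) : u = v := by
  obtain ⟨n, rfl⟩ := h
  have h1 : (n : ℝ) < 1 := by linarith [hu.1, hv.2]
  have h2 : (-1 : ℝ) < n := by linarith [hu.2, hv.1]
  have h3 : n < 1 := by exact_mod_cast h1
  have h4 : -1 < n := by exact_mod_cast h2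
  have h5 : n = 0 := by omega
  simp [h5]

theorem exists_pos_deriv_ne_zero {y : ℝ → ℝ} (hy : ContDiff ℝ 1 y) (hp : Periodic y 1)
    (hz : ∀ u, y u = 0 → deriv y u ≠ 0) : ∃ δ > 0, ∀ u, |y u| < δ → deriv y u ≠ 0 := by
  have hK : IsCompact (Icc (0 : ℝ) 1 ∩ {u | deriv y u = 0}) :=
    isCompact_Icc.inter_right (isClosed_eq (hy.continuous_deriv le_rfl) continuous_const)
  obtain ⟨δ, hδ, h⟩ := hK.exists_forall_le' (f := fun u => |y u|) hy.continuous.abs.continuousOn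
    (a := 0) fun u hu => abs_pos.2 fun h0 => hz u h0 hu.2
  refine ⟨δ, hδ, fun u hu h0 => ?_⟩
  obtain ⟨v, hv, hs⟩ := exists_sameParam_mem_Ico u
  have hdp : Periodic (deriv y) 1 := fun u => by
    rw [← deriv_comp_add_const]
    congr 1
    exact funext hp
  have h1 := h v ⟨⟨hv.1, hv.2.le⟩, (hs.eq_of_periodic hdp).symm.trans h0⟩
  rw [← hs.eq_of_periodic hp] at h1
  linarith

namespace Arrangement

variable {D : ℝ → Space} {A : Arrangement D}

theorem isCrossing_iff (hD : IsKnotDiagram D) {u : ℝ} :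
    IsCrossing D u ↔ ∃ v, (D u).1 = (D v).1 ∧ ¬ SameParam u v := by
  constructor
  · rintro (⟨v, h1, h2⟩ | ⟨v, h1, h2⟩)
    · refine ⟨v, h1, fun h => h2.ne ?_⟩
      rw [h.eq_of_periodic hD.periodic]
    · refine ⟨v, h1, fun h => h2.ne ?_⟩
      rw [h.eq_of_periodic hD.periodic]
  · rintro ⟨v, h1, h2⟩
    rcases lt_trichotomy (D u).2 (D v).2 with h | h | h
    · exact Or.inr ⟨v, h1, h⟩
    · exact absurd (hD.simple u v (Prod.ext h1 h)) h2
    · exact Or.inl ⟨v, h1, h⟩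

/-- The crossings keep a positive distance from the axis: otherwise two strands that cross
would converge to one point of the axis, near which the diagram is monotone. -/
theorem exists_pos_le_ordinate (hD : IsKnotDiagram D) :
    ∃ δ > 0, ∀ u, IsCrossing D u → δ ≤ |A.ordinate u| := by
  have hy := A.ordinate_contDiff hD.contDiff
  have hp := A.ordinate_periodic hD.periodic
  by_contra hn
  push Not at hn
  have hseq : ∀ n : ℕ, ∃ q : ℝ × ℝ, q ∈ Icc (0 : ℝ) 1 ×ˢ Icc (0 : ℝ) 1 ∧ (D q.1).1 = (D q.2).1 ∧
      ¬ SameParam q.1 q.2 ∧ |A.ordinate q.1| < 1 / ((n : ℝ) + 1) := by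
    intro n
    obtain ⟨u, hu, hu'⟩ := hn (1 / ((n : ℝ) + 1)) (by positivity)
    obtain ⟨v, hv1, hv2⟩ := (isCrossing_iff hD).1 hu
    obtain ⟨u₁, hu₁, hs⟩ := exists_sameParam_mem_Ico u
    obtain ⟨v₁, hv₁, hs'⟩ := exists_sameParam_mem_Ico v
    refine ⟨(u₁, v₁), ⟨⟨hu₁.1, hu₁.2.le⟩, hv₁.1, hv₁.2.le⟩, ?_, ?_, ?_⟩
    · simp only
      rw [← hs.eq_of_periodic hD.periodic, ← hs'.eq_of_periodic hD.periodic, hv1]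
    · rintro ⟨n, hn⟩
      obtain ⟨a, ha⟩ := hs
      obtain ⟨b, hb⟩ := hs'
      simp only at hn
      exact hv2 ⟨a + n - b, by push_cast; linarith⟩
    · simp only
      rwa [← hs.eq_of_periodic hp]
  choose q hq hq1 hq2 hq3 using hseq
  obtain ⟨⟨u, v⟩, -, ψ, hψ, hlim⟩ := (isCompact_Icc.prod isCompact_Icc).tendsto_subseq hq
  have hlu : Filter.Tendsto (fun n => (q (ψ n)).1) Filter.atTop (nhds u) :=
    (continuous_fst.tendsto _).comp hlim
  have hlv : Filter.Tendsto (fun n => (q (ψ n)).2) Filter.atTop (nhds v) :=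
    (continuous_snd.tendsto _).comp hlim
  have hDc : Continuous fun w => (D w).1 := hD.contDiff.fst.continuous
  have huv : (D u).1 = (D v).1 := tendsto_nhds_unique ((hDc.tendsto u).comp hlu)
    (((hDc.tendsto v).comp hlv).congr fun n => (hq1 (ψ n)).symm)
  have hu0 : A.ordinate u = 0 := by
    have h1 := (hy.continuous.abs.tendsto u).comp hlu
    have h2 : Filter.Tendsto (fun n => |A.ordinate (q (ψ n)).1|) Filter.atTop (nhds 0) :=
      squeeze_zero (fun n => abs_nonneg _) (fun n => (hq3 (ψ n)).le)
        (tendsto_one_div_add_atTop_nhds_zero_nat.comp hψ.tendsto_atTop)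
    exact abs_eq_zero.1 (tendsto_nhds_unique h1 h2)
  have hs : SameParam u v := by
    by_contra h
    exact (A.axis_regular u hu0).2 ((isCrossing_iff hD).2 ⟨v, huv, h⟩)
  obtain ⟨m, rfl⟩ := hs
  have hlv' : Filter.Tendsto (fun n => (q (ψ n)).2 - m) Filter.atTop (nhds u) := by
    simpa using hlv.sub_const (m : ℝ)
  have hd : ∀ᶠ w in nhds u, deriv A.ordinate w ≠ 0 :=
    (hy.continuous_deriv le_rfl).continuousAt.eventually_ne (A.deriv_ordinate_ne_zero hu0)
  obtain ⟨r, hr, hball⟩ := Metric.eventually_nhds_iff_ball.1 hd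
  obtain ⟨n, hn1, hn2⟩ := ((hlu.eventually (Metric.ball_mem_nhds u hr)).and
    (hlv'.eventually (Metric.ball_mem_nhds u hr))).exists
  set s := (q (ψ n)).1 with hs
  set t := (q (ψ n)).2 - m with ht
  have hst : A.ordinate s = A.ordinate t := by
    have h1 : A.ordinate t = A.ordinate (q (ψ n)).2 :=
      SameParam.eq_of_periodic hp ⟨m, by rw [ht]; ring⟩
    rw [h1, ordinate, ordinate, hs, hq1]
  have hne : s ≠ t := fun h => hq2 (ψ n) ⟨m, by rw [← hs, h, ht]; ring⟩
  have hin : ∀ w ∈ uIcc s t, deriv A.ordinate w ≠ 0 := fun w hw =>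
    hball w ((convex_ball u r).ordConnected.uIcc_subset hn1 hn2 hw)
  rcases lt_or_gt_of_ne hne with h | h
  · obtain ⟨w, hw, hw0⟩ := exists_deriv_eq_zero h hy.continuous.continuousOn hst
    exact hin w (Icc_subset_uIcc (Ioo_subset_Icc_self hw)) hw0
  · obtain ⟨w, hw, hw0⟩ := exists_deriv_eq_zero h hy.continuous.continuousOn hst.symm
    exact hin w (Icc_subset_uIcc' (Ioo_subset_Icc_self hw)) hw0

/-- Heights with which the diagram turns around the first coordinate axis with positive velocity,
all crossings being kept. -/
theorem exists_braiding_height (hD : IsKnotDiagram D) : ∃ g : ℝ → ℝ, IsHeightChange D g ∧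
    (∀ u, 0 < A.ordinate u * deriv g u - g u * deriv A.ordinate u) ∧ ∀ i, g (A.φ i) = 0 := by
  have hy := A.ordinate_contDiff hD.contDiff
  have hp := A.ordinate_periodic hD.periodic
  obtain ⟨δ₁, hδ₁, h₁⟩ := exists_pos_deriv_ne_zero hy hp fun u hu => A.deriv_ordinate_ne_zero hu
  obtain ⟨δ₂, hδ₂, h₂⟩ := exists_pos_le_ordinate (A := A) hD
  have hδ : 0 < min (min δ₁ δ₂) A.ε := lt_min (lt_min hδ₁ hδ₂) A.ε_pos
  obtain ⟨g, hg, hgp, hturn, hgr⟩ := exists_turning_height (r := fun u => u - A.pivot u) hy hp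
    (fun u hu => by
      filter_upwards [pivot_eventually_eq hD hu] with v hv
      rw [hv]
      ring)
    (fun u => by simp only [pivot_add_one hD]; ring) (fun u hu => abs_sub_pivot_le hD hu) hδ
    (fun u hu => h₁ u (hu.trans_le ((min_le_left _ _).trans (min_le_left _ _))))
  have hcr : ∀ u, IsCrossing D u → g u = A.ordinate u * (u - A.pivot u) := fun u hu =>
    hgr u (((min_le_left _ _).trans (min_le_right _ _)).trans (h₂ u hu))
  refine ⟨g, ⟨hg, hgp, fun u hu => ?_, fun u hu => ?_⟩, hturn, fun i => ?_⟩
  · rw [hcr u (Or.inl hu)]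
    exact mul_sub_pivot_pos hD hu
  · rw [hcr u (Or.inr hu)]
    exact mul_sub_pivot_neg hD hu
  · have h3 := A.finish_lt hD.periodic i
    rw [hgr, pivot_finish hD, sub_self, mul_zero]
    refine (min_le_right _ _).trans ?_
    rw [abs_of_neg (by linarith [A.ε_pos])]
    linarith

theorem finite_zeros (hD : IsKnotDiagram D) :
    {u | u ∈ Ico (0 : ℝ) 1 ∧ A.ordinate u = 0}.Finite := by
  have hy := A.ordinate_contDiff hD.contDiff
  by_contra hinf
  obtain ⟨x, hx, hacc⟩ := Set.Infinite.exists_accPt_of_subset_isCompact hinf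
    (isCompact_Icc (a := (0 : ℝ)) (b := 1)) fun u hu => ⟨hu.1.1, hu.1.2.le⟩
  have hfr := accPt_iff_frequently_nhdsNE.1 hacc
  have h0 : A.ordinate x = 0 := by
    by_contra hx0
    have h1 : ∀ᶠ u in nhds x, A.ordinate u ≠ 0 := hy.continuous.continuousAt.eventually_ne hx0
    exact hfr ((h1.filter_mono nhdsWithin_le_nhds).mono fun u hu h2 => hu h2.2)
  have h1 := (hy.differentiable one_ne_zero x).hasDerivAt.eventually_ne
    (c := 0) (A.deriv_ordinate_ne_zero h0)
  exact hfr (h1.mono fun u hu h2 => hu h2.2)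

end Arrangement

/-! ### Orientations in the plane -/

theorem planeDet_map (f : Plane →L[ℝ] Plane) (v w : Plane) :
    planeDet (f v) (f w) = planeDet (f (1, 0)) (f (0, 1)) * planeDet v w := by
  have h : ∀ v : Plane, f v = v.1 • f (1, 0) + v.2 • f (0, 1) := fun v => by
    rw [← map_smul, ← map_smul, ← map_add]
    congr 1
    ext <;> simp
  rw [h v, h w]
  simp only [planeDet, Prod.fst_add, Prod.snd_add, Prod.smul_fst, Prod.smul_snd, smul_eq_mul]
  ring

theorem planeDet_ne_zero_of_injective {f : Plane →L[ℝ] Plane} (hf : Injective f) :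
    planeDet (f (1, 0)) (f (0, 1)) ≠ 0 := by
  intro h
  have hlin : ∀ v : Plane, f v = v.1 • f (1, 0) + v.2 • f (0, 1) := fun v => by
    rw [← map_smul, ← map_smul, ← map_add]
    congr 1
    ext <;> simp
  have h1 : f ((f (0, 1)).1, -(f (1, 0)).1) = f 0 := by
    rw [hlin, map_zero]
    refine Prod.ext ?_ ?_ <;>
      simp only [planeDet, Prod.fst_add, Prod.snd_add, Prod.smul_fst, Prod.smul_snd, smul_eq_mul,
        Prod.fst_zero, Prod.snd_zero] at h ⊢ <;> linarith
  have h2 : f ((f (0, 1)).2, -(f (1, 0)).2) = f 0 := by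
    rw [hlin, map_zero]
    refine Prod.ext ?_ ?_ <;>
      simp only [planeDet, Prod.fst_add, Prod.snd_add, Prod.smul_fst, Prod.smul_snd, smul_eq_mul,
        Prod.fst_zero, Prod.snd_zero] at h ⊢ <;> linarith
  have h3 := hf h1
  have h4 := hf h2
  have h5 : f (1, 0) = f 0 := by
    rw [map_zero]
    exact Prod.ext (neg_eq_zero.1 (congrArg Prod.snd h3)) (neg_eq_zero.1 (congrArg Prod.snd h4))
  have h6 := congrArg Prod.fst (hf h5)
  simp at h6

/-- The maps of a plane isotopy preserve the orientation. -/
theorem planeDet_fderiv_pos {h : ℝ → Plane → Plane} (H : IsPlaneFamily h) (p : Plane) :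
    0 < planeDet (fderiv ℝ (h 1) p (1, 0)) (fderiv ℝ (h 1) p (0, 1)) := by
  set d : ℝ → ℝ := fun t => planeDet (fderiv ℝ (h t) p (1, 0)) (fderiv ℝ (h t) p (0, 1)) with hd
  have hf : ContinuousOn (fun t : ℝ => fderiv ℝ (h t) p) (Icc 0 1) :=
    H.continuousOn_fderiv.comp (f := fun t : ℝ => (t, p)) (by fun_prop)
      fun t ht => ⟨ht, mem_univ _⟩
  have hc : ContinuousOn d (Icc 0 1) := by
    have h1 := hf.clm_apply (continuousOn_const (c := ((1, 0) : Plane)))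
    have h2 := hf.clm_apply (continuousOn_const (c := ((0, 1) : Plane)))
    exact (h1.fst.mul h2.snd).sub (h1.snd.mul h2.fst)
  have h0 : d 0 = 1 := by
    have : h 0 = id := funext H.zero
    simp [hd, this, planeDet]
  by_contra hn
  push Not at hn
  obtain ⟨t, ht, ht0⟩ := intermediate_value_Icc' zero_le_one hc
    (show (0 : ℝ) ∈ Icc (d 1) (d 0) from ⟨hn, by rw [h0]; norm_num⟩)
  exact planeDet_ne_zero_of_injective (H.fderiv_injective t ht p) ht0

namespace Arrangement

variable {D : ℝ → Space} {A : Arrangement D}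

theorem planar_hasDerivAt {L : ℝ → Space} (hL : ContDiff ℝ 1 L) (u : ℝ) :
    HasDerivAt (fun v => A.h 1 (L v).1) (fderiv ℝ (A.h 1) (L u).1 (planeVel L u)) u :=
  A.isotopy.isPlaneFamily.hasDerivAt_comp one_mem (hL.fst.differentiable one_ne_zero u)

/-- The sign of a crossing can be computed after the plane isotopy. -/
theorem sign_planeDet {K L : ℝ → Space} (hK : ContDiff ℝ 1 K) (hL : ContDiff ℝ 1 L) {u v : ℝ}
    (h : (K u).1 = (L v).1) :
    SignType.sign (planeDet (planeVel K u) (planeVel L v)) =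
    SignType.sign (planeDet (deriv (fun w => A.h 1 (K w).1) u)
      (deriv (fun w => A.h 1 (L w).1) v)) := by
  rw [(A.planar_hasDerivAt hK u).deriv, (A.planar_hasDerivAt hL v).deriv, h, planeDet_map,
    sign_mul, sign_pos (planeDet_fderiv_pos A.isotopy.isPlaneFamily _), one_mul]

theorem planar_deriv_snd {L : ℝ → Space} (hL : ContDiff ℝ 1 L) (u : ℝ) :
    (deriv (fun v => A.h 1 (L v).1) u).2 = deriv (fun v => (A.h 1 (L v).1).2) u := by
  have h := A.planar_hasDerivAt hL u
  have h1 := (hasFDerivAt_snd (𝕜 := ℝ)).comp_hasDerivAt u h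
  rw [h.deriv]
  exact h1.deriv.symm

theorem planar_deriv_fst {L : ℝ → Space} (hL : ContDiff ℝ 1 L) (u : ℝ) :
    (deriv (fun v => A.h 1 (L v).1) u).1 = deriv (fun v => (A.h 1 (L v).1).1) u := by
  have h := A.planar_hasDerivAt hL u
  have h1 := (hasFDerivAt_fst (𝕜 := ℝ)).comp_hasDerivAt u h
  rw [h.deriv]
  exact h1.deriv.symm

end Arrangement

/-! ### Heights of a line through infinity -/

/-- Finitely many values of a compactly supported `C¹` function can be prescribed. -/
theorem exists_contDiff_interpolation (S : Finset ℝ) (c : ℝ → ℝ) : ∃ ζ : ℝ → ℝ,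
    ContDiff ℝ 1 ζ ∧ (∃ R : ℝ, ∀ s, R ≤ |s| → ζ s = 0) ∧ ∀ s ∈ S, ζ s = c s := by
  obtain ⟨r, hr⟩ : ∃ r : ℝ, ∀ s ∈ S, |s| ≤ r :=
    ⟨∑ s ∈ S, |s|, fun s hs => Finset.single_le_sum (fun i _ => abs_nonneg i) hs⟩
  have hr0 : 0 < |r| + 1 := by positivity
  let β : ContDiffBump (0 : ℝ) := ⟨|r| + 1, |r| + 2, hr0, by linarith⟩
  refine ⟨fun s => β s * (Lagrange.interpolate S id c).eval s, ?_, ⟨|r| + 2, fun s hs => ?_⟩,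
    fun s hs => ?_⟩
  · have h1 : ContDiff ℝ 1 fun s => (Lagrange.interpolate S id c).eval s := by
      simpa only [Polynomial.coe_aeval_eq_eval] using
        (Lagrange.interpolate S id c).contDiff_aeval (𝕜 := ℝ) 1
    have h2 : ContDiff ℝ 1 β := β.contDiff
    exact h2.mul h1
  · simp only
    rw [β.zero_of_le_dist (by simpa using hs), zero_mul]
  · have h1 : β s = 1 := by
      refine β.one_of_mem_closedBall ?_
      rw [mem_closedBall_zero_iff, Real.norm_eq_abs]
      linarith [hr s hs, le_abs_self r]
    simp only [h1, one_mul]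
    exact Lagrange.eval_interpolate_at_node c (injective_id.injOn) hs

namespace Arrangement

variable {D : ℝ → Space} {A : Arrangement D}

/-- Where the diagram meets the axis, its planar position determines the parameter. -/
theorem sameParam_of_ordinate_eq_zero (hD : IsKnotDiagram D) {u v : ℝ} (h : A.ordinate u = 0)
    (he : (D u).1 = (D v).1) : SameParam u v := by
  by_contra hn
  exact (A.axis_regular u h).2 ((isCrossing_iff hD).2 ⟨v, he, hn⟩)

theorem planar_injective : Injective (A.h 1) := (A.isotopy.bijective 1 one_mem).1

/-- The crossings of the axis with the diagram can be chosen at will. -/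
theorem exists_line_heights (hD : IsKnotDiagram D) (P : ℝ → Prop)
    (hP : ∀ u v, SameParam u v → (P u ↔ P v)) : ∃ ζ : ℝ → ℝ, ContDiff ℝ 1 ζ ∧
      (∃ R : ℝ, ∀ s, R ≤ |s| → ζ s = 0) ∧
      ∀ u s, A.h 1 (D u).1 = (s, 0) → (P u → ζ s < (D u).2) ∧ (¬ P u → (D u).2 < ζ s) := by
  classical
  let V : ℝ → ℝ := fun u => if P u then (D u).2 - 1 else (D u).2 + 1
  have hV : ∀ u v, SameParam u v → V u = V v := fun u v h => by
    simp only [V, hP u v h, h.eq_of_periodic hD.periodic]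
  let c : ℝ → ℝ := fun s => if h : ∃ u, A.h 1 (D u).1 = (s, 0) then V h.choose else 0
  obtain ⟨ζ, h1, h2, h3⟩ := exists_contDiff_interpolation
    ((finite_zeros (A := A) hD).toFinset.image A.abscissa) c
  refine ⟨ζ, h1, h2, fun u s hus => ?_⟩
  have hu0 : A.ordinate u = 0 := congrArg Prod.snd hus
  have hc : c s = V u := by
    have h : ∃ u, A.h 1 (D u).1 = (s, 0) := ⟨u, hus⟩
    simp only [c, dif_pos h]
    refine (hV _ _ (sameParam_of_ordinate_eq_zero hD hu0 ?_)).symm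
    exact A.planar_injective (hus.trans h.choose_spec.symm)
  have hs : ζ s = V u := by
    rw [← hc]
    refine h3 s ?_
    obtain ⟨v, hv, hs⟩ := exists_sameParam_mem_Ico u
    rw [Finset.mem_image]
    refine ⟨v, ?_, ?_⟩
    · rw [Set.Finite.mem_toFinset]
      exact ⟨hv, (hs.eq_of_periodic (A.ordinate_periodic hD.periodic)).symm.trans hu0⟩
    · rw [← hs.eq_of_periodic (A.abscissa_periodic hD.periodic)]
      exact congrArg Prod.fst hus
  rw [hs]
  constructor <;> intro hPu <;> simp only [V, hPu, if_true, if_false] <;> linarith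

/-- The first coordinate axis, moved back by the plane isotopy. -/
theorem exists_axis (A : Arrangement D) : ∃ γ : ℝ → Plane, ContDiff ℝ 1 γ ∧
    ∀ s, A.h 1 (γ s) = (s, 0) := by
  have hd := A.isotopy.differentiable 1 one_mem
  have hcd : ContDiff ℝ 1 (A.h 1) := contDiff_one_iff_fderiv.2 ⟨hd,
    A.isotopy.continuousOn_fderiv.comp_continuous (f := fun p : Plane => ((1 : ℝ), p))
      (by fun_prop) fun p => ⟨one_mem, mem_univ _⟩⟩
  have hbij := A.isotopy.fderiv_bijective 1 one_mem
  let f' : Plane → Plane ≃L[ℝ] Plane := fun p =>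
    ContinuousLinearEquiv.ofBijective (fderiv ℝ (A.h 1) p)
      (LinearMap.ker_eq_bot.2 (hbij p).1) (LinearMap.range_eq_top.2 (hbij p).2)
  have hf' : ∀ p, HasFDerivAt (A.h 1) (f' p : Plane →L[ℝ] Plane) p := fun p => (hd p).hasFDerivAt
  have hopen : IsOpenMap (A.h 1) := by
    refine isOpenMap_iff_nhds_le.2 fun p => ?_
    exact ((hcd.contDiffAt.hasStrictFDerivAt' (hf' p) one_ne_zero).map_nhds_eq_of_equiv).ge
  let e : Plane ≃ₜ Plane := (Equiv.ofBijective (A.h 1)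
    (A.isotopy.bijective 1 one_mem)).toHomeomorphOfContinuousOpen hcd.continuous hopen
  have hinv : ContDiff ℝ 1 e.symm := e.contDiff_symm (f₀' := f') hf' hcd
  exact ⟨fun s => e.symm (s, 0), hinv.comp (by fun_prop), fun s => e.apply_symm_apply (s, 0)⟩

theorem deriv_planar_axis {T : ℝ → Space} (h : ∀ s, A.h 1 (T s).1 = (s, 0)) (s : ℝ) :
    deriv (fun w => A.h 1 (T w).1) s = (1, 0) := by
  have h1 : (fun w => A.h 1 (T w).1) = fun w => (w, (0 : ℝ)) := funext h
  rw [h1]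
  exact ((hasDerivAt_id s).prodMk (hasDerivAt_const s (0 : ℝ))).deriv

theorem planeDet_ne_zero_of_axis (hD : IsKnotDiagram D) {T : ℝ → Space} (hT : ContDiff ℝ 1 T)
    (h : ∀ s, A.h 1 (T s).1 = (s, 0)) {u s : ℝ} (hus : (D u).1 = (T s).1) :
    planeDet (planeVel D u) (planeVel T s) ≠ 0 := by
  have h0 : A.ordinate u = 0 := by rw [ordinate, hus, h]
  have h1 := sign_planeDet (A := A) hD.contDiff hT hus
  rw [A.deriv_planar_axis h] at h1
  rw [← sign_ne_zero, h1, sign_ne_zero]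
  simp only [planeDet, mul_zero, mul_one, zero_sub, neg_ne_zero, A.planar_deriv_snd hD.contDiff]
  exact A.deriv_ordinate_ne_zero h0

/-- An extended semi-threading circle belongs to every arrangement. -/
theorem exists_isExtendedCircle (hD : IsKnotDiagram D) (A : Arrangement D) :
    ∃ T₀, A.IsExtendedCircle T₀ := by
  obtain ⟨γ, hγ, hγ1⟩ := A.exists_axis
  obtain ⟨ζ, hζ, ⟨R₁, hR₁⟩, hζ1⟩ := A.exists_line_heights hD A.OnOverpass
    fun u v h => A.onOverpass_congr h
  obtain ⟨R₂, hR₂⟩ := A.isotopy.compact_support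
  have hT : ContDiff ℝ 1 fun s => ((γ s, ζ s) : Space) := hγ.prodMk hζ
  have hproj : ∀ s, A.h 1 ((γ s, ζ s) : Space).1 = (s, 0) := hγ1
  have hinj : ∀ u v, γ u = γ v → u = v := fun u v h => by
    have h1 := hγ1 u
    rw [h, hγ1 v] at h1
    exact (congrArg Prod.fst h1).symm
  refine ⟨fun s => (γ s, ζ s), ⟨⟨hT, hinj, fun s h0 => ?_, max R₁ R₂, fun s hs => ?_⟩,
    fun u s hus => ⟨?_, planeDet_ne_zero_of_axis hD hT hproj hus, ?_⟩, hproj, fun u s hus h => ?_,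
    fun u s hus h => ?_⟩⟩
  · have h1 := (A.planar_hasDerivAt hT s).deriv
    rw [A.deriv_planar_axis hproj, h0, map_zero] at h1
    simpa using congrArg Prod.fst h1
  · refine Prod.ext (A.planar_injective ?_) (hR₁ s ((le_max_left _ _).trans hs))
    rw [hproj]
    refine (hR₂ 1 one_mem (s, 0) ?_).symm
    rw [Prod.norm_def]
    simpa using (le_max_right _ _).trans hs
  · have h1 := hζ1 u s (by rw [hus]; exact hγ1 s)
    by_cases h : A.OnOverpass u
    · exact (h1.1 h).ne'
    · exact (h1.2 h).ne
  · refine (A.axis_regular u ?_).2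
    rw [hus]
    exact congrArg Prod.snd (hproj s)
  · exact (hζ1 u s (by rw [hus]; exact hγ1 s)).1 h
  · exact (hζ1 u s (by rw [hus]; exact hγ1 s)).2 h

end Arrangement

/-! ### Linking numbers -/

theorem finsum_mem_int_one {α : Type*} {S : Set α} (hS : S.Finite) {f : α → ℤ}
    (hf : ∀ p ∈ S, f p = 1) : ∑ᶠ p ∈ S, f p = S.ncard := by
  rw [finsum_mem_congr rfl hf, finsum_mem_eq_finite_toFinset_sum _ hS,
    Set.ncard_eq_toFinset_card S hS]
  simp

namespace Arrangement

variable {D : ℝ → Space} {A : Arrangement D}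

/-- The linking number with the axis, passed under at the downward crossings and passed over at the
upward crossings, is the number of downward crossings. -/
theorem lkLine_eq_ncard (hD : IsKnotDiagram D) {T : ℝ → Space} (hT : ContDiff ℝ 1 T)
    (hproj : ∀ s, A.h 1 (T s).1 = (s, 0))
    (hdown : ∀ u s, (D u).1 = (T s).1 → ((T s).2 < (D u).2 ↔ deriv A.ordinate u < 0)) :
    lkLine D T =
      {u | (u ∈ Ico (0 : ℝ) 1 ∧ A.ordinate u = 0) ∧ deriv A.ordinate u < 0}.ncard := by
  set S := {p : ℝ × ℝ | p.1 ∈ Ico (0 : ℝ) 1 ∧ p.2 ∈ (univ : Set ℝ) ∧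
      (D p.1).1 = (T p.2).1 ∧ (T p.2).2 < (D p.1).2} with hS
  set U := {u | (u ∈ Ico (0 : ℝ) 1 ∧ A.ordinate u = 0) ∧ deriv A.ordinate u < 0} with hU
  have hUfin : U.Finite := (finite_zeros hD).subset fun u hu => hu.1
  have hinj : InjOn Prod.fst S := by
    rintro ⟨u, s⟩ hus ⟨u', s'⟩ hus' (rfl : u = u')
    have h1 : A.h 1 (T s).1 = A.h 1 (T s').1 := by rw [← hus.2.2.1, ← hus'.2.2.1]
    rw [hproj, hproj] at h1
    exact Prod.ext rfl (congrArg Prod.fst h1)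
  have himg : Prod.fst '' S = U := by
    ext u
    constructor
    · rintro ⟨⟨u, s⟩, ⟨h1, -, h2, h3⟩, rfl⟩
      refine ⟨⟨h1, ?_⟩, (hdown u s h2).1 h3⟩
      have h4 := hproj s
      rw [← h2] at h4
      exact congrArg Prod.snd h4
    · rintro ⟨⟨h1, h2⟩, h3⟩
      have h4 : (D u).1 = (T (A.abscissa u)).1 := by
        refine A.planar_injective ?_
        rw [hproj, ← h2]
        rfl
      exact ⟨(u, A.abscissa u), ⟨h1, mem_univ _, h4, (hdown u _ h4).2 h3⟩, rfl⟩
  have hSfin : S.Finite := Set.Finite.of_finite_image (himg ▸ hUfin) hinj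
  have hsign : ∀ p ∈ S, ((SignType.sign (planeDet (planeVel D p.1) (planeVel T p.2)) :
      SignType) : ℤ) = 1 := by
    rintro ⟨u, s⟩ ⟨-, -, h2, h3⟩
    have h4 := (hdown u s h2).1 h3
    rw [sign_planeDet (A := A) hD.contDiff hT h2, A.deriv_planar_axis hproj, sign_pos]
    · rfl
    · simp only [planeDet, mul_zero, mul_one, zero_sub, A.planar_deriv_snd hD.contDiff]
      exact neg_pos.2 h4
  rw [lkLine, linkingNumberOn, ← hS, finsum_mem_int_one hSfin hsign, ← himg,
    hinj.ncard_image]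

end Arrangement

/-! ### The stadium -/

theorem stadium_snd_mem {a b ε : ℝ} (hε : 0 < ε) {p : Plane} (hp : p ∈ stadium a b ε) :
    p.2 ∈ Icc (-ε) 0 := by
  have h : (p.1 - max a (min b p.1)) ^ 2 + (p.2 + ε / 2) ^ 2 = (ε / 2) ^ 2 := hp
  have h1 : |p.2 + ε / 2| ≤ ε / 2 :=
    abs_le_of_sq_le_sq (by nlinarith [sq_nonneg (p.1 - max a (min b p.1))]) (by linarith)
  rw [abs_le] at h1
  exact ⟨by linarith, by linarith⟩

theorem stadium_snd_eq {a b ε : ℝ} {p : Plane} (hp : p ∈ stadium a b ε)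
    (hx : a ≤ p.1 ∧ p.1 ≤ b) : p.2 = 0 ∨ p.2 = -ε := by
  have h : (p.1 - max a (min b p.1)) ^ 2 + (p.2 + ε / 2) ^ 2 = (ε / 2) ^ 2 := hp
  rw [min_eq_right hx.2, max_eq_right hx.1, sub_self] at h
  have h1 : p.2 * (p.2 + ε) = 0 := by linarith
  rcases mul_eq_zero.1 h1 with h2 | h2
  · exact Or.inl h2
  · exact Or.inr (by linarith)

namespace Arrangement

variable {D : ℝ → Space} {A : Arrangement D} {M : ℝ → Space}

theorem IsCircle.mem_stadium (hM : A.IsCircle M) (v : ℝ) :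
    A.h 1 (M v).1 ∈ stadium A.a A.b A.ε := hM.range_eq ▸ mem_range_self v

theorem IsCircle.front_or_back (hM : A.IsCircle M) {u v : ℝ} (h : (D u).1 = (M v).1) :
    (A.h 1 (M v).1).2 = 0 ∨ (A.h 1 (M v).1).2 = -A.ε := by
  have h1 := A.ends_free u (by rw [h]; exact hM.mem_stadium v)
  rw [h] at h1
  exact stadium_snd_eq (hM.mem_stadium v) ⟨h1.1.le, h1.2.le⟩

theorem IsCircle.deriv_snd_eq_zero (hM : A.IsCircle M) {v : ℝ} (h : (A.h 1 (M v).1).2 = 0) :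
    deriv (fun w => (A.h 1 (M w).1).2) v = 0 := by
  refine IsLocalMax.deriv_eq_zero (Filter.Eventually.of_forall fun w => ?_)
  simp only [h]
  exact (stadium_snd_mem A.ε_pos (hM.mem_stadium w)).2

/-- Only crossings on the overpasses contribute to the linking number with a minimal semi-threading
circle, each of them with sign `1`. -/
theorem IsCircle.lkCircle_le (hD : IsKnotDiagram D) (hM : A.IsCircle M) : lkCircle D M ≤
    {u | (u ∈ Ico (0 : ℝ) 1 ∧ A.ordinate u = 0) ∧ A.OnOverpass u}.ncard := by
  set S := {p : ℝ × ℝ | p.1 ∈ Ico (0 : ℝ) 1 ∧ p.2 ∈ Ico (0 : ℝ) 1 ∧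
      (D p.1).1 = (M p.2).1 ∧ (M p.2).2 < (D p.1).2} with hS
  set U := {u | (u ∈ Ico (0 : ℝ) 1 ∧ A.ordinate u = 0) ∧ A.OnOverpass u} with hU
  have hUfin : U.Finite := (finite_zeros hD).subset fun u hu => hu.1
  have hinj : InjOn Prod.fst S := by
    rintro ⟨u, s⟩ hus ⟨u', s'⟩ hus' (rfl : u = u')
    refine Prod.ext rfl (SameParam.eq_of_mem_Ico (hM.circle.simple s s' ?_) hus.2.1 hus'.2.1)
    rw [← hus.2.2.1, ← hus'.2.2.1]
  have hfront : ∀ p ∈ S, (A.h 1 (M p.2).1).2 = 0 ∧ A.OnOverpass p.1 := by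
    rintro ⟨u, v⟩ ⟨-, -, h2, h3⟩
    have h4 : (A.h 1 (M v).1).2 = 0 := (hM.front_or_back h2).resolve_right
      fun h => (hM.back_over u v h2 h).not_gt h3
    exact ⟨h4, by_contra fun h => (hM.front_over u v h2 h4 h).not_gt h3⟩
  have himg : Prod.fst '' S ⊆ U := by
    rintro _ ⟨p, hp, rfl⟩
    obtain ⟨h1, h2⟩ := hfront p hp
    refine ⟨⟨hp.1, ?_⟩, h2⟩
    rw [ordinate, hp.2.2.1, h1]
  have hSfin : S.Finite := Set.Finite.of_finite_image (hUfin.subset himg) hinj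
  have hsign : ∀ p ∈ S, ((SignType.sign (planeDet (planeVel D p.1) (planeVel M p.2)) :
      SignType) : ℤ) = 1 := by
    rintro ⟨u, v⟩ hp
    obtain ⟨h1, h2⟩ := hfront _ hp
    have h3 : A.ordinate u = 0 := (himg ⟨_, hp, rfl⟩).1.2
    rw [sign_planeDet (A := A) hD.contDiff hM.circle.contDiff hp.2.2.1, sign_pos]
    · rfl
    · rw [planeDet, A.planar_deriv_snd hD.contDiff, A.planar_deriv_snd hM.circle.contDiff,
        A.planar_deriv_fst hM.circle.contDiff, hM.deriv_snd_eq_zero h1, mul_zero, zero_sub,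
        neg_pos]
      exact mul_neg_of_neg_of_pos (A.deriv_ordinate_neg hD h2 h3) (hM.oriented v h1)
  rw [lkCircle, linkingNumberOn, ← hS, finsum_mem_int_one hSfin hsign]
  rw [← hinj.ncard_image]
  exact_mod_cast Set.ncard_le_ncard himg hUfin

end Arrangement

/-! ### Turning around the origin -/

theorem turnsPositively_mk {a b : ℝ → ℝ} (ha : Differentiable ℝ a) (hb : Differentiable ℝ b) :
    (TurnsPositively fun u => (⟨a u, b u⟩ : ℂ)) ↔
      ∀ u, 0 < a u * deriv b u - b u * deriv a u := by
  refine forall_congr' fun u => ?_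
  rw [(hasDerivAt_complex_mk (ha u).hasDerivAt (hb u).hasDerivAt).deriv]
  simp only [Complex.mul_im, Complex.conj_re, Complex.conj_im]
  ring_nf

theorem TurnsPositively.smul {z : ℝ → ℂ} (h : TurnsPositively z) (hz : Differentiable ℝ z)
    {l : ℝ → ℝ} (hl : Differentiable ℝ l) (hpos : ∀ u, 0 < l u) :
    TurnsPositively fun u => l u • z u := by
  intro u
  have hd : HasDerivAt (fun u => l u • z u) (l u • deriv z u + deriv l u • z u) u :=
    (hl u).hasDerivAt.fun_smul (hz u).hasDerivAt
  rw [hd.deriv]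
  have h1 : ((starRingEnd ℂ) (l u • z u) * (l u • deriv z u + deriv l u • z u)).im =
      l u ^ 2 * ((starRingEnd ℂ) (z u) * deriv z u).im := by
    simp only [Complex.mul_im, Complex.conj_re, Complex.conj_im, Complex.add_re, Complex.add_im,
      Complex.real_smul, Complex.mul_re, Complex.ofReal_re, Complex.ofReal_im]
    ring
  rw [h1]
  exact mul_pos (pow_pos (hpos u) 2) (h u)

theorem TurnsPositively.ne_zero {z : ℝ → ℂ} (h : TurnsPositively z) (u : ℝ) : z u ≠ 0 := by
  intro h0
  have := h u
  simp [h0] at this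

theorem cos_im_eq_one_of_exp_eq {a : ℂ} {c : ℝ} (hc : 0 < c) (h : Complex.exp a = c) :
    Real.cos a.im = 1 := by
  have h1 := congrArg Complex.re h
  have h2 := congrArg Complex.im h
  rw [Complex.exp_re, Complex.ofReal_re] at h1
  rw [Complex.exp_im, Complex.ofReal_im] at h2
  have h3 := (mul_eq_zero.1 h2).resolve_left (Real.exp_pos _).ne'
  have h4 : 0 < Real.cos a.im := by
    by_contra hn
    have := mul_nonpos_of_nonneg_of_nonpos (Real.exp_pos a.re).le (not_lt.1 hn)
    linarith
  have h5 := Real.sin_sq_add_cos_sq a.im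
  rw [h3] at h5
  nlinarith

/-- A closed curve that turns around the origin with positive velocity and has a direction which
it passes only once has every direction only once: its total turning angle is `2 * π`. -/
theorem TurnsPositively.sameParam_of_same_direction {z : ℝ → ℂ} (ht : TurnsPositively z)
    (hz : ContDiff ℝ 1 z) (hp : Periodic z 1) {u₀ : ℝ}
    (h0 : ∀ w, ∀ c : ℝ, 0 < c → z w = c • z u₀ → SameParam u₀ w) {u v c : ℝ} (hc : 0 < c)
    (h : z u = c • z v) : SameParam u v := by
  have hne := ht.ne_zero
  have hcont : Continuous fun w => deriv z w / z w :=
    (hz.continuous_deriv le_rfl).div hz.continuous hne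
  set Λ : ℝ → ℂ := fun w => ∫ x in u₀..w, deriv z x / z x with hΛ
  have hΛd : ∀ w, HasDerivAt Λ (deriv z w / z w) w := fun w =>
    intervalIntegral.integral_hasDerivAt_right (hcont.intervalIntegrable _ _)
      (hcont.stronglyMeasurableAtFilter _ _) hcont.continuousAt
  have hexp : ∀ w, z w = z u₀ * Complex.exp (Λ w) := by
    have hd : ∀ w, HasDerivAt (fun w => z w * Complex.exp (-Λ w)) 0 w := by
      intro w
      have h1 := (hz.differentiable one_ne_zero w).hasDerivAt.fun_mul (hΛd w).fun_neg.cexp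
      refine h1.congr_deriv ?_
      have h2 : z w * (deriv z w / z w) = deriv z w := mul_div_cancel₀ _ (hne w)
      linear_combination (-Complex.exp (-Λ w)) * h2
    intro w
    have h1 := is_const_of_deriv_eq_zero (fun w => (hd w).differentiableAt)
      (fun w => (hd w).deriv) w u₀
    have h2 : Λ u₀ = 0 := intervalIntegral.integral_same
    simp only [h2, neg_zero, Complex.exp_zero, mul_one] at h1
    rw [← h1, mul_assoc, ← Complex.exp_add, neg_add_cancel, Complex.exp_zero, mul_one]
  set Θ : ℝ → ℝ := fun w => (Λ w).im with hΘ
  have hΘd : ∀ w, HasDerivAt Θ (deriv z w / z w).im w := fun w =>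
    Complex.imCLM.hasFDerivAt.comp_hasDerivAt w (hΛd w)
  have hΘmono : StrictMono Θ := by
    refine strictMono_of_deriv_pos fun w => ?_
    rw [(hΘd w).deriv]
    have h1 : (deriv z w / z w).im =
        ((starRingEnd ℂ) (z w) * deriv z w).im / Complex.normSq (z w) := by
      rw [Complex.div_im, Complex.mul_im, Complex.conj_re, Complex.conj_im]
      ring
    rw [h1]
    exact div_pos (ht w) (Complex.normSq_pos.2 (hne w))
  have hΘc : Continuous Θ := continuous_iff_continuousAt.2 fun w => (hΘd w).continuousAt
  have hΘ0 : Θ u₀ = 0 := by simp [hΘ, hΛ]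
  have hone : Θ (u₀ + 1) ≤ 2 * Real.pi := by
    by_contra hn
    push Not at hn
    obtain ⟨w, hw, hw2⟩ := intermediate_value_Ioo (by linarith : u₀ ≤ u₀ + 1) hΘc.continuousOn
      (show 2 * Real.pi ∈ Ioo (Θ u₀) (Θ (u₀ + 1)) from ⟨by rw [hΘ0]; positivity, hn⟩)
    obtain ⟨n, hn⟩ := h0 w (Real.exp (Λ w).re) (Real.exp_pos _) (by
      rw [hexp w, mul_comm, Complex.real_smul]
      congr 1
      refine Complex.ext ?_ ?_
      · have h1 : Real.cos (Λ w).im = 1 := by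
          rw [show (Λ w).im = 2 * Real.pi from hw2, Real.cos_two_pi]
        rw [Complex.exp_re, Complex.ofReal_re, h1, mul_one]
      · have h1 : Real.sin (Λ w).im = 0 := by
          rw [show (Λ w).im = 2 * Real.pi from hw2, Real.sin_two_pi]
        rw [Complex.exp_im, Complex.ofReal_im, h1, mul_zero])
    have h1 : (0 : ℝ) < n := by linarith [hw.1]
    have h2 : (n : ℝ) < 1 := by linarith [hw.2]
    have h3 : 0 < n := by exact_mod_cast h1
    have h4 : n < 1 := by exact_mod_cast h2
    omega
  -- Both parameters are moved to the period that starts at `u₀`.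
  have hmove : ∀ x : ℝ, ∃ x' ∈ Ico u₀ (u₀ + 1), SameParam x x' := fun x =>
    ⟨u₀ + Int.fract (x - u₀), ⟨by linarith [Int.fract_nonneg (x - u₀)],
      by linarith [Int.fract_lt_one (x - u₀)]⟩, -⌊x - u₀⌋, by
        rw [← Int.self_sub_floor]; push_cast; ring⟩
  obtain ⟨u', hu', hsu⟩ := hmove u
  obtain ⟨v', hv', hsv⟩ := hmove v
  have h' : z u' = c • z v' := by
    rw [← hsu.eq_of_periodic hp, ← hsv.eq_of_periodic hp, h]
  have hcos : Real.cos (Λ u' - Λ v').im = 1 := by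
    refine cos_im_eq_one_of_exp_eq hc ?_
    rw [hexp u', hexp v', Complex.real_smul] at h'
    rw [Complex.exp_sub, div_eq_iff (Complex.exp_ne_zero _)]
    refine mul_left_cancel₀ (hne u₀) ?_
    rw [h']
    ring
  have hrange : ∀ x ∈ Ico u₀ (u₀ + 1), 0 ≤ Θ x ∧ Θ x < 2 * Real.pi := fun x hx =>
    ⟨by rw [← hΘ0]; exact hΘmono.monotone hx.1, (hΘmono hx.2).trans_le hone⟩
  have h1 := hrange u' hu'
  have h2 := hrange v' hv'
  have h3 : Θ u' - Θ v' = 0 := (Real.cos_eq_one_iff_of_lt_of_lt (by linarith) (by linarith)).1 hcos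
  have h4 : u' = v' := hΘmono.injective (sub_eq_zero.1 h3)
  obtain ⟨m, hm⟩ := hsu
  obtain ⟨n, hn⟩ := hsv
  exact ⟨m - n, by push_cast; linarith⟩

/-! ### Closed braids in the 3-sphere -/

theorem toSphere_fst_eq (p : Space) : (toSphere p).1 =
    (p.1.1 ^ 2 + p.1.2 ^ 2 + p.2 ^ 2 + 1)⁻¹ •
      (⟨2 * p.1.1, p.1.1 ^ 2 + p.1.2 ^ 2 + p.2 ^ 2 - 1⟩ : ℂ) := by
  rw [Complex.real_smul]
  refine Complex.ext ?_ ?_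
  · rw [Complex.re_ofReal_mul]
    simp only [toSphere]
    ring
  · rw [Complex.im_ofReal_mul]
    simp only [toSphere]
    ring

theorem toSphere_snd_eq (p : Space) : (toSphere p).2 =
    (2 * (p.1.1 ^ 2 + p.1.2 ^ 2 + p.2 ^ 2 + 1)⁻¹) • (⟨p.1.2, p.2⟩ : ℂ) := by
  rw [Complex.real_smul]
  refine Complex.ext ?_ ?_
  · rw [Complex.re_ofReal_mul]
    simp only [toSphere]
    ring
  · rw [Complex.im_ofReal_mul]
    simp only [toSphere]
    ring

theorem norm_factor_differentiable {γ : ℝ → Space} (hγ : Differentiable ℝ γ) :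
    Differentiable ℝ fun u =>
      ((γ u).1.1 ^ 2 + (γ u).1.2 ^ 2 + (γ u).2 ^ 2 + 1)⁻¹ :=
  Differentiable.fun_inv (by fun_prop) fun u => (norm_sq_add_one_pos (γ u)).ne'

/-- A curve in space turns around the first coordinate axis as its projection to the plane of the
other two coordinates turns around the origin. -/
theorem turnsPositively_toSphere_snd {γ : ℝ → Space} (hγ : ContDiff ℝ 1 γ)
    (h : ∀ u, 0 < (γ u).1.2 * deriv (fun v => (γ v).2) u - (γ u).2 * deriv (fun v => (γ v).1.2) u) :
    TurnsPositively fun u => (sphereCurve γ u).2 := by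
  have hd : Differentiable ℝ γ := hγ.differentiable one_ne_zero
  have h1 : Differentiable ℝ fun v => (γ v).2 := by fun_prop
  have h2 : Differentiable ℝ fun v => (γ v).1.2 := by fun_prop
  have h3 := ((turnsPositively_mk h2 h1).2 h).smul
    (fun u => (hasDerivAt_complex_mk (h2 u).hasDerivAt (h1 u).hasDerivAt).differentiableAt)
    ((norm_factor_differentiable hd).const_mul 2)
    fun u => mul_pos two_pos (inv_pos.2 (norm_sq_add_one_pos (γ u)))
  simpa only [sphereCurve, toSphere_snd_eq] using h3

theorem turnsPositively_toSphere_fst {γ : ℝ → Space} (hγ : ContDiff ℝ 1 γ)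
    (h : TurnsPositively fun u =>
      (⟨2 * (γ u).1.1, (γ u).1.1 ^ 2 + (γ u).1.2 ^ 2 + (γ u).2 ^ 2 - 1⟩ : ℂ)) :
    TurnsPositively fun u => (sphereCurve γ u).1 := by
  have hd : Differentiable ℝ γ := hγ.differentiable one_ne_zero
  have h1 : Differentiable ℝ fun u => 2 * (γ u).1.1 := by fun_prop
  have h2 : Differentiable ℝ fun u => (γ u).1.1 ^ 2 + (γ u).1.2 ^ 2 + (γ u).2 ^ 2 - 1 := by fun_prop
  have h3 := h.smul
    (fun u => (hasDerivAt_complex_mk (h1 u).hasDerivAt (h2 u).hasDerivAt).differentiableAt)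
    (norm_factor_differentiable hd) fun u => inv_pos.2 (norm_sq_add_one_pos (γ u))
  simpa only [sphereCurve, toSphere_fst_eq] using h3

theorem IsIsotopic.isSphereLink_right {K T K' T' : ℝ → C2} (h : IsIsotopic K T K' T') :
    IsSphereLink K' T' := by
  obtain ⟨F, G, hl, -, -, -, -, -, -, rfl, rfl⟩ := h
  exact hl 1 (by simp)

/-- A line that the diagram passes over downward and under upward is braided. -/
theorem Arrangement.isBraided_line {D : ℝ → Space} {A : Arrangement D} (hD : IsKnotDiagram D)
    {T : ℝ → Space} (hT : IsLineThroughInfinity T) (hproj : ∀ s, A.h 1 (T s).1 = (s, 0))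
    (hdown : ∀ u s, (D u).1 = (T s).1 → deriv A.ordinate u < 0 → (T s).2 < (D u).2)
    (hup : ∀ u s, (D u).1 = (T s).1 → ¬ deriv A.ordinate u < 0 → (D u).2 < (T s).2) :
    IsBraided (sphereCurve D) (sphereLine T) := by
  obtain ⟨g, hg, hturn, -⟩ := A.exists_braiding_height hD
  have hiso := isIsotopic_line_of_heightChange A.isotopy hD hg hT fun u s hus => by
    have h0 : A.ordinate u = 0 := by rw [ordinate, hus, hproj]
    have h1 := hturn u
    rw [h0, zero_mul, zero_sub, neg_pos] at h1
    by_cases h2 : deriv A.ordinate u < 0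
    · exact Or.inr ⟨hdown u s hus h2, pos_of_mul_neg_left h1 h2.le⟩
    · exact Or.inl ⟨hup u s hus h2, neg_of_mul_neg_left h1 (not_lt.1 h2)⟩
  have haxis : (sphereLine fun s => (A.h 1 (T s).1, 0)) = axisCurve :=
    funext fun u => sphereLine_eq_axisCurve fun _ => by rw [hproj]
  refine ⟨_, _, hiso, hiso.isSphereLink_right, ?_, ?_, ?_⟩
  · intro u
    rw [haxis]
    rfl
  · rw [haxis]
    exact axisCurve_turnsPositively
  · exact turnsPositively_toSphere_snd ((A.planar_contDiff hD.contDiff).prodMk hg.contDiff) hturn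

/-! ### Pushing a curve to the circle `w = 0` -/

/-- The reciprocal of the Euclidean norm. -/
def invNorm (q : C2) : ℝ := (Real.sqrt (‖q.1‖ ^ 2 + ‖q.2‖ ^ 2))⁻¹

theorem isOpen_fst_ne_zero : IsOpen {q : C2 | q.1 ≠ 0} :=
  isOpen_ne_fun continuous_fst continuous_const

theorem norm_sq_add_pos {q : C2} (hq : q.1 ≠ 0) : 0 < ‖q.1‖ ^ 2 + ‖q.2‖ ^ 2 := by
  have := norm_pos_iff.2 hq
  positivity

theorem invNorm_pos {q : C2} (hq : q.1 ≠ 0) : 0 < invNorm q :=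
  inv_pos.2 (Real.sqrt_pos.2 (norm_sq_add_pos hq))

theorem invNorm_contDiffOn : ContDiffOn ℝ 1 invNorm {q : C2 | q.1 ≠ 0} := by
  have h : ContDiff ℝ 1 fun q : C2 => ‖q.1‖ ^ 2 + ‖q.2‖ ^ 2 :=
    (contDiff_fst.norm_sq ℝ).add (contDiff_snd.norm_sq ℝ)
  exact (h.contDiffOn.sqrt fun q hq => (norm_sq_add_pos hq).ne').inv
    fun q hq => (Real.sqrt_pos.2 (norm_sq_add_pos hq)).ne'

theorem invNorm_smul_mem_sphere {q : C2} (hq : q.1 ≠ 0) :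
    ‖(invNorm q • q).1‖ ^ 2 + ‖(invNorm q • q).2‖ ^ 2 = 1 := by
  have h := norm_sq_add_pos hq
  rw [Prod.smul_fst, Prod.smul_snd, norm_smul, norm_smul, mul_pow, mul_pow, ← mul_add, invNorm,
    Real.norm_eq_abs, sq_abs, inv_pow, Real.sq_sqrt h.le, inv_mul_cancel₀ h.ne']

/-- The curve `T` in the 3-sphere, pushed towards the circle `w = 0`. Each point moves on a great
circle orthogonal to `w = 0`; in particular, it stays in its page of the open book. -/
def pushed (T : ℝ → C2) (t u : ℝ) : C2 :=
  invNorm ((T u).1, (1 - t) • (T u).2) • ((T u).1, (1 - t) • (T u).2)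

theorem pushed_family {T : ℝ → C2} (hT : ContDiff ℝ 1 T) (h0 : ∀ u, (T u).1 ≠ 0) :
    C1FamilyOn (pushed T) univ := by
  have h : C1FamilyOn (fun t u => (((T u).1, (1 - t) • (T u).2) : C2)) univ :=
    (C1FamilyOn.const hT.fst univ).prodMk
      ((C1FamilyOn.const hT.snd univ).time_smul (c := fun t => 1 - t) (by fun_prop))
  exact h.comp isOpen_fst_ne_zero (Φ := fun q => invNorm q • q)
    (invNorm_contDiffOn.smul contDiffOn_id) fun t _ u _ => h0 u

/-- If the angle of the first coordinate of `T` has positive velocity and determines the parameter,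
then `T` can be pushed to the circle `w = 0` in the complement of a closed braid
around this circle, provided that the points of the braid are not met on the way. -/
theorem isBraided_of_pushed {K T : ℝ → C2} (hlink : IsSphereLink K T)
    (hK : TurnsPositively fun u => (K u).2) (hT : TurnsPositively fun u => (T u).1)
    (hinj : ∀ u v, ∀ c : ℝ, 0 < c → (T u).1 = c • (T v).1 → SameParam u v)
    (hdisj : ∀ u v, ∀ t ∈ Icc (0 : ℝ) 1, K u ≠ pushed T t v) : IsBraided K T := by
  have h0 := hT.ne_zero
  have hd := hlink.right.contDiff
  have hfam := pushed_family hd h0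
  have hturn : ∀ t, TurnsPositively fun u => (pushed T t u).1 := by
    intro t
    have h1 : ContDiff ℝ 1 fun u => (((T u).1, (1 - t) • (T u).2) : C2) :=
      hd.fst.prodMk (hd.snd.const_smul (1 - t))
    have h2 : ContDiff ℝ 1 fun u => invNorm ((T u).1, (1 - t) • (T u).2) :=
      invNorm_contDiffOn.comp_contDiff h1 h0
    exact hT.smul (hd.fst.differentiable one_ne_zero) (h2.differentiable one_ne_zero)
      fun u => invNorm_pos (h0 u)
  have hfst : ∀ t u v, pushed T t u = pushed T t v → SameParam u v := by
    intro t u v h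
    have h1 := invNorm_pos (q := ((T u).1, (1 - t) • (T u).2)) (h0 u)
    have h2 := invNorm_pos (q := ((T v).1, (1 - t) • (T v).2)) (h0 v)
    have h3 : invNorm ((T u).1, (1 - t) • (T u).2) • (T u).1 =
      invNorm ((T v).1, (1 - t) • (T v).2) • (T v).1 := congrArg Prod.fst h
    refine hinj u v _ (mul_pos (inv_pos.2 h1) h2) ?_
    rw [mul_smul, ← h3, smul_smul, inv_mul_cancel₀ h1.ne', one_smul]
  have hiso : IsIsotopic K T K (pushed T 1) := by
    refine IsIsotopic.of_families (F := fun _ => K) (C1FamilyOn.const hlink.left.contDiff univ)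
      hfam (fun t ht => ⟨hlink.left, ⟨hfam.contDiff ht, fun u => ?_, fun u =>
        invNorm_smul_mem_sphere (h0 u), hfst t, fun u => ?_⟩, fun u v => hdisj u v t ht⟩)
      rfl ?_ rfl rfl
    · simp only [pushed, hlink.right.periodic u]
    · exact deriv_ne_zero_of_fst (hfam.diff t ht u (mem_univ _)) ((hturn t).deriv_ne_zero u)
    · funext u
      have h1 : (((T u).1, (1 - (0 : ℝ)) • (T u).2) : C2) = T u := by
        rw [sub_zero, one_smul]
      rw [pushed, h1, invNorm, hlink.right.mem_sphere u, Real.sqrt_one, inv_one, one_smul]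
  exact ⟨_, _, hiso, hiso.isSphereLink_right, fun u => by simp [pushed], hturn 1, hK⟩

/-! ### Curves around a stadium -/

/-- The nearest point of `[a, b]`. -/
def clamp (a b x : ℝ) : ℝ := max a (min b x)

theorem clamp_mem {a b : ℝ} (hab : a ≤ b) (x : ℝ) : clamp a b x ∈ Icc a b :=
  ⟨le_max_left _ _, max_le hab (min_le_left _ _)⟩

theorem sq_sub_clamp_le {a b : ℝ} (x : ℝ) {q : ℝ} (hq : q ∈ Icc a b) :
    (x - clamp a b x) ^ 2 ≤ (x - q) ^ 2 := by
  rw [clamp]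
  rcases le_total x b with h | h
  · rw [min_eq_right h]
    rcases le_total a x with h' | h'
    · rw [max_eq_right h', sub_self]
      nlinarith [sq_nonneg (x - q)]
    · rw [max_eq_left h']
      nlinarith [hq.1]
  · rw [min_eq_left h, max_eq_right (hq.1.trans hq.2)]
    nlinarith [hq.2]

theorem clamp_of_mem {a b x : ℝ} (h : x ∈ Icc a b) : clamp a b x = x := by
  rw [clamp, min_eq_right h.2, max_eq_right h.1]

theorem clamp_eq_right {a b x : ℝ} (hab : a ≤ b) (h : clamp a b x < x) : clamp a b x = b := by
  rcases le_total x b with h1 | h1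
  · rw [clamp, min_eq_right h1] at h
    exact absurd (le_max_right a x) (not_le.2 h)
  · rw [clamp, min_eq_left h1, max_eq_right hab]

theorem clamp_eq_left {a b x : ℝ} (h : x < clamp a b x) : clamp a b x = a := by
  rcases le_total a x with h1 | h1
  · have h2 : clamp a b x ≤ x := max_le h1 (min_le_right _ _)
    exact absurd h2 (not_le.2 h)
  · rw [clamp, max_eq_left (min_le_of_right_le h1)]

/-- The velocity of a curve that runs around the stadium is perpendicular to the segment from the
nearest point of the core of the stadium. -/
theorem stadium_velocity {a b ε : ℝ} (hab : a ≤ b) (hε : 0 < ε) {p : ℝ → Plane}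
    (hp : ContDiff ℝ 1 p) (hrange : range p = stadium a b ε) (himm : ∀ v, deriv p v ≠ 0)
    (hor : ∀ v, (p v).2 = 0 → 0 < deriv (fun w => (p w).1) v) (v : ℝ) :
    ∃ j > 0, deriv (fun w => (p w).1) v = j * ((p v).2 + ε / 2) ∧
      deriv (fun w => (p w).2) v = -(j * ((p v).1 - clamp a b (p v).1)) := by
  have hd := hp.differentiable one_ne_zero
  have hx : ∀ v, HasDerivAt (fun w => (p w).1) (deriv (fun w => (p w).1) v) v := fun v =>
    (hp.fst.differentiable one_ne_zero v).hasDerivAt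
  have hy : ∀ v, HasDerivAt (fun w => (p w).2) (deriv (fun w => (p w).2) v) v := fun v =>
    (hp.snd.differentiable one_ne_zero v).hasDerivAt
  have hmem : ∀ v, ((p v).1 - clamp a b (p v).1) ^ 2 + ((p v).2 + ε / 2) ^ 2 = (ε / 2) ^ 2 :=
    fun v => (hrange ▸ mem_range_self v : p v ∈ stadium a b ε)
  -- The distance from the nearest point of the core is minimal at `v`.
  have horth : ∀ v, ((p v).1 - clamp a b (p v).1) * deriv (fun w => (p w).1) v +
      ((p v).2 + ε / 2) * deriv (fun w => (p w).2) v = 0 := by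
    intro v
    have hmin : IsLocalMin
        (fun w => ((p w).1 - clamp a b (p v).1) ^ 2 + ((p w).2 + ε / 2) ^ 2) v := by
      refine Filter.Eventually.of_forall fun w => ?_
      simp only
      rw [hmem v, ← hmem w]
      exact add_le_add_left (sq_sub_clamp_le _ (clamp_mem hab _)) _
    have h1 := (((hx v).sub_const (clamp a b (p v).1)).fun_pow 2).fun_add
      (((hy v).add_const (ε / 2)).fun_pow 2)
    have h2 := hmin.hasDerivAt_eq_zero h1
    simp only [Nat.cast_ofNat, Nat.add_one_sub_one, pow_one] at h2
    linarith
  have hclc : Continuous fun v => clamp a b (p v).1 := by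
    unfold clamp
    have := hp.continuous
    fun_prop
  set J : ℝ → ℝ := fun v => ((p v).2 + ε / 2) * deriv (fun w => (p w).1) v -
    ((p v).1 - clamp a b (p v).1) * deriv (fun w => (p w).2) v with hJ
  have hJc : Continuous J := by
    have h1 := hp.fst.continuous_deriv le_rfl
    have h2 := hp.snd.continuous_deriv le_rfl
    have h3 := hp.continuous
    fun_prop
  have hε2 : 0 < (ε / 2) ^ 2 := by positivity
  have hxJ : ∀ v, (ε / 2) ^ 2 * deriv (fun w => (p w).1) v = J v * ((p v).2 + ε / 2) := fun v => by
    rw [← hmem v, hJ]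
    linear_combination ((p v).1 - clamp a b (p v).1) * horth v
  have hyJ : ∀ v, (ε / 2) ^ 2 * deriv (fun w => (p w).2) v =
      -(J v * ((p v).1 - clamp a b (p v).1)) := fun v => by
    rw [← hmem v, hJ]
    linear_combination ((p v).2 + ε / 2) * horth v
  have hJ0 : ∀ v, J v ≠ 0 := by
    intro v h0
    have h1 := hxJ v
    have h2 := hyJ v
    rw [h0, zero_mul] at h1 h2
    have h3 := (mul_eq_zero.1 h1).resolve_left hε2.ne'
    have h4 := (mul_eq_zero.1 (h2.trans neg_zero)).resolve_left hε2.ne'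
    refine himm v ?_
    have h5 := (hx v).prodMk (hy v)
    rw [h3, h4] at h5
    exact h5.deriv
  have hfront : ((a, 0) : Plane) ∈ stadium a b ε := by
    change (a - clamp a b a) ^ 2 + (0 + ε / 2) ^ 2 = (ε / 2) ^ 2
    rw [clamp_of_mem ⟨le_rfl, hab⟩]
    ring
  obtain ⟨v₀, hv₀⟩ := hrange.symm ▸ hfront
  have hJv₀ : 0 < J v₀ := by
    have h1 := hor v₀ (by rw [hv₀])
    have h2 := hxJ v₀
    rw [hv₀, zero_add] at h2
    exact pos_of_mul_pos_left (h2 ▸ mul_pos hε2 h1) (by positivity)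
  have hJpos : 0 < J v :=
    (mul_pos_iff_of_pos_left hJv₀).1 (mul_pos_of_Icc_ne_zero hJc fun c _ => hJ0 c)
  refine ⟨J v / (ε / 2) ^ 2, div_pos hJpos hε2, ?_, ?_⟩
  · rw [div_mul_eq_mul_div, ← hxJ v, mul_div_cancel_left₀ _ hε2.ne']
  · rw [div_mul_eq_mul_div, ← neg_div, ← hyJ v, mul_div_cancel_left₀ _ hε2.ne']

/-- Normalized coordinates of the points of a stadium: after scaling by `α`, the nearest point
of the core has abscissa `Q`, and `(c, s)` is the unit vector from there to the given point, the
second coordinate being reversed. -/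
theorem stadium_coordinates {a b ε α E B : ℝ} (hab : a ≤ b) (hε : 0 < ε) (hα : 0 < α)
    (hE : α * ε / 2 = E) (hB : α * (b - a) / 2 = B) {p : Plane} (hp : p ∈ stadium a b ε) :
    ∃ Q c s : ℝ, c ^ 2 + s ^ 2 = 1 ∧ 0 ≤ Q * c ∧ |Q| ≤ B ∧
      α * (p.1 - (a + b) / 2) = Q + E * c ∧ p.2 = -(ε / 2 * (1 + s)) ∧
      p.1 - clamp a b p.1 = ε / 2 * c := by
  have h : (p.1 - clamp a b p.1) ^ 2 + (p.2 + ε / 2) ^ 2 = (ε / 2) ^ 2 := hp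
  have hcl := clamp_mem hab p.1
  refine ⟨α * (clamp a b p.1 - (a + b) / 2), 2 / ε * (p.1 - clamp a b p.1), -(2 / ε * p.2) - 1,
    ?_, ?_, ?_, ?_, ?_, ?_⟩
  · field_simp
    linarith
  · have h1 : 0 ≤ (clamp a b p.1 - (a + b) / 2) * (p.1 - clamp a b p.1) := by
      rcases lt_trichotomy (clamp a b p.1) p.1 with h1 | h1 | h1
      · have h2 := clamp_eq_right hab h1
        rw [h2] at h1 ⊢
        exact mul_nonneg (by linarith) (by linarith)
      · rw [h1, sub_self, mul_zero]
      · have h2 := clamp_eq_left h1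
        rw [h2] at h1 ⊢
        exact mul_nonneg_of_nonpos_of_nonpos (by linarith) (by linarith)
    have h2 : α * (clamp a b p.1 - (a + b) / 2) * (2 / ε * (p.1 - clamp a b p.1)) =
        α * (2 / ε) * ((clamp a b p.1 - (a + b) / 2) * (p.1 - clamp a b p.1)) := by ring
    rw [h2]
    positivity
  · rw [abs_le, ← hB]
    constructor <;> nlinarith [hcl.1, hcl.2]
  · rw [← hE]
    field_simp
    ring
  · field_simp
    ring
  · field_simp

/-- The angular velocity along the normalized stadium, seen along the great circles through
the point at distance `1` from the axis, is positive. -/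
theorem stadium_turning {Q E c s : ℝ} (hE : 0 < E) (hcs : c ^ 2 + s ^ 2 = 1) (hQ : 0 ≤ Q * c)
    (hX : |Q + E * c| ≤ 1) :
    0 < -(E * s) * ((Q + E * c) ^ 2 - (1 + s) ^ 2 + 1) + 2 * (Q + E * c) * (1 + s) * c := by
  have hX2 : (Q + E * c) ^ 2 ≤ 1 := (sq_le_one_iff_abs_le_one _).2 hX
  have hs : |s| ≤ 1 := (sq_le_one_iff_abs_le_one _).1 (by nlinarith [sq_nonneg c])
  rw [abs_le] at hs
  have h1 : -(E * s) * ((Q + E * c) ^ 2 - (1 + s) ^ 2 + 1) + 2 * (Q + E * c) * (1 + s) * c =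
      2 * (Q * c) * (1 + s) + E * (2 + 2 * s - s ^ 3 - s * (Q + E * c) ^ 2) := by
    linear_combination (2 * E * (1 + s)) * hcs
  rw [h1]
  set X2 := (Q + E * c) ^ 2 with hX2d
  have hX0 : 0 ≤ X2 := sq_nonneg _
  have h2 : 0 < 2 + 2 * s - s ^ 3 - s * X2 := by
    rcases le_total 0 s with h0 | h0
    · have : 0 ≤ s * (2 - s ^ 2 - X2) := mul_nonneg h0 (by nlinarith)
      nlinarith
    · have h3 : 0 ≤ -s * X2 := mul_nonneg (by linarith) hX0
      nlinarith [sq_nonneg (s + 1), sq_nonneg s, mul_nonneg (neg_nonneg.2 h0) (sq_nonneg (s + 1))]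
  have h3 := mul_pos hE h2
  have h4 : 0 ≤ 2 * (Q * c) * (1 + s) := mul_nonneg (by linarith) (by linarith)
  linarith

/-- A point `p` of space, seen in the 3-sphere, that results from pushing `q` towards the
circle `w = 0` is compared with `q` after removal of the denominators. -/
theorem exists_scalar_of_eq_pushed {p q : Space} {l t : ℝ} (hl : 0 < l)
    (h1 : (toSphere p).1 = l • (toSphere q).1)
    (h2 : (toSphere p).2 = l • (1 - t) • (toSphere q).2) :
    ∃ k > 0, 2 * p.1.1 = k * (2 * q.1.1) ∧ p.1.1 ^ 2 + p.1.2 ^ 2 + p.2 ^ 2 - 1 =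
        k * (q.1.1 ^ 2 + q.1.2 ^ 2 + q.2 ^ 2 - 1) ∧
      p.1.2 = k * (1 - t) * q.1.2 ∧ p.2 = k * (1 - t) * q.2 := by
  have hp := norm_sq_add_one_pos p
  have hq := inv_pos.2 (norm_sq_add_one_pos q)
  rw [toSphere_fst_eq, toSphere_fst_eq] at h1
  rw [toSphere_snd_eq, toSphere_snd_eq] at h2
  set P := p.1.1 ^ 2 + p.1.2 ^ 2 + p.2 ^ 2 + 1
  set Q := (q.1.1 ^ 2 + q.1.2 ^ 2 + q.2 ^ 2 + 1)⁻¹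
  have h3 := congrArg Complex.re h1
  have h4 := congrArg Complex.im h1
  have h5 := congrArg Complex.re h2
  have h6 := congrArg Complex.im h2
  simp only [Complex.real_smul, Complex.re_ofReal_mul, Complex.im_ofReal_mul] at h3 h4 h5 h6
  refine ⟨P * (l * Q), by positivity, ?_, ?_, ?_, ?_⟩ <;> field_simp at h3 h4 h5 h6 ⊢ <;> linarith

/-- In the tilted half-plane, pushing a point `(x, ρ)` of the stadium outward does not move it to a
point `(X, σ)` of the front part of the stadium. -/
theorem stadium_no_collision {B X x σ ρ k : ℝ} (hB : B < 1) (hX : |X| < B) (hσ0 : 0 < σ)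
    (hσ1 : σ < 1) (hk : 0 < k) (hσ : σ ≤ k * ρ) (hXx : X = k * x)
    (h : X ^ 2 + σ ^ 2 - 1 = k * (x ^ 2 + ρ ^ 2 - 1)) (hback : |x| ≤ B → ρ = 0 ∨ ρ ^ 2 = 4) :
    False := by
  rcases lt_or_ge k 1 with hk1 | hk1
  · have h1 : σ ^ 2 ≤ (k * ρ) ^ 2 := pow_le_pow_left₀ hσ0.le hσ 2
    rw [hXx] at h
    have h2 : 0 ≤ k * (1 - k) * (x ^ 2 + ρ ^ 2) :=
      mul_nonneg (mul_nonneg hk.le (by linarith)) (by positivity)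
    nlinarith
  · have h1 : |x| ≤ |X| := by
      rw [hXx, abs_mul, abs_of_pos hk]
      nlinarith [abs_nonneg x]
    have h2 : X ^ 2 < 1 := by
      rw [← sq_abs]
      nlinarith [abs_nonneg X]
    rcases hback (h1.trans hX.le) with h3 | h3
    · rw [h3, mul_zero] at hσ
      linarith
    · rw [h3] at h
      nlinarith [sq_nonneg x]

/-- A plane curve, scaled by `α`, centred at `m`, and lifted into a plane of slope `-κ / α` through
the first coordinate axis. -/
def tilted (α κ m : ℝ) (p : ℝ → Plane) (v : ℝ) : Space :=
  ((α * ((p v).1 - m), α * (p v).2), -(κ * (p v).2))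

/-- A parametrization `p` of the stadium, from left to right on the front arc, together
with constants of a normalization: after scaling by `α` and centring, the core of the stadium
extends over `[-B, B]` and its ends have radius `E`. The plane of the stadium is to be tilted about
the first coordinate axis by the angle with cosine `E` and sine `f`, the second coordinate being
kept; then the back arc has distance `2` from the axis. -/
structure IsNormalizedStadium (a b ε α E B f : ℝ) (p : ℝ → Plane) : Prop where
  a_lt_b : a < b
  ε_pos : 0 < ε
  α_pos : 0 < α
  f_pos : 0 < f
  end_eq : α * ε / 2 = E
  core_eq : α * (b - a) / 2 = B
  core_add_end : B + E = 1
  tilt : E ^ 2 + f ^ 2 = 1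
  contDiff : ContDiff ℝ 1 p
  range_eq : range p = stadium a b ε
  immersed : ∀ v, deriv p v ≠ 0
  oriented : ∀ v, (p v).2 = 0 → 0 < deriv (fun w => (p w).1) v
  simple : ∀ u v, p u = p v → SameParam u v

namespace IsNormalizedStadium

variable {a b ε α E B f : ℝ} {p : ℝ → Plane} (S : IsNormalizedStadium a b ε α E B f p)
include S

theorem end_pos : 0 < E := by
  have h1 := S.ε_pos
  have h2 := S.α_pos
  rw [← S.end_eq]
  positivity

theorem core_pos : 0 < B := by
  have h1 := sub_pos.2 S.a_lt_b
  have h2 := S.α_pos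
  rw [← S.core_eq]
  positivity

theorem mem (v : ℝ) : p v ∈ stadium a b ε := S.range_eq ▸ mem_range_self v

theorem scale_eq : α = 2 * E / ε := by
  have h1 := S.ε_pos
  rw [← S.end_eq]
  field_simp

theorem sq_dist_axis (v : ℝ) :
    (tilted α (2 * f / ε) ((a + b) / 2) p v).1.2 ^ 2 +
      (tilted α (2 * f / ε) ((a + b) / 2) p v).2 ^ 2 =
      (2 / ε * (p v).2) ^ 2 := by
  have h := S.scale_eq
  simp only [tilted, h]
  linear_combination (2 / ε * (p v).2) ^ 2 * S.tilt

theorem tilted_contDiff (κ m : ℝ) : ContDiff ℝ 1 (tilted α κ m p) := by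
  have h1 := S.contDiff.fst
  have h2 := S.contDiff.snd
  exact ((contDiff_const.mul (h1.sub contDiff_const)).prodMk (contDiff_const.mul h2)).prodMk
    (contDiff_const.mul h2).neg

/-- The tilted stadium turns with positive angular velocity. -/
theorem turnsPositively : TurnsPositively fun u =>
    (sphereCurve (tilted α (2 * f / ε) ((a + b) / 2) p) u).1 := by
  have hx : ∀ v, HasDerivAt (fun w => (p w).1) (deriv (fun w => (p w).1) v) v := fun v =>
    (S.contDiff.fst.differentiable one_ne_zero v).hasDerivAt
  have hy : ∀ v, HasDerivAt (fun w => (p w).2) (deriv (fun w => (p w).2) v) v := fun v =>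
    (S.contDiff.snd.differentiable one_ne_zero v).hasDerivAt
  have hrad := S.sq_dist_axis
  have hE0 := S.end_pos
  have hα := S.α_pos
  have hε := S.ε_pos
  have hE := S.end_eq
  have hB := S.core_eq
  have hBE := S.core_add_end
  set δ := tilted α (2 * f / ε) ((a + b) / 2) p
  refine turnsPositively_toSphere_fst (S.tilted_contDiff _ _) ?_
  have hA : ∀ v, HasDerivAt (fun v => 2 * (δ v).1.1)
      (2 * (α * deriv (fun w => (p w).1) v)) v := fun v =>
    (((hx v).sub_const _).const_mul α).const_mul 2
  have hR : ∀ v, HasDerivAt (fun v => (δ v).1.1 ^ 2 + (δ v).1.2 ^ 2 + (δ v).2 ^ 2 - 1)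
      (2 * (α * ((p v).1 - (a + b) / 2)) * (α * deriv (fun w => (p w).1) v) +
        2 * (2 / ε) ^ 2 * (p v).2 * deriv (fun w => (p w).2) v) v := fun v => by
    have h1 : (fun v => (δ v).1.1 ^ 2 + (δ v).1.2 ^ 2 + (δ v).2 ^ 2 - 1) =
        fun v => (α * ((p v).1 - (a + b) / 2)) ^ 2 + (2 / ε * (p v).2) ^ 2 - 1 :=
      funext fun v => by rw [add_assoc, hrad]; rfl
    rw [h1]
    refine HasDerivAt.congr_deriv ((((((hx v).sub_const _).const_mul α).fun_pow 2).fun_add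
      (((hy v).const_mul (2 / ε)).fun_pow 2)).sub_const 1) ?_
    simp only [Nat.cast_ofNat, Nat.add_one_sub_one, pow_one]
    ring
  refine (turnsPositively_mk (fun v => (hA v).differentiableAt)
    (fun v => (hR v).differentiableAt)).2 fun v => ?_
  rw [(hA v).deriv, (hR v).deriv, add_assoc ((δ v).1.1 ^ 2), hrad]
  obtain ⟨j, hj, hjx, hjy⟩ := stadium_velocity S.a_lt_b.le hε S.contDiff S.range_eq
    S.immersed S.oriented v
  obtain ⟨Q, c, s, hcs, hQc, hQ, hX, hY, hξ⟩ :=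
    stadium_coordinates S.a_lt_b.le hε hα hE hB (S.mem v)
  have hc : |c| ≤ 1 := (sq_le_one_iff_abs_le_one _).1 (by nlinarith [sq_nonneg s])
  have hX1 : |Q + E * c| ≤ 1 := by
    refine (abs_add_le _ _).trans ?_
    rw [abs_mul, abs_of_pos hE0]
    nlinarith
  have h1 := mul_pos (mul_pos two_pos hj) (stadium_turning hE0 hcs hQc hX1)
  have h2 : (δ v).1.1 = Q + E * c := hX
  have h3 : 2 / ε * (p v).2 = -(1 + s) := by rw [hY]; field_simp
  have h4 : α * deriv (fun w => (p w).1) v = -(j * E * s) := by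
    rw [hjx, hY, ← hE]; ring
  have h5 : 2 * (2 / ε) ^ 2 * (p v).2 * deriv (fun w => (p w).2) v = 2 * (1 + s) * (j * c) := by
    rw [hjy, hξ, hY]; field_simp
  rw [h2, h3, h4, h5, hX]
  refine h1.trans_eq ?_
  ring

theorem front_or_back {v : ℝ} (h : |(tilted α (2 * f / ε) ((a + b) / 2) p v).1.1| ≤ B) :
    (p v).2 = 0 ∨ (p v).2 = -ε := by
  have h3 : (tilted α (2 * f / ε) ((a + b) / 2) p v).1.1 = α * ((p v).1 - (a + b) / 2) := rfl
  rw [h3, ← S.core_eq, abs_le] at h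
  obtain ⟨h1, h2⟩ := h
  refine stadium_snd_eq (S.mem v) ⟨?_, ?_⟩ <;> refine le_of_mul_le_mul_left ?_ S.α_pos <;> linarith

theorem back_eq {v : ℝ} (hv : (p v).2 = -ε) : (2 / ε * (p v).2) ^ 2 = 4 := by
  have hε := S.ε_pos
  rw [hv]
  field_simp
  norm_num

/-- The direction of the first coordinate determines the parameter, because the direction of the
middle point of the front arc is passed only once. -/
theorem sameParam_of_same_direction
    (hK : IsSphereKnot (sphereCurve (tilted α (2 * f / ε) ((a + b) / 2) p)))
    {u v c : ℝ} (hc : 0 < c)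
    (h : (sphereCurve (tilted α (2 * f / ε) ((a + b) / 2) p) u).1 =
      c • (sphereCurve (tilted α (2 * f / ε) ((a + b) / 2) p) v).1) : SameParam u v := by
  have hab := S.a_lt_b
  have hα := S.α_pos
  have hB0 := S.core_pos
  have hrad := S.sq_dist_axis
  have hback := fun v => S.front_or_back (v := v)
  have hfront : (((a + b) / 2, 0) : Plane) ∈ stadium a b ε := by
    change ((a + b) / 2 - clamp a b ((a + b) / 2)) ^ 2 + (0 + ε / 2) ^ 2 = (ε / 2) ^ 2
    rw [clamp_of_mem ⟨by linarith, by linarith⟩]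
    ring
  obtain ⟨v₀, hv₀⟩ := S.range_eq.symm ▸ hfront
  have hδ0 : tilted α (2 * f / ε) ((a + b) / 2) p v₀ = ((0, 0), 0) := by simp [tilted, hv₀]
  have hδ1 : ∀ w, (tilted α (2 * f / ε) ((a + b) / 2) p w).1.1 = α * ((p w).1 - (a + b) / 2) :=
    fun w => rfl
  have hturn := S.turnsPositively
  set δ := tilted α (2 * f / ε) ((a + b) / 2) p
  refine hturn.sameParam_of_same_direction hK.contDiff.fst
    (fun w => congrArg Prod.fst (hK.periodic w)) (u₀ := v₀) (fun w c hc hw => ?_) hc h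
  simp only [sphereCurve, toSphere_fst_eq, hδ0, Complex.real_smul] at hw
  have hn := inv_pos.2 (norm_sq_add_one_pos (δ w))
  have hre := congrArg Complex.re hw
  have him := congrArg Complex.im hw
  simp only [Complex.re_ofReal_mul, Complex.im_ofReal_mul, mul_zero] at hre him
  have h1 : (δ w).1.1 = 0 := by
    have := (mul_eq_zero.1 hre).resolve_left hn.ne'
    linarith
  have h2 : (δ w).1.1 ^ 2 + (δ w).1.2 ^ 2 + (δ w).2 ^ 2 - 1 < 0 := by
    norm_num at him
    by_contra hcon
    have := mul_nonneg hn.le (not_lt.1 hcon)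
    linarith
  rw [add_assoc, hrad, h1] at h2
  rcases hback w (by rw [h1, abs_zero]; exact hB0.le) with h3 | h3
  · refine S.simple _ _ (hv₀.trans (Prod.ext ?_ h3.symm))
    have h4 : α * ((p w).1 - (a + b) / 2) = 0 := (hδ1 w).symm.trans h1
    have h5 := (mul_eq_zero.1 h4).resolve_left hα.ne'
    simp only
    linarith
  · rw [S.back_eq h3] at h2
    norm_num at h2

/-- Pushing the tilted stadium to the circle `w = 0` avoids the points that are outside its
half-plane or in its front part. -/
theorem ne_pushed {q : Space} (hq : (toSphere q).2 ≠ 0)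
    (hpage : q.1.2 < 0 → 0 < q.2 → |q.1.1| < B ∧ q.2 < f) {t : ℝ} (ht : t ∈ Icc (0 : ℝ) 1) (v : ℝ) :
    toSphere q ≠ pushed (sphereCurve (tilted α (2 * f / ε) ((a + b) / 2) p)) t v := by
  intro he
  have hE0 := S.end_pos
  have hf := S.f_pos
  have hε := S.ε_pos
  have hαE := S.scale_eq
  have hl := invNorm_pos (q := ((sphereCurve (tilted α (2 * f / ε) ((a + b) / 2) p) v).1, (1 - t) •
    (sphereCurve (tilted α (2 * f / ε) ((a + b) / 2) p) v).2)) (S.turnsPositively.ne_zero v)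
  obtain ⟨k, hk, hk1re, hk1im, hk2re, hk2im⟩ :=
    exists_scalar_of_eq_pushed hl (congrArg Prod.fst he) (congrArg Prod.snd he)
  have hback := S.front_or_back (v := v)
  set ρ := -(2 / ε * (p v).2) with hρ
  have hY : (tilted α (2 * f / ε) ((a + b) / 2) p v).1.2 = -(E * ρ) := by
    simp only [tilted, hαE, hρ]
    ring
  have hZ : (tilted α (2 * f / ε) ((a + b) / 2) p v).2 = f * ρ := by
    simp only [tilted, hρ]
    ring
  have hρ0 : 0 ≤ ρ := by
    have := (stadium_snd_mem hε (S.mem v)).2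
    have : 2 / ε * (p v).2 ≤ 0 := mul_nonpos_of_nonneg_of_nonpos (by positivity) this
    linarith
  rw [hY] at hk2re hk1im
  rw [hZ] at hk2im hk1im
  set x := (tilted α (2 * f / ε) ((a + b) / 2) p v).1.1
  have ht0 : 0 ≤ 1 - t := by linarith [ht.2]
  have hτ : 0 ≤ k * (1 - t) * ρ := by positivity
  have hσ : k * (1 - t) * ρ ≤ k * ρ := by nlinarith [ht.1, mul_nonneg hk.le hρ0]
  set σ := k * (1 - t) * ρ with hσd
  have hgy : q.1.2 = -(E * σ) := by rw [hk2re, hσd]; ring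
  have hgz : q.2 = f * σ := by rw [hk2im, hσd]; ring
  have hσ0 : 0 < σ := by
    refine hτ.lt_of_ne fun h0 => hq ?_
    rw [toSphere_snd_eq, hgy, hgz, ← h0, mul_zero, mul_zero, neg_zero]
    simp [Complex.ext_iff]
  obtain ⟨hgx, hgf⟩ := hpage (by rw [hgy]; exact neg_neg_of_pos (mul_pos hE0 hσ0))
    (by rw [hgz]; positivity)
  have hσ1 : σ < 1 := by
    rw [hgz] at hgf
    exact lt_of_mul_lt_mul_left (by rwa [mul_one]) hf.le
  have hB1 : B < 1 := by linarith [S.core_add_end]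
  have hxx : q.1.1 = k * x := by linarith
  have hrr : q.1.1 ^ 2 + σ ^ 2 - 1 = k * (x ^ 2 + ρ ^ 2 - 1) := by
    rw [hgy, hgz] at hk1im
    linear_combination hk1im + (k * ρ ^ 2 - σ ^ 2) * S.tilt
  refine stadium_no_collision hB1 hgx hσ0 hσ1 hk hσ hxx hrr fun h => ?_
  rcases hback h with h3 | h3
  · exact Or.inl (by rw [hρ, h3, mul_zero, neg_zero])
  · exact Or.inr (by rw [hρ, neg_sq, S.back_eq h3])

/-- A tilted stadium is braided with a closed braid around the first coordinate axis that meets its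
half-plane only in the front part of the stadium. -/
theorem isBraided {γ : ℝ → Space}
    (hlink : IsSphereLink (sphereCurve γ) (sphereCurve (tilted α (2 * f / ε) ((a + b) / 2) p)))
    (hturn : TurnsPositively fun u => (sphereCurve γ u).2)
    (hγ : ∀ u, (γ u).1.2 < 0 → 0 < (γ u).2 → |(γ u).1.1| < B ∧ (γ u).2 < f) :
    IsBraided (sphereCurve γ) (sphereCurve (tilted α (2 * f / ε) ((a + b) / 2) p)) :=
  isBraided_of_pushed hlink hturn S.turnsPositively
    (fun _ _ _ hc h => S.sameParam_of_same_direction hlink.right hc h)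
    fun u v _ ht => S.ne_pushed (hturn.ne_zero u) (hγ u) ht v

end IsNormalizedStadium

/-! ### Minimal semi-threadings without downward crossings on the underpasses -/

namespace Arrangement

variable {D : ℝ → Space} {A : Arrangement D} {M : ℝ → Space}

/-- If the underpasses cross the axis only upward, then the strands below the axis that lie in the
upper half-space belong to the overpasses: on each arc below the axis, the height changes
its sign at the end of the overpass only. -/
theorem onOverpass_of_height_pos (hD : IsKnotDiagram D)
    (hno : ∀ u, A.ordinate u = 0 → deriv A.ordinate u < 0 → A.OnOverpass u) {g : ℝ → ℝ}
    (hg : ContDiff ℝ 1 g)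
    (hturn : ∀ u, 0 < A.ordinate u * deriv g u - g u * deriv A.ordinate u)
    (hfin : ∀ i, g (A.φ i) = 0) {u : ℝ} (hu : A.ordinate u < 0) (hgu : 0 < g u) :
    A.OnOverpass u := by
  have hy := A.ordinate_contDiff hD.contDiff
  have hd := hy.differentiable one_ne_zero
  have hgd := hg.differentiable one_ne_zero
  have hp := A.ordinate_periodic hD.periodic
  obtain ⟨hl, hl0⟩ := prevZero_mem hy.continuous hp (exists_ordinate_eq_zero hD) hu.ne
  set l := prevZero A.ordinate u with hldef
  have hneg : ∀ c, l < c → c ≤ u → A.ordinate c < 0 := by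
    intro c hc hcu
    have h1 : ∀ x ∈ uIcc u c, A.ordinate x ≠ 0 := by
      intro x hx
      rw [uIcc_of_ge hcu] at hx
      rcases hx.2.eq_or_lt with h | h
      · rw [h]
        exact hu.ne
      · exact ne_zero_of_prevZero_lt h (hc.trans_le hx.1)
    exact neg_of_mul_pos_right (mul_pos_of_Icc_ne_zero hy.continuous h1) hu.le
  have hdown : deriv A.ordinate l < 0 := by
    refine lt_of_le_of_ne ?_ (A.deriv_ordinate_ne_zero hl0)
    by_contra hn
    push Not at hn
    have h1 := eventually_nhdsWithin_sign_eq_of_deriv_pos hn hl0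
    have h2 : ∀ᶠ x in nhdsWithin l (Ioi l), x < u :=
      (eventually_lt_nhds hl).filter_mono nhdsWithin_le_nhds
    obtain ⟨x, ⟨hx1, hx2⟩, hx3⟩ := (((h1.filter_mono nhdsWithin_le_nhds).and h2).and
      self_mem_nhdsWithin).exists
    rw [sign_pos (sub_pos.2 hx3), sign_eq_one_iff] at hx1
    exact (hneg x hx3 hx2.le).not_gt hx1
  obtain ⟨i, hi⟩ := hno l hl0 hdown
  rcases le_or_gt u (A.φ i) with h | h
  · exact ⟨i, hi.1.trans hl.le, h⟩
  · exfalso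
    have hlφ : l < A.φ i := hi.2.lt_of_ne fun h1 => by
      have h2 := A.finish_neg hD.periodic i
      rw [← h1, hl0] at h2
      exact h2.false
    have hne : ∀ c ∈ Icc (A.φ i) u, A.ordinate c < 0 := fun c hc =>
      hneg c (hlφ.trans_le hc.1) hc.2
    have hmono : StrictMonoOn (fun c => g c / A.ordinate c) (Icc (A.φ i) u) := by
      refine strictMonoOn_of_deriv_pos (convex_Icc _ _)
        (hg.continuous.continuousOn.div hy.continuous.continuousOn fun c hc => (hne c hc).ne)
        fun c hc => ?_
      rw [interior_Icc] at hc
      have hc0 := hne c (Ioo_subset_Icc_self hc)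
      have h1 := ((hgd c).hasDerivAt.fun_div (hd c).hasDerivAt hc0.ne).deriv
      rw [h1]
      refine div_pos ?_ (sq_pos_of_neg hc0)
      linarith [hturn c]
    have h1 := hmono (left_mem_Icc.2 h.le) (right_mem_Icc.2 h.le) h
    simp only [hfin, zero_div] at h1
    have h2 := div_neg_of_pos_of_neg hgu hu
    linarith

/-- If the underpasses cross the axis only upward, then the minimal semi-threading is braided. -/
theorem IsCircle.isBraided (hD : IsKnotDiagram D) (hM : A.IsCircle M)
    (hno : ∀ u, A.ordinate u = 0 → deriv A.ordinate u < 0 → A.OnOverpass u) :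
    IsBraided (sphereCurve D) (sphereCurve M) := by
  obtain ⟨g, hg, hturn, hfin⟩ := A.exists_braiding_height hD
  have hab := A.a_lt_b
  have hε := A.ε_pos
  have hba : 0 < A.b - A.a + A.ε := by linarith
  set m := (A.a + A.b) / 2 with hm
  set α := 2 / (A.b - A.a + A.ε) with hα
  set E := A.ε / (A.b - A.a + A.ε) with hE
  have hα0 : 0 < α := by positivity
  have hE0 : 0 < E := by positivity
  have hE1 : E < 1 := by rw [hE, div_lt_one hba]; linarith
  have hf0 : 0 < 1 - E ^ 2 := by nlinarith
  set f := Real.sqrt (1 - E ^ 2) with hf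
  have hfpos : 0 < f := Real.sqrt_pos.2 hf0
  have S : IsNormalizedStadium A.a A.b A.ε α E ((A.b - A.a) / (A.b - A.a + A.ε)) f
      fun v => A.h 1 (M v).1 :=
    { a_lt_b := hab
      ε_pos := hε
      α_pos := hα0
      f_pos := hfpos
      end_eq := by rw [hα, hE]; ring
      core_eq := by rw [hα]; ring
      core_add_end := by rw [hE, ← add_div, div_self hba.ne']
      tilt := by rw [hf, Real.sq_sqrt hf0.le]; ring
      contDiff := A.planar_contDiff hM.circle.contDiff
      range_eq := hM.range_eq
      immersed := fun v h0 => by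
        rw [(A.planar_hasDerivAt hM.circle.contDiff v).deriv] at h0
        exact hM.circle.immersed v
          ((A.isotopy.fderiv_bijective 1 one_mem _).1 (h0.trans (map_zero _).symm))
      oriented := hM.oriented
      simple := fun u v h => hM.circle.simple u v (A.planar_injective h) }
  -- The heights are scaled such that `D` stays below `f`, the height of the points of the tilted
  -- plane at distance `1` from the axis.
  obtain ⟨G, hG⟩ : ∃ G : ℝ, ∀ u, |g u| ≤ G := by
    obtain ⟨G, hG⟩ := (isCompact_Icc (a := (0 : ℝ)) (b := 1)).exists_bound_of_continuousOn
      hg.contDiff.continuous.continuousOn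
    refine ⟨G, fun u => ?_⟩
    obtain ⟨v, hv, hs⟩ := exists_sameParam_mem_Ico u
    rw [hs.eq_of_periodic hg.periodic]
    exact hG v ⟨hv.1, hv.2.le⟩
  have hG0 : 0 < G + 1 := by linarith [(abs_nonneg _).trans (hG 0)]
  set κ := f / (G + 1) with hκ
  have hκ0 : 0 < κ := by positivity
  have hκf : ∀ u, κ * g u < f := fun u => by
    rw [hκ, div_mul_eq_mul_div, div_lt_iff₀ hG0]
    exact mul_lt_mul_of_pos_left (by linarith [le_abs_self (g u), hG u]) hfpos
  have hg' : IsHeightChange D fun u => κ * g u :=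
    ⟨contDiff_const.mul hg.contDiff, fun u => by simp only [hg.periodic u],
      fun u hu => mul_pos hκ0 (hg.pos_of_over u hu),
      fun u hu => mul_neg_of_pos_of_neg hκ0 (hg.neg_of_under u hu)⟩
  have hμ : ContDiff ℝ 1 fun v => -(2 * f / A.ε * (A.h 1 (M v).1).2) :=
    (contDiff_const.mul S.contDiff.snd).neg
  have hiso := isIsotopic_of_heightChange
    (A.isotopy.isPlaneFamily.similarity hα0 (α * m, 0)) hD hg' hM.circle hμ
    (fun v => by simp only [hM.circle.periodic v]) fun u v huv => by
      rcases hM.front_or_back huv with h0 | h0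
      · have hy : A.ordinate u = 0 := by rw [ordinate, huv, h0]
        have h1 := hturn u
        rw [hy, zero_mul, zero_sub, neg_pos] at h1
        rw [h0, mul_zero, neg_zero]
        by_cases hu : A.OnOverpass u
        · exact Or.inr ⟨hM.front_under u v huv h0 hu,
            mul_pos hκ0 (pos_of_mul_neg_left h1 (A.deriv_ordinate_neg hD hu hy).le)⟩
        · refine Or.inl ⟨hM.front_over u v huv h0 hu, mul_neg_of_pos_of_neg hκ0
            (neg_of_mul_neg_left h1 (not_lt.1 fun h => hu (hno u hy h)))⟩
      · refine Or.inl ⟨hM.back_over u v huv h0, (hκf u).trans ?_⟩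
        have h2 : -(2 * f / A.ε * -A.ε) = 2 * f := by field_simp
        rw [h0, h2]
        linarith
  have hDγ : (fun u => ((1 - 1 + 1 * α) • A.h 1 (D u).1 - (1 : ℝ) • ((α * m, 0) : Plane),
      κ * g u)) = fun u => (((α * (A.abscissa u - m), α * A.ordinate u), κ * g u) : Space) := by
    funext u
    refine Prod.ext (Prod.ext ?_ ?_) rfl <;> simp [abscissa, ordinate, mul_sub]
  have hMδ : (fun v => ((1 - 1 + 1 * α) • A.h 1 (M v).1 - (1 : ℝ) • ((α * m, 0) : Plane),
      -(2 * f / A.ε * (A.h 1 (M v).1).2))) =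
      tilted α (2 * f / A.ε) m fun v => A.h 1 (M v).1 := by
    funext v
    refine Prod.ext (Prod.ext ?_ ?_) rfl <;> simp [tilted, mul_sub]
  rw [hDγ, hMδ] at hiso
  have hγC : ContDiff ℝ 1
      fun u => (((α * (A.abscissa u - m), α * A.ordinate u), κ * g u) : Space) :=
    ((contDiff_const.mul ((A.planar_contDiff hD.contDiff).fst.sub contDiff_const)).prodMk
      (contDiff_const.mul (A.ordinate_contDiff hD.contDiff))).prodMk hg'.contDiff
  have hγturn := turnsPositively_toSphere_snd hγC fun u => by
    have h1 := ((hg.contDiff.differentiable one_ne_zero u).hasDerivAt.const_mul κ).deriv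
    have h2 := (((A.ordinate_contDiff hD.contDiff).differentiable one_ne_zero
      u).hasDerivAt.const_mul α).deriv
    simp only [h1, h2]
    have h3 := mul_pos (mul_pos hα0 hκ0) (hturn u)
    linarith
  obtain ⟨K, T, h1, h2⟩ := S.isBraided hiso.isSphereLink_right hγturn fun u hu1 hu2 => by
    refine ⟨?_, hκf u⟩
    have h3 := A.onOverpass_of_height_pos hD hno hg.contDiff hturn hfin
      (neg_of_mul_neg_right hu1 hα0.le) (pos_of_mul_pos_right hu2 hκ0.le)
    have h4 := A.abscissa_mem_Ioo hD.periodic h3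
    simp only
    rw [← S.core_eq, abs_lt, hm]
    constructor <;> nlinarith [h4.1, h4.2]
  exact ⟨K, T, hiso.trans h1, h2⟩

end Arrangement

/-! ### The positive Hopf link -/

/-- The positive Hopf link is the closed braid with one strand together with its axis. -/
theorem isBraided_of_isIsotopic_hopf {K T : ℝ → C2} (h : IsIsotopic K T hopfKnot hopfAxis) :
    IsBraided K T := by
  have hturn : TurnsPositively fun u : ℝ => Complex.exp (2 * Real.pi * u * Complex.I) := by
    intro u
    have h1 : HasDerivAt (fun u : ℝ => 2 * (Real.pi : ℂ) * u * Complex.I)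
        (2 * Real.pi * Complex.I) u := by
      simpa using ((hasDerivAt_id u).ofReal_comp.const_mul (2 * (Real.pi : ℂ))).mul_const Complex.I
    rw [h1.cexp.deriv, ← mul_assoc, ← Complex.normSq_eq_conj_mul_self]
    have h2 : 0 < Complex.normSq (Complex.exp (2 * Real.pi * u * Complex.I)) :=
      Complex.normSq_pos.2 (Complex.exp_ne_zero _)
    rw [Complex.im_ofReal_mul]
    refine mul_pos h2 ?_
    simp [Real.pi_pos]
  exact ⟨_, _, h, h.isSphereLink_right, fun _ => rfl, hturn, hturn⟩

end SemiThreading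

open SemiThreading in
theorem lemma3p5 (D M : ℝ → SemiThreading.Space)
    (hD : SemiThreading.IsKnotDiagram D)
    (hM : SemiThreading.IsMinimalSemiThreadingCircle D M)
    (hnb : ¬ SemiThreading.IsBraided (SemiThreading.sphereCurve D)
      (SemiThreading.sphereCurve M)) :
    (∃ T₀, SemiThreading.IsExtendedCircleOf D M T₀) ∧
    ∀ T₀, SemiThreading.IsExtendedCircleOf D M T₀ →
      ∃ T, SemiThreading.ObtainedByCrossingChanges T₀ T ∧
        SemiThreading.IsThreadingCircle D T ∧
        SemiThreading.lkCircle D M < SemiThreading.lkLine D T := by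
  refine ⟨?_, ?_⟩
  · rcases hM with ⟨-, -, -, hhopf⟩ | ⟨A, hA⟩
    · exact absurd (isBraided_of_isIsotopic_hopf hhopf) hnb
    · obtain ⟨T₀, hT₀⟩ := A.exists_isExtendedCircle hD
      exact ⟨T₀, A, hA, hT₀⟩
  · rintro T₀ ⟨A, hA, hT₀⟩
    have hdp : Periodic (deriv A.ordinate) 1 := fun u => by
      rw [← deriv_comp_add_const]
      congr 1
      exact funext (A.ordinate_periodic hD.periodic)
    obtain ⟨ζ, hζ, ⟨R₁, hR₁⟩, hζ1⟩ := A.exists_line_heights hD (fun u => deriv A.ordinate u < 0)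
      fun u v h => by rw [h.eq_of_periodic hdp]
    obtain ⟨R₂, hR₂⟩ := hT₀.line.straight
    have hproj : ∀ s, A.h 1 (((T₀ s).1, ζ s) : Space).1 = (s, 0) := hT₀.proj_eq
    have hT : ContDiff ℝ 1 fun s => (((T₀ s).1, ζ s) : Space) := hT₀.line.contDiff.fst.prodMk hζ
    have hheights : ∀ u s, (D u).1 = (T₀ s).1 → (deriv A.ordinate u < 0 → ζ s < (D u).2) ∧
        (¬ deriv A.ordinate u < 0 → (D u).2 < ζ s) := fun u s hus =>
      hζ1 u s (by rw [hus]; exact hT₀.proj_eq s)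
    have hlk := A.lkLine_eq_ncard hD hT hproj fun u s hus =>
      ⟨fun h => by_contra fun h1 => ((hheights u s hus).2 h1).not_gt h, (hheights u s hus).1⟩
    -- If every downward crossing of the axis were on an overpass, then `M` would be braided.
    have hlt : {u | (u ∈ Ico (0 : ℝ) 1 ∧ A.ordinate u = 0) ∧ A.OnOverpass u}.ncard <
        {u | (u ∈ Ico (0 : ℝ) 1 ∧ A.ordinate u = 0) ∧ deriv A.ordinate u < 0}.ncard := by
      refine Set.ncard_lt_ncard ?_ ((A.finite_zeros hD).subset fun u hu => hu.1)
      refine ⟨fun u hu => ⟨hu.1, A.deriv_ordinate_neg hD hu.2 hu.1.2⟩, fun hsub => hnb ?_⟩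
      refine hA.isBraided hD fun u hu0 hu1 => ?_
      obtain ⟨v, hv, hs⟩ := exists_sameParam_mem_Ico u
      refine (A.onOverpass_congr hs).2 (hsub (a := v) ⟨⟨hv, ?_⟩, ?_⟩).2
      · rw [← hs.eq_of_periodic (A.ordinate_periodic hD.periodic), hu0]
      · rwa [← hs.eq_of_periodic hdp]
    have hline : IsLineThroughInfinity fun s => (((T₀ s).1, ζ s) : Space) := by
      refine ⟨hT, hT₀.line.simple, hT₀.line.immersed, max R₁ R₂, fun s hs => ?_⟩
      rw [hR₁ s ((le_max_left _ _).trans hs), hR₂ s ((le_max_right _ _).trans hs)]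
    refine ⟨fun s => ((T₀ s).1, ζ s), fun s => rfl, ⟨hline, fun u s hus => ⟨?_, ?_⟩, ?_, ?_⟩, ?_⟩
    · by_cases h : deriv A.ordinate u < 0
      · exact ((hheights u s hus).1 h).ne'
      · exact ((hheights u s hus).2 h).ne
    · exact (hT₀.regular u s hus).2
    · rw [hlk, Nat.cast_pos]
      exact (Nat.zero_le _).trans_lt hlt
    · exact A.isBraided_line hD hline hproj (fun u s hus => (hheights u s hus).1)
        fun u s hus => (hheights u s hus).2
    · rw [hlk]
      exact (hA.lkCircle_le hD).trans_lt (Nat.cast_lt.2 hlt)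
end
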